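/- **Conventions.** Let $F$ be a number field with a fixed algebraic closure $\Omega$; all extensions of $F$ are taken inside $\Omega$ and $\mathrm{Gal}_k=\mathrm{Gal}(\Omega/k)$. Let $E/F$ be a finite Galois extension, $\ell$ a prime and $\rho:\mathrm{Gal}_E\to \mathrm{GL}_2(\bar{\mathbb{Q}}_\ell)$ a continuous representation. For a continuous homomorphism $\psi$ on $\mathrm{Gal}_E$ and $\zeta\in\mathrm{Gal}(E/F)$ put $\psi^\zeta(g)=\psi(\tilde\zeta^{-1}g\tilde\zeta)$, where $\tilde\zeta\in\mathrm{Gal}_F$ is a lift of $\zeta$; for representations and characters this is independent of the lift up to isomorphism. Write $\rho_1\sim\rho_2$ if the projective representations $\mathrm{Gal}_E\to\mathrm{PGL}_2(\bar{\mathbb{Q}}_\ell)$ attached to $\rho_1$ and $\rho_2$ are isomorphic, that is, conjugate under $\mathrm{PGL}_2(\bar{\mathbb{Q}}_\ell)$. Let $\mathrm{Gal}(E/F)_\rho$ be the stabilizer of the class of $\rho$, that is, the subgroup of all $\xi$ with $\rho^\xi\sim\rho$, and put $m=|\mathrm{Gal}(E/F)_\rho|$. The algebraic envelope of $\rho$ is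 the smallest algebraic subgroup of $\mathrm{GL}_2$ over $\bar{\mathbb{Q}}_\ell$ whose $\bar{\mathbb{Q}}_\ell$-points contain $\rho(\mathrm{Gal}_E)$. The number of one-dimensional subrepresentations of a finite-dimensional representation is counted with multiplicity: it is the largest number of one-dimensional subrepresentations whose sum is direct, equivalently the dimension of the sum of all of them. **Proposition.** Suppose that the algebraic envelope of $\rho$ contains $\mathrm{SL}_2$. Then there are continuous characters $\chi(\xi):\mathrm{Gal}_E\to\bar{\mathbb{Q}}_\ell^\times$, for $\xi\in\mathrm{Gal}(E/F)_\rho$, such that $\rho^\xi\cong\rho\otimes\chi(\xi)$ for each $\xi$. For any finite extension $k/E$, the number of one-dimensional subrepresentations of $$\bigotimes_{\zeta\in\mathrm{Gal}(E/F)}\rho^\zeta\Big|_{\mathrm{Gal}_k}$$ is $0$ if $m$ is odd, and is $$\left(\binom{m}{m/2}-\binom{m}{m/2-1}\right)^{[E:F]/m}$$ if $m$ is even. If $m$ is even, then for any such characters $\chi(\xi)$ and any choice of representatives of the left cosets $\mu$ of $\mathrm{Gal}(E/F)_\rho$, each one-dimensional subrepresentation is isomorphic to $$\prod_{\mu\in\mathrm{Gal}(E/F)/\mathrm{Gal}(E/F)_\rho}\left(\det(\rho)^{m/2}\prod_{\xi\in\mathrm{Gal}(E/F)_\rho}\chi(\xi)\right)^{\mu}\Bigg|_{\mathrm{Gal}_k}.$$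 -/

import Mathlib

open scoped TensorProduct MatrixGroups

noncomputable section

namespace TensorGalois

/-! ### One-dimensional subrepresentations -/

section Count

variable {K G V : Type*} [Field K] [Group G] [AddCommGroup V] [Module K V]

/-- The subrepresentation `W` is one-dimensional. -/
def IsOneDim {σ : Representation K G V} (W : Subrepresentation σ) : Prop :=
  Module.finrank K W.toSubmodule = 1

/-- The number of one-dimensional subrepresentations of `σ`, counted with multiplicity: the
dimension of the sum of all of them. As `isGreatest_numOneDim` shows, it is the largest number of
one-dimensional subrepresentations whose sum is direct. -/
def numOneDim (σ : Representation K G V) : ℕ :=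
  Module.finrank K
    (⨆ W : {W : Subrepresentation σ // IsOneDim W}, W.1.toSubmodule : Submodule K V)

theorem isGreatest_numOneDim [FiniteDimensional K V] (σ : Representation K G V) :
    IsGreatest {n : ℕ | ∃ W : Fin n → Subrepresentation σ,
      (∀ i, IsOneDim (W i)) ∧ iSupIndep fun i => (W i).toSubmodule} (numOneDim σ) := by
  classical
  constructor
  · set S : Set V :=
      ⋃ W : {W : Subrepresentation σ // IsOneDim W}, (W.1.toSubmodule : Set V) with hS
    obtain ⟨b, hbS, hspan, hb⟩ := exists_linearIndependent K S
    have hsup : (⨆ W : {W : Subrepresentation σ // IsOneDim W}, W.1.toSubmodule) =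
        Submodule.span K b := by
      rw [hspan, hS, Submodule.span_iUnion]
      simp
    have hfin : Finite b := hb.finite
    have := Fintype.ofFinite b
    have hcard : Fintype.card b = numOneDim σ := by
      rw [numOneDim, hsup]
      have := finrank_span_eq_card hb
      rw [Subtype.range_coe] at this
      exact this.symm
    let e : Fin (numOneDim σ) ≃ b := (Fintype.equivFinOfCardEq hcard).symm
    have hW : ∀ x : b, ∃ W : Subrepresentation σ, IsOneDim W ∧ W.toSubmodule = K ∙ (x : V) := by
      intro x
      obtain ⟨W, hxW⟩ := Set.mem_iUnion.1 (hbS x.2)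
      refine ⟨W.1, W.2, ?_⟩
      have hx0 : (x : V) ≠ 0 := hb.ne_zero x
      have h1 : Module.finrank K W.1.toSubmodule = 1 := W.2
      refine (Submodule.eq_of_le_of_finrank_eq ?_ ?_).symm
      · simpa using hxW
      · rw [h1, finrank_span_singleton hx0]
    choose W hW1 hW2 using hW
    refine ⟨fun i => W (e i), fun i => hW1 _, ?_⟩
    have hind := (hb.comp e e.injective).iSupIndep_span_singleton
    simpa [hW2] using hind
  · rintro n ⟨W, hW1, hW2⟩
    have hv : ∀ i, ∃ v ∈ (W i).toSubmodule, v ≠ 0 := by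
      intro i
      apply Submodule.exists_mem_ne_zero_of_ne_bot
      intro h
      have h1 : Module.finrank K (W i).toSubmodule = 1 := hW1 i
      rw [h] at h1
      simp at h1
    choose v hv hv0 using hv
    have hli : LinearIndependent K v := hW2.linearIndependent _ hv hv0
    have := finrank_span_eq_card hli
    rw [Fintype.card_fin] at this
    rw [← this]
    apply Submodule.finrank_mono
    rw [Submodule.span_le]
    rintro _ ⟨i, rfl⟩
    exact Submodule.mem_iSup_of_mem (p := fun W : {W : Subrepresentation σ // IsOneDim W} =>
      W.1.toSubmodule) ⟨W i, hW1 i⟩ (hv i)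

/-- A character, as a representation on `K`. -/
def charRep (ψ : G →* Kˣ) : Representation K G K where
  toFun g := LinearMap.lsmul K K (ψ g : K)
  map_one' := by ext; simp
  map_mul' a b := by ext; simp

end Count

/-! ### Algebraic envelopes -/

section Envelope

variable {K : Type*} [Field K] {n : ℕ}

/-- A subgroup of `GL_n(K)` is algebraic if it is the zero locus of polynomials in the matrix
entries (inverting the determinant gives no further loci). If `K` is algebraically closed of
characteristic zero, these are the groups of `K`-points of the algebraic subgroups of `GL_n`,
and each of them determines its algebraic group. -/
def IsAlgebraicSubgroup (H : Subgroup (GL (Fin n) K)) : Prop :=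
  ∃ I : Set (MvPolynomial (Fin n × Fin n) K),
    ∀ g : GL (Fin n) K, g ∈ H ↔
      ∀ p ∈ I, MvPolynomial.eval (fun ij : Fin n × Fin n => (g : Matrix _ _ K) ij.1 ij.2) p = 0

/-- The (points of the) smallest algebraic subgroup of `GL_n` containing `A`. -/
def algebraicEnvelope (A : Subgroup (GL (Fin n) K)) : Subgroup (GL (Fin n) K) :=
  sInf {H | IsAlgebraicSubgroup H ∧ A ≤ H}

theorem isLeast_algebraicEnvelope (A : Subgroup (GL (Fin n) K)) :
    IsLeast {H | IsAlgebraicSubgroup H ∧ A ≤ H} (algebraicEnvelope A) := by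
  refine ⟨⟨?_, le_sInf fun H hH => hH.2⟩, fun H hH => sInf_le hH⟩
  refine ⟨{p | ∃ H : Subgroup (GL (Fin n) K), A ≤ H ∧ ∃ I : Set (MvPolynomial (Fin n × Fin n) K),
    (∀ g : GL (Fin n) K, g ∈ H ↔ ∀ p ∈ I,
      MvPolynomial.eval (fun ij : Fin n × Fin n => (g : Matrix _ _ K) ij.1 ij.2) p = 0) ∧ p ∈ I},
    fun g => ?_⟩
  rw [algebraicEnvelope, Subgroup.mem_sInf]
  constructor
  · rintro h p ⟨H, hA, I, hI, hp⟩
    exact (hI g).1 (h H ⟨⟨I, hI⟩, hA⟩) p hp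
  · rintro h H ⟨⟨I, hI⟩, hA⟩
    exact (hI g).2 fun p hp => h p ⟨H, hA, I, hI, hp⟩

/-- `SL_n`, as a subgroup of `GL_n`. -/
def SLsub (n : ℕ) (K : Type*) [Field K] : Subgroup (GL (Fin n) K) :=
  (Matrix.SpecialLinearGroup.toGL : Matrix.SpecialLinearGroup (Fin n) K →* GL (Fin n) K).range

end Envelope

/-! ### Two-dimensional representations of topological groups -/

section Rep

variable {Γ K : Type*} [Group Γ] [TopologicalSpace Γ] [Field K] [TopologicalSpace K]

/-- Isomorphism of two-dimensional representations. -/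
def IsIso (ρ₁ ρ₂ : Γ →ₜ* GL (Fin 2) K) : Prop :=
  ∃ a : GL (Fin 2) K, ∀ g, ρ₂ g = a * ρ₁ g * a⁻¹

/-- The relation `ρ₁ ∼ ρ₂`: the representations `Pρ₁, Pρ₂ : Γ → PGL_2(K)` are isomorphic. -/
def ProjEquiv (ρ₁ ρ₂ : Γ →ₜ* GL (Fin 2) K) : Prop :=
  ∃ a : PGL(2, K), ∀ g,
    Matrix.ProjGenLinGroup.mk (ρ₂ g) = a * Matrix.ProjGenLinGroup.mk (ρ₁ g) * a⁻¹

theorem projEquiv_equivalence :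
    Equivalence (ProjEquiv : (Γ →ₜ* GL (Fin 2) K) → (Γ →ₜ* GL (Fin 2) K) → Prop) where
  refl ρ := ⟨1, fun g => by simp⟩
  symm := by
    rintro ρ₁ ρ₂ ⟨a, ha⟩
    exact ⟨a⁻¹, fun g => by rw [ha g]; group⟩
  trans := by
    rintro ρ₁ ρ₂ ρ₃ ⟨a, ha⟩ ⟨b, hb⟩
    exact ⟨b * a, fun g => by rw [hb g, ha g]; group⟩

/-- The tensor product over `i : ι` of the two-dimensional representations `ρ i`. -/
def tensorRep {ι : Type*} (ρ : ι → (Γ →ₜ* GL (Fin 2) K)) :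
    Representation K Γ (⨂[K] _ : ι, (Fin 2 → K)) where
  toFun g := PiTensorProduct.map fun i => (ρ i g : Matrix (Fin 2) (Fin 2) K).mulVecLin
  map_one' := by
    simp only [map_one, Units.val_one, Matrix.mulVecLin_one]
    exact PiTensorProduct.map_id
  map_mul' g h := by
    simp only [map_mul, Units.val_mul, Matrix.mulVecLin_mul]
    exact PiTensorProduct.map_comp _ _

theorem continuous_scalar :
    Continuous (Matrix.GeneralLinearGroup.scalar (Fin 2) : Kˣ → GL (Fin 2) K) := by
  refine Continuous.units_map (Matrix.scalar (Fin 2) : K →+* Matrix (Fin 2) (Fin 2) K).toMonoidHom ?_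
  refine continuous_matrix fun i j => ?_
  by_cases h : i = j
  · subst h; simpa using continuous_id'
  · simpa [h] using continuous_const

variable [IsTopologicalRing K]

/-- The twist `ρ ⊗ χ`. -/
def twist (ρ : Γ →ₜ* GL (Fin 2) K) (χ : Γ →ₜ* Kˣ) : Γ →ₜ* GL (Fin 2) K where
  toFun g := Matrix.GeneralLinearGroup.scalar (Fin 2) (χ g) * ρ g
  map_one' := by simp
  map_mul' g h := by
    have hc : ∀ (u : Kˣ) (x : GL (Fin 2) K), x * Matrix.GeneralLinearGroup.scalar (Fin 2) u =
        Matrix.GeneralLinearGroup.scalar (Fin 2) u * x := by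
      intro u x
      ext i j
      simp [Matrix.GeneralLinearGroup.scalar, mul_comm]
    rw [map_mul, map_mul, map_mul, mul_assoc, mul_assoc, ← mul_assoc (ρ g), hc, mul_assoc]
  continuous_toFun :=
    (continuous_scalar.comp χ.continuous_toFun).mul ρ.continuous_toFun

/-- The character `det ρ`. -/
def detChar (ρ : Γ →ₜ* GL (Fin 2) K) : Γ →ₜ* Kˣ where
  toFun g := Matrix.GeneralLinearGroup.det (ρ g)
  map_one' := by simp
  map_mul' g h := by simp
  continuous_toFun := Matrix.GeneralLinearGroup.continuous_det.comp ρ.continuous_toFun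

end Rep

/-! ### Galois conjugation

`Ω` is a field extension of `F` and `E` is an intermediate field, normal over `F`. When `Ω` is an
algebraic closure of `F`, the group `E.fixingSubgroup`, with the topology induced by the Krull
topology, is the absolute Galois group of `E`. -/

section Conj

variable {F Ω : Type*} [Field F] [Field Ω] [Algebra F Ω] (E : IntermediateField F Ω) [Normal F E]

/-- Conjugation `g ↦ σ⁻¹ g σ` on `Gal(Ω/E)`, for `σ ∈ Gal(Ω/F)`. -/
def conjAut (σ : Gal(Ω/F)) : E.fixingSubgroup →ₜ* E.fixingSubgroup where
  toFun g := ⟨σ⁻¹ * g * σ, by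
    have hn : E.fixingSubgroup.Normal := by
      rw [← IntermediateField.restrictNormalHom_ker E]; infer_instance
    simpa using hn.conj_mem g.1 g.2 σ⁻¹⟩
  map_one' := by ext; simp
  map_mul' g h := by apply Subtype.ext; simp [mul_assoc]
  continuous_toFun := by
    refine Continuous.subtype_mk ?_ _
    exact (continuous_const.mul continuous_subtype_val).mul continuous_const

variable {E} {A : Type*} [Monoid A] [TopologicalSpace A]

/-- The conjugate `g ↦ ψ(σ⁻¹ g σ)` of a homomorphism `ψ` on `Gal(Ω/E)` by `σ ∈ Gal(Ω/F)`.
Up to isomorphism it depends only on `ζ = σ|_E`, and is then denoted by `ψ^ζ`. -/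
def conj (σ : Gal(Ω/F)) (ψ : E.fixingSubgroup →ₜ* A) : E.fixingSubgroup →ₜ* A :=
  ψ.comp (conjAut E σ)

theorem conj_apply (σ : Gal(Ω/F)) (ψ : E.fixingSubgroup →ₜ* A) (g : E.fixingSubgroup) :
    conj σ ψ g = ψ (conjAut E σ g) := rfl

theorem conj_one (ψ : E.fixingSubgroup →ₜ* A) : conj 1 ψ = ψ := by
  refine ContinuousMonoidHom.ext fun g => congrArg ψ (Subtype.ext ?_)
  change (1 : Gal(Ω/F))⁻¹ * g * 1 = (g : Gal(Ω/F))
  group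

theorem conj_mul (σ τ : Gal(Ω/F)) (ψ : E.fixingSubgroup →ₜ* A) :
    conj (σ * τ) ψ = conj σ (conj τ ψ) := by
  refine ContinuousMonoidHom.ext fun g => congrArg ψ (Subtype.ext ?_)
  change (σ * τ)⁻¹ * (g : Gal(Ω/F)) * (σ * τ) = τ⁻¹ * (σ⁻¹ * g * σ) * τ
  group

variable {K : Type*} [Field K] [TopologicalSpace K]

theorem ProjEquiv.conj {ρ₁ ρ₂ : E.fixingSubgroup →ₜ* GL (Fin 2) K} (h : ProjEquiv ρ₁ ρ₂)
    (σ : Gal(Ω/F)) : ProjEquiv (conj σ ρ₁) (conj σ ρ₂) := by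
  obtain ⟨a, ha⟩ := h
  exact ⟨a, fun g => ha _⟩

/-- The stabilizer `Gal(E/F)_ρ` of the class of `ρ` under `∼`: the automorphisms `ζ` of `E/F` such
that `ρ^ζ ∼ ρ`. Here `ρ^ζ` is formed with some lift of `ζ`; `mem_stab_iff` shows that the choice of
the lift does not matter. -/
def stab (ρ : E.fixingSubgroup →ₜ* GL (Fin 2) K) : Subgroup Gal(E/F) where
  carrier := {ζ | ∃ σ : Gal(Ω/F), AlgEquiv.restrictNormalHom E σ = ζ ∧ ProjEquiv (conj σ ρ) ρ}
  one_mem' := ⟨1, map_one _, by rw [conj_one]; exact projEquiv_equivalence.refl ρ⟩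
  mul_mem' := by
    rintro _ _ ⟨σ, rfl, hσ⟩ ⟨τ, rfl, hτ⟩
    exact ⟨σ * τ, map_mul _ _ _, by
      rw [conj_mul]; exact projEquiv_equivalence.trans (hτ.conj σ) hσ⟩
  inv_mem' := by
    rintro _ ⟨σ, rfl, hσ⟩
    refine ⟨σ⁻¹, map_inv _ _, ?_⟩
    have h := hσ.conj σ⁻¹
    rw [← conj_mul, inv_mul_cancel, conj_one] at h
    exact projEquiv_equivalence.symm h

theorem mem_stab_iff (ρ : E.fixingSubgroup →ₜ* GL (Fin 2) K) (σ : Gal(Ω/F)) :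
    AlgEquiv.restrictNormalHom E σ ∈ stab ρ ↔ ProjEquiv (conj σ ρ) ρ := by
  refine ⟨?_, fun h => ⟨σ, rfl, h⟩⟩
  rintro ⟨τ, hτ, h⟩
  have hmem : τ⁻¹ * σ ∈ E.fixingSubgroup := by
    rw [← IntermediateField.restrictNormalHom_ker E, MonoidHom.mem_ker, map_mul, map_inv, hτ,
      inv_mul_cancel]
  have hin : ProjEquiv (TensorGalois.conj (τ⁻¹ * σ) ρ) ρ := by
    refine ⟨Matrix.ProjGenLinGroup.mk (ρ ⟨_, hmem⟩), fun g => ?_⟩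
    rw [← map_inv, ← map_mul, ← map_mul, conj_apply, ← map_inv ρ, ← map_mul ρ, ← map_mul ρ]
    congr 2
    apply Subtype.ext
    change (g : Gal(Ω/F)) = (τ⁻¹ * σ) * ((τ⁻¹ * σ)⁻¹ * g * (τ⁻¹ * σ)) * (τ⁻¹ * σ)⁻¹
    group
  have h2 := hin.conj τ
  rw [← conj_mul, mul_inv_cancel_left] at h2
  exact projEquiv_equivalence.trans h2 h

/-- Restriction of a representation of `Gal(Ω/E)` to `Gal(Ω/k)`, for `k ⊇ E`. -/
def resRep {V : Type*} [AddCommGroup V] [Module K V] {k : IntermediateField F Ω} (hk : E ≤ k)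
    (σ : Representation K E.fixingSubgroup V) : Representation K k.fixingSubgroup V :=
  σ.comp (Subgroup.inclusion (IntermediateField.fixingSubgroup_antitone hk))

/-- Restriction of a character of `Gal(Ω/E)` to `Gal(Ω/k)`, for `k ⊇ E`. -/
def resChar {k : IntermediateField F Ω} (hk : E ≤ k)
    (ψ : E.fixingSubgroup →ₜ* Kˣ) : k.fixingSubgroup →* Kˣ :=
  ψ.toMonoidHom.comp (Subgroup.inclusion (IntermediateField.fixingSubgroup_antitone hk))

end Conj

end TensorGalois

end

/-! Write `S = stab ρ` and `C` for the set of left cosets of `S`. For `ξ` in `S` the representation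
`ρ^ξ` is projectively equivalent to `ρ`, so it is a twist `ρ ⊗ χ(ξ)` (`exists_isIso_twist`).
Indexing the tensor factors by `C × S` therefore turns the big tensor product into a character times
`⨂_c (ρ^{r c})^{⊗ m}`, where the `ρ^{r c}` are pairwise projectively inequivalent (`untwist`,
`untwist_resRep`). Since a character does not affect which vectors are joint eigenvectors, one has
to find the joint eigenvectors of `Gal_k` on this second product.

The claim is that they are exactly the invariants of the Lie algebra `sl_2 ^ C`. The envelope still
contains `SL_2` after restriction to `Gal_k`, a subgroup of finite index
(`SLsub_le_algebraicEnvelope_map`), and inequivalence also survives (`mk_eq_mk_of_normal`). Let `L`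
be the space of tuples in `gl_2 ^ C` for which every joint eigenvector is an eigenvector of the
derived action. It is a Lie algebra, stable under the adjoint action and containing the scalars of
each factor. By a Goursat argument (`IsAdStable.eq_top`) it is everything as soon as each of its
projections contains a nonscalar matrix.

Such matrices come from one Galois element whose images are regular of infinite projective order in
all factors, found by Baire's theorem on the compact group (`exists_regular`). No logarithm is
needed: an additive homomorphism `Kˣ → K` applied to the eigenvalues gives an element of `L`
(`exists_tensorDer_eq_smul`), and one that does not kill the ratio of eigenvalues exists because `K`
is a divisible group (`exists_addMonoidHom_ne_zero`). Once `L` is everything, commutators act on a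
joint eigenvector by zero, and `sl_2` is spanned by commutators.

Conversely, `GL_2 ^ C` acts on the invariants through powers of determinants
(`tensorAct_of_mem_slInvariants`), so every invariant is a joint eigenvector and all of them have
the same character. For odd `m` weights rule out nonzero invariants. For even `m` the invariants of
`sl_2` on `(K²)^{⊗ m}` have dimension equal to the difference of the dimensions of the weight spaces
0 and 2 (`finrank_invariants`), and the invariants of the product of Lie algebras are the tensor
power of these (`finrank_iInf_ker_slotMap`). -/

open scoped TensorProduct MatrixGroups

noncomputable section

namespace TensorGalois

/-! ### Polynomial functions on matrices and algebraic envelopes -/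

section Zariski

variable {K : Type*} [Field K] {n : ℕ}

/-- Functions on `n × n` matrices which are polynomial in the entries. -/
def IsPolyFun (f : Matrix (Fin n) (Fin n) K → K) : Prop :=
  ∃ p : MvPolynomial (Fin n × Fin n) K, ∀ x, f x = MvPolynomial.eval (fun ij => x ij.1 ij.2) p

namespace IsPolyFun

variable {f g : Matrix (Fin n) (Fin n) K → K}

theorem const (c : K) : IsPolyFun fun _ : Matrix (Fin n) (Fin n) K => c :=
  ⟨MvPolynomial.C c, fun x => by simp⟩

theorem entry (i j : Fin n) : IsPolyFun fun x : Matrix (Fin n) (Fin n) K => x i j :=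
  ⟨MvPolynomial.X (i, j), fun x => by simp⟩

theorem add (hf : IsPolyFun f) (hg : IsPolyFun g) : IsPolyFun fun x => f x + g x := by
  obtain ⟨p, hp⟩ := hf
  obtain ⟨q, hq⟩ := hg
  exact ⟨p + q, fun x => by simp [hp, hq]⟩

theorem mul (hf : IsPolyFun f) (hg : IsPolyFun g) : IsPolyFun fun x => f x * g x := by
  obtain ⟨p, hp⟩ := hf
  obtain ⟨q, hq⟩ := hg
  exact ⟨p * q, fun x => by simp [hp, hq]⟩

theorem neg (hf : IsPolyFun f) : IsPolyFun fun x => -f x := by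
  simpa using (const (-1)).mul hf

theorem sub (hf : IsPolyFun f) (hg : IsPolyFun g) : IsPolyFun fun x => f x - g x := by
  simpa [sub_eq_add_neg] using hf.add hg.neg

theorem sum {ι : Type*} (s : Finset ι) {f : ι → Matrix (Fin n) (Fin n) K → K}
    (hf : ∀ i ∈ s, IsPolyFun (f i)) : IsPolyFun fun x => ∑ i ∈ s, f i x := by
  classical
  induction s using Finset.induction_on with
  | empty => simpa using const 0
  | insert a s ha ih =>
    simp only [Finset.sum_insert ha]
    exact (hf a (Finset.mem_insert_self _ _)).add
      (ih fun i hi => hf i (Finset.mem_insert_of_mem hi))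

theorem prod {ι : Type*} (s : Finset ι) {f : ι → Matrix (Fin n) (Fin n) K → K}
    (hf : ∀ i ∈ s, IsPolyFun (f i)) : IsPolyFun fun x => ∏ i ∈ s, f i x := by
  classical
  induction s using Finset.induction_on with
  | empty => simpa using const 1
  | insert a s ha ih =>
    simp only [Finset.prod_insert ha]
    exact (hf a (Finset.mem_insert_self _ _)).mul
      (ih fun i hi => hf i (Finset.mem_insert_of_mem hi))

/-- Composition with a matrix-valued function all of whose entries are polynomial. -/
theorem comp (hf : IsPolyFun f) {φ : Matrix (Fin n) (Fin n) K → Matrix (Fin n) (Fin n) K}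
    (hφ : ∀ i j, IsPolyFun fun x => φ x i j) : IsPolyFun fun x => f (φ x) := by
  obtain ⟨p, hp⟩ := hf
  simp only [hp]
  clear hp
  induction p using MvPolynomial.induction_on with
  | C a => simpa using const a
  | add p q hp hq =>
    simp only [map_add]
    exact hp.add hq
  | mul_X p ij hp =>
    simp only [map_mul, MvPolynomial.eval_X]
    exact hp.mul (hφ _ _)

theorem mul_entry {φ ψ : Matrix (Fin n) (Fin n) K → Matrix (Fin n) (Fin n) K}
    (hφ : ∀ i j, IsPolyFun fun x => φ x i j) (hψ : ∀ i j, IsPolyFun fun x => ψ x i j)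
    (i j : Fin n) : IsPolyFun fun x => (φ x * ψ x) i j := by
  simp only [Matrix.mul_apply]
  exact sum _ fun k _ => (hφ i k).mul (hψ k j)

theorem pow_entry {φ : Matrix (Fin n) (Fin n) K → Matrix (Fin n) (Fin n) K}
    (hφ : ∀ i j, IsPolyFun fun x => φ x i j) (N : ℕ)
    (i j : Fin n) : IsPolyFun fun x => (φ x ^ N) i j := by
  induction N generalizing i j with
  | zero => simpa using const _
  | succ N ih => simpa only [pow_succ] using mul_entry ih hφ i j

theorem mul_left (hf : IsPolyFun f) (c : Matrix (Fin n) (Fin n) K) :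
    IsPolyFun fun x => f (c * x) :=
  hf.comp (mul_entry (fun _ _ => const _) entry)

theorem mul_right (hf : IsPolyFun f) (c : Matrix (Fin n) (Fin n) K) :
    IsPolyFun fun x => f (x * c) :=
  hf.comp (mul_entry entry fun _ _ => const _)

/-- The left translates of a polynomial function lie in a finite-dimensional space. -/
theorem exists_fg_translates (hf : IsPolyFun f) :
    ∃ V : Submodule K (Matrix (Fin n) (Fin n) K → K), V.FG ∧ ∀ c, (fun x => f (c * x)) ∈ V := by
  obtain ⟨p, hp⟩ := hf
  simp only [hp]
  clear hp
  induction p using MvPolynomial.induction_on with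
  | C a =>
    refine ⟨K ∙ fun _ => a, Submodule.fg_span_singleton _, fun c => ?_⟩
    simp
  | add p q hp hq =>
    obtain ⟨V, hV, h1⟩ := hp
    obtain ⟨W, hW, h2⟩ := hq
    refine ⟨V ⊔ W, hV.sup hW, fun c => ?_⟩
    simp only [map_add]
    exact Submodule.add_mem_sup (h1 c) (h2 c)
  | mul_X p ij hp =>
    obtain ⟨V, hV, h1⟩ := hp
    refine ⟨V * Submodule.span K (Set.range fun ij : Fin n × Fin n =>
      fun x : Matrix (Fin n) (Fin n) K => x ij.1 ij.2),
      hV.mul (Submodule.fg_span (Set.finite_range _)), fun c => ?_⟩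
    simp only [map_mul, MvPolynomial.eval_X]
    refine Submodule.mul_mem_mul (h1 c) ?_
    have : (fun x : Matrix (Fin n) (Fin n) K => (c * x) ij.1 ij.2) =
        ∑ k, c ij.1 k • fun x : Matrix (Fin n) (Fin n) K => x k ij.2 := by
      ext x
      simp [Matrix.mul_apply]
    rw [this]
    exact Submodule.sum_mem _ fun k _ => Submodule.smul_mem _ _
      (Submodule.subset_span ⟨(k, ij.2), rfl⟩)

end IsPolyFun

/-- Take all polynomials vanishing on `H` as equations. This lets algebraicity be checked one
outside point at a time. -/
theorem isAlgebraicSubgroup_of_separating {H : Subgroup (GL (Fin n) K)}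
    (h : ∀ g ∉ H, ∃ f, IsPolyFun f ∧ (∀ x ∈ H, f (x : Matrix (Fin n) (Fin n) K) = 0) ∧
      f (g : Matrix (Fin n) (Fin n) K) ≠ 0) : IsAlgebraicSubgroup H := by
  refine ⟨{p | ∀ x ∈ H, MvPolynomial.eval
    (fun ij : Fin n × Fin n => (x : Matrix (Fin n) (Fin n) K) ij.1 ij.2) p = 0}, fun g => ⟨fun hg p hp =>
    hp g hg, fun hg => ?_⟩⟩
  by_contra hgH
  obtain ⟨f, ⟨p, hp⟩, h1, h2⟩ := h g hgH
  exact h2 ((hp g).trans (hg p fun x hx => by rw [← hp]; exact h1 x hx))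

theorem le_algebraicEnvelope (A : Subgroup (GL (Fin n) K)) : A ≤ algebraicEnvelope A :=
  (isLeast_algebraicEnvelope A).1.2

theorem exists_separating_algebraicEnvelope (A : Subgroup (GL (Fin n) K)) {g : GL (Fin n) K}
    (hg : g ∉ algebraicEnvelope A) : ∃ f, IsPolyFun f ∧
      (∀ x ∈ algebraicEnvelope A, f (x : Matrix (Fin n) (Fin n) K) = 0) ∧ f (g : Matrix (Fin n) (Fin n) K) ≠ 0 := by
  obtain ⟨I, hI⟩ := (isLeast_algebraicEnvelope A).1.1
  rw [hI] at hg
  push Not at hg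
  obtain ⟨p, hp, hpg⟩ := hg
  exact ⟨_, ⟨p, fun _ => rfl⟩, fun x hx => (hI x).1 hx p hp, hpg⟩

/-- A polynomial function which vanishes on a subgroup vanishes on its algebraic envelope. -/
theorem IsPolyFun.eq_zero_of_mem_algebraicEnvelope {f : Matrix (Fin n) (Fin n) K → K}
    (hf : IsPolyFun f) (A : Subgroup (GL (Fin n) K)) (hA : ∀ a ∈ A, f (a : Matrix (Fin n) (Fin n) K) = 0)
    {g : GL (Fin n) K} (hg : g ∈ algebraicEnvelope A) : f (g : Matrix (Fin n) (Fin n) K) = 0 := by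
  let L (c : GL (Fin n) K) : (Matrix (Fin n) (Fin n) K → K) →ₗ[K] (Matrix (Fin n) (Fin n) K → K) :=
    LinearMap.funLeft K K fun x => (c : Matrix (Fin n) (Fin n) K) * x
  have hLmul : ∀ c d u, L (c * d) u = L d (L c u) := fun c d u => by
    ext x; simp [L, LinearMap.funLeft, mul_assoc]
  have hLone : ∀ u, L 1 u = u := fun u => by ext x; simp [L, LinearMap.funLeft]
  have hLapp : ∀ c u x, L c u x = u ((c : Matrix (Fin n) (Fin n) K) * x) := fun _ _ _ => rfl
  -- The zero locus of `f` need not be a group, so minimality of the envelope cannot be applied to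
  -- it. Instead use the stabiliser, under left translation, of the space `I` of functions in `V`
  -- that vanish on `A`.
  let V : Submodule K (Matrix (Fin n) (Fin n) K → K) := Submodule.span K (Set.range fun c => L c f)
  have hVL : ∀ c, ∀ u ∈ V, L c u ∈ V := fun c u hu => by
    induction hu using Submodule.span_induction with
    | mem u hu =>
      obtain ⟨d, rfl⟩ := hu
      exact Submodule.subset_span ⟨d * c, hLmul _ _ _⟩
    | zero => simp
    | add u v _ _ hu hv => rw [map_add]; exact V.add_mem hu hv
    | smul a u _ hu => rw [map_smul]; exact V.smul_mem _ hu
  have hVpoly : ∀ u ∈ V, IsPolyFun u := fun u hu => by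
    induction hu using Submodule.span_induction with
    | mem u hu =>
      obtain ⟨d, rfl⟩ := hu
      exact hf.mul_left _
    | zero => exact IsPolyFun.const 0
    | add u v _ _ hu hv => exact hu.add hv
    | smul a u _ hu => exact (IsPolyFun.const a).mul hu
  have hVfin : FiniteDimensional K V := by
    obtain ⟨W, hW, h⟩ := hf.exists_fg_translates
    have : FiniteDimensional K W := Module.Finite.iff_fg.2 hW
    refine Submodule.finiteDimensional_of_le (S₂ := W) (Submodule.span_le.2 ?_)
    rintro _ ⟨c, rfl⟩
    exact h c
  let I : Submodule K (Matrix (Fin n) (Fin n) K → K) :=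
    { carrier := {u | u ∈ V ∧ ∀ a ∈ A, u (a : Matrix (Fin n) (Fin n) K) = 0}
      add_mem' := fun {u v} hu hv => ⟨V.add_mem hu.1 hv.1, fun a ha => by
        simp [hu.2 a ha, hv.2 a ha]⟩
      zero_mem' := ⟨V.zero_mem, fun _ _ => rfl⟩
      smul_mem' := fun c u hu => ⟨V.smul_mem _ hu.1, fun a ha => by simp [hu.2 a ha]⟩ }
  have hIfin : FiniteDimensional K I := Submodule.finiteDimensional_of_le fun u hu => hu.1
  let H : Subgroup (GL (Fin n) K) :=
    { carrier := {c | ∀ u ∈ I, L c u ∈ I}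
      mul_mem' := fun {c d} hc hd u hu => by rw [hLmul]; exact hd _ (hc _ hu)
      one_mem' := fun u hu => by rwa [hLone]
      inv_mem' := fun {c} hc u hu => by
        -- Translation by `c` is injective on the finite-dimensional space `I`, hence surjective, so
        -- the inverse translation preserves `I` too.
        have hinj : Function.Injective ((L c).restrict hc) := by
          intro u v huv
          have h1 : L c u = L c v := congrArg Subtype.val huv
          have h2 := congrArg (L c⁻¹) h1
          rw [← hLmul, ← hLmul, mul_inv_cancel, hLone, hLone] at h2
          exact Subtype.ext h2
        obtain ⟨v, hv⟩ := LinearMap.injective_iff_surjective.1 hinj ⟨u, hu⟩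
        have h1 : L c v = u := congrArg Subtype.val hv
        rw [← h1, ← hLmul, mul_inv_cancel, hLone]
        exact v.2 }
  have hAH : A ≤ H := fun a ha u hu => ⟨hVL _ _ hu.1, fun b hb => by
    rw [hLapp, ← Units.val_mul]; exact hu.2 _ (A.mul_mem ha hb)⟩
  have hHalg : IsAlgebraicSubgroup H := by
    refine isAlgebraicSubgroup_of_separating fun g hg => ?_
    have hg' : ¬∀ u ∈ I, L g u ∈ I := hg
    push Not at hg'
    obtain ⟨u, hu, hgu⟩ := hg'
    -- The translate stays in `V`, so it leaves `I` only by failing to vanish at some point of `A`.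
    -- Thus `H` is cut out by the polynomial conditions `u (x * a) = 0`.
    have : ∃ a ∈ A, u (g * a : Matrix (Fin n) (Fin n) K) ≠ 0 := by
      by_contra! hcon
      exact hgu ⟨hVL _ _ hu.1, hcon⟩
    obtain ⟨a, ha, hne⟩ := this
    exact ⟨fun x => u (x * a), (hVpoly u hu.1).mul_right _, fun x hx => (hx u hu).2 a ha, hne⟩
  have hgH : g ∈ H := (isLeast_algebraicEnvelope A).2 ⟨hHalg, hAH⟩ hg
  have hfI : f ∈ I := ⟨Submodule.subset_span ⟨1, hLone f⟩, hA⟩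
  -- The translate of `f` by `g` vanishes on `A`, in particular at the identity.
  have := (hgH f hfI).2 1 A.one_mem
  rwa [hLapp, Units.val_one, mul_one] at this

end Zariski

/-! ### Envelopes of subgroups of finite index -/

section FiniteIndex

variable {K : Type*} [Field K]

/-- If `f` vanishes on the envelope, then `y ↦ f (a y a⁻¹)` is polynomial and vanishes on `A'`,
hence on the envelope of `A'`. -/
theorem conj_algebraicEnvelope_mem {n : ℕ} {A A' : Subgroup (GL (Fin n) K)}
    (hA : A ≤ Subgroup.normalizer (A' : Set (GL (Fin n) K))) {a : GL (Fin n) K} (ha : a ∈ A)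
    {x : GL (Fin n) K}
    (hx : x ∈ algebraicEnvelope A') : a * x * a⁻¹ ∈ algebraicEnvelope A' := by
  by_contra hcon
  obtain ⟨f, hf, h1, h2⟩ := exists_separating_algebraicEnvelope A' hcon
  refine h2 ?_
  have h3 : IsPolyFun fun y : Matrix (Fin n) (Fin n) K =>
      f ((a : Matrix (Fin n) (Fin n) K) * y * ((a⁻¹ : GL (Fin n) K) : Matrix (Fin n) (Fin n) K)) :=
    (hf.mul_right _).mul_left _
  have := h3.eq_zero_of_mem_algebraicEnvelope A' (fun b hb => ?_) hx
  · simpa using this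
  · have := h1 (a * b * a⁻¹)
      (le_algebraicEnvelope _ ((Subgroup.mem_normalizer_iff.1 (hA ha) b).1 hb))
    simpa using this

theorem mem_sup_algebraicEnvelope {n : ℕ} {A A' : Subgroup (GL (Fin n) K)}
    (hA : A ≤ Subgroup.normalizer (A' : Set (GL (Fin n) K))) {x : GL (Fin n) K} :
    x ∈ A ⊔ algebraicEnvelope A' ↔ ∃ a ∈ A, a⁻¹ * x ∈ algebraicEnvelope A' := by
  have hnorm : A ≤ Subgroup.normalizer (algebraicEnvelope A' : Set (GL (Fin n) K)) := by
    intro a ha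
    refine Subgroup.mem_normalizer_iff.2 fun x => ⟨conj_algebraicEnvelope_mem hA ha, fun hx => ?_⟩
    have := conj_algebraicEnvelope_mem hA (A.inv_mem ha) hx
    simpa [mul_assoc] using this
  rw [← SetLike.mem_coe, Subgroup.coe_mul_of_left_le_normalizer_right _ _ hnorm, Set.mem_mul]
  constructor
  · rintro ⟨a, ha, y, hy, rfl⟩
    exact ⟨a, ha, by simpa using hy⟩
  · rintro ⟨a, ha, h⟩
    exact ⟨a, ha, _, h, by simp⟩

/-- The group is a finite union of translates of the envelope of `A'`. A point outside all of them
is separated by the product of the functions that separate it from each. -/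
theorem isAlgebraicSubgroup_sup_algebraicEnvelope {n : ℕ} {A A' : Subgroup (GL (Fin n) K)}
    (hA : A ≤ Subgroup.normalizer (A' : Set (GL (Fin n) K))) (hfin : A'.relIndex A ≠ 0) :
    IsAlgebraicSubgroup (A ⊔ algebraicEnvelope A') := by
  classical
  have hmem := fun x => mem_sup_algebraicEnvelope hA (x := x)
  have : Finite (A ⧸ A'.subgroupOf A) := (Nat.card_ne_zero.1 hfin).2
  have := Fintype.ofFinite (A ⧸ A'.subgroupOf A)
  refine isAlgebraicSubgroup_of_separating fun g hg => ?_
  have hsep : ∀ q : A ⧸ A'.subgroupOf A, ∃ f, IsPolyFun f ∧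
      (∀ x ∈ algebraicEnvelope A', f (x : Matrix (Fin n) (Fin n) K) = 0) ∧
      f (((q.out : GL (Fin n) K)⁻¹ * g : GL (Fin n) K) : Matrix (Fin n) (Fin n) K) ≠ 0 := fun q =>
    exists_separating_algebraicEnvelope A' fun h => hg ((hmem g).2 ⟨_, q.out.2, h⟩)
  choose f hf h1 h2 using hsep
  refine ⟨fun x => ∏ q, f q (((q.out : GL (Fin n) K)⁻¹ : GL (Fin n) K) * x),
    IsPolyFun.prod _ fun q _ => (hf q).mul_left _, fun x hx => ?_, ?_⟩
  · obtain ⟨a, ha, hax⟩ := (hmem x).1 hx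
    refine Finset.prod_eq_zero (Finset.mem_univ (QuotientGroup.mk ⟨a, ha⟩)) ?_
    rw [← Units.val_mul]
    refine h1 _ _ ?_
    set q : A ⧸ A'.subgroupOf A := QuotientGroup.mk ⟨a, ha⟩ with hq
    have hqa : (q.out : GL (Fin n) K)⁻¹ * a ∈ A' := by
      have : (QuotientGroup.mk q.out : A ⧸ A'.subgroupOf A) = QuotientGroup.mk ⟨a, ha⟩ := by
        rw [QuotientGroup.out_eq']
      have h3 := QuotientGroup.eq.1 this
      simpa [Subgroup.mem_subgroupOf] using h3
    have := mul_mem (le_algebraicEnvelope _ hqa) hax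
    simpa [mul_assoc] using this
  · refine Finset.prod_ne_zero_iff.2 fun q _ => ?_
    rw [← Units.val_mul]
    exact h2 q

theorem exists_normal_core {G : Type*} [Group G] {A A' : Subgroup G}
    (hfin : A'.relIndex A ≠ 0) :
    ∃ N : Subgroup G, N ≤ A' ∧ N.relIndex A ≠ 0 ∧ A ≤ Subgroup.normalizer (N : Set G) := by
  refine ⟨((A'.subgroupOf A).normalCore).map A.subtype, ?_, ?_, ?_⟩
  · rintro _ ⟨x, hx, rfl⟩
    exact (A'.subgroupOf A).normalCore_le hx
  · have h1 : (A'.subgroupOf A).FiniteIndex := ⟨hfin⟩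
    rw [Subgroup.relIndex, Subgroup.subgroupOf,
      Subgroup.comap_map_eq_self_of_injective A.subtype_injective]
    exact Subgroup.FiniteIndex.index_ne_zero
  · have key : ∀ a ∈ A, ∀ x ∈ ((A'.subgroupOf A).normalCore).map A.subtype,
        a * x * a⁻¹ ∈ ((A'.subgroupOf A).normalCore).map A.subtype := by
      rintro a ha _ ⟨x, hx, rfl⟩
      exact ⟨⟨a, ha⟩ * x * ⟨a, ha⟩⁻¹,
        ((A'.subgroupOf A).normalCore_normal).conj_mem x hx _, by simp⟩
    intro a ha
    refine Subgroup.mem_normalizer_iff.2 fun x => ⟨key a ha x, fun hx => ?_⟩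
    have := key _ (A.inv_mem ha) _ hx
    simpa [mul_assoc] using this

/-- If the envelope of a subgroup contains `SL_2`, then so does the envelope of a subgroup of
finite index. -/
theorem SLsub_le_algebraicEnvelope_of_relIndex [CharZero K] {A A' : Subgroup (GL (Fin 2) K)}
    (hA : SLsub 2 K ≤ algebraicEnvelope A) (hfin : A'.relIndex A ≠ 0) :
    SLsub 2 K ≤ algebraicEnvelope A' := by
  obtain ⟨N, hNA', hNfin, hNnorm⟩ := exists_normal_core hfin
  set B := algebraicEnvelope N with hB
  have hBA' : B ≤ algebraicEnvelope A' := sInf_le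
    ⟨(isLeast_algebraicEnvelope A').1.1, hNA'.trans (le_algebraicEnvelope _)⟩
  refine le_trans ?_ hBA'
  -- The algebraic group `A ⊔ B` contains the envelope of `A`, hence `SL_2`, and `B` is normal of
  -- finite index in it.
  have hAB : algebraicEnvelope A ≤ A ⊔ B := sInf_le
    ⟨isAlgebraicSubgroup_sup_algebraicEnvelope hNnorm hNfin, le_sup_left⟩
  have hpow : ∃ d : ℕ, d ≠ 0 ∧ ∀ x ∈ A ⊔ B, x ^ d ∈ B := by
    have hr : B.relIndex A ≠ 0 := fun h => hNfin
      (Subgroup.relIndex_eq_zero_of_le_left (le_algebraicEnvelope N) h)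
    refine ⟨(B.relIndex A).factorial, Nat.factorial_ne_zero _, fun x hx => ?_⟩
    obtain ⟨a, ha, hax⟩ := (mem_sup_algebraicEnvelope hNnorm).1 hx
    -- `x` and `a` agree modulo `B`, so their powers do; it is then enough that some power of `a`
    -- lies in `B`.
    have h1 : ∀ j : ℕ, (a ^ j)⁻¹ * x ^ j ∈ B := by
      intro j
      induction j with
      | zero => simp
      | succ j ih =>
        have h2 := mul_mem (conj_algebraicEnvelope_mem hNnorm (A.inv_mem ha) ih) hax
        convert! h2 using 1
        rw [pow_succ, pow_succ]
        group
    have h2 : a ^ (B.relIndex A).factorial ∈ B :=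
      (Subgroup.pow_mem_of_relIndex_ne_zero_of_dvd hr ha fun m hm hle =>
        Nat.dvd_factorial hm hle).1
    have h3 := mul_mem h2 (h1 (B.relIndex A).factorial)
    rwa [mul_inv_cancel_left] at h3
  obtain ⟨d, hd, hpow⟩ := hpow
  rintro _ ⟨g, rfl⟩
  induction g using Matrix.SL2.transvection_induction with
  | htransvec i j hij c =>
    -- In characteristic zero every transvection is a `d`-th power of a transvection, so it lies in
    -- `B`; transvections generate `SL_2`.
    have h1 : Matrix.SpecialLinearGroup.transvection hij c =
        (Matrix.SpecialLinearGroup.transvection hij (c / d)) ^ d := by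
      have h2 : ∀ N : ℕ, Matrix.SpecialLinearGroup.transvection hij (c / d) ^ N =
          Matrix.SpecialLinearGroup.transvection hij (N * (c / d)) := by
        intro N
        induction N with
        | zero => simp
        | succ N ih =>
          rw [pow_succ, ih]
          apply Subtype.ext
          change Matrix.transvection i j _ * Matrix.transvection i j _ = Matrix.transvection i j _
          rw [Matrix.transvection_mul_transvection_same _ _ hij]
          congr 1
          push_cast
          ring
      rw [h2, mul_div_cancel₀ c (Nat.cast_ne_zero.2 hd)]
    rw [h1, map_pow]
    exact hpow _ (hAB (hA ⟨_, rfl⟩))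
  | hmul g h hg hh => rw [map_mul]; exact mul_mem hg hh

end FiniteIndex

/-! ### Two-by-two matrices, conjugation by `SL_2`, and `sl_2`-triples -/

section MatrixTwo

variable {K : Type*} [Field K]

/-- The space of `2 × 2` matrices. -/
abbrev Mat2 (K : Type*) := Matrix (Fin 2) (Fin 2) K

/-- The raising operator of `sl_2`. -/
def matE (K : Type*) [Field K] : Mat2 K := !![0, 1; 0, 0]

/-- The lowering operator of `sl_2`. -/
def matF (K : Type*) [Field K] : Mat2 K := !![0, 0; 1, 0]

/-- The semisimple element of the standard `sl_2`-triple. -/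
def matH (K : Type*) [Field K] : Mat2 K := !![1, 0; 0, -1]

/-- The matrix is not a multiple of the identity. -/
def IsNonscalar (x : Mat2 K) : Prop := x 0 1 ≠ 0 ∨ x 1 0 ≠ 0 ∨ x 0 0 ≠ x 1 1

theorem isNonscalar_matE : IsNonscalar (matE K) := Or.inl (by simp [matE])

theorem not_isNonscalar_iff {x : Mat2 K} : ¬IsNonscalar x ↔ x = x 0 0 • (1 : Mat2 K) := by
  simp only [IsNonscalar, not_or, not_not]
  constructor
  · rintro ⟨h1, h2, h3⟩
    ext i j
    fin_cases i <;> fin_cases j <;> simp [h1, h2, h3]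
  · intro h
    rw [h]
    simp

theorem mem_SLsub_of_det {x : Mat2 K} (hx : x.det = 1) :
    ∃ g ∈ SLsub 2 K, (g : Mat2 K) = x ∧ ((g⁻¹ : GL (Fin 2) K) : Mat2 K) = x.adjugate := by
  let y : Matrix.SpecialLinearGroup (Fin 2) K := ⟨x, hx⟩
  refine ⟨Matrix.SpecialLinearGroup.toGL y, ⟨_, rfl⟩, rfl, ?_⟩
  rw [← map_inv]
  rfl

theorem isPolyFun_adjugate (i j : Fin 2) : IsPolyFun fun x : Mat2 K => x.adjugate i j := by
  simp only [Matrix.adjugate_fin_two]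
  fin_cases i <;> fin_cases j <;> simp
  · exact IsPolyFun.entry 1 1
  · exact (IsPolyFun.entry 0 1).neg
  · exact (IsPolyFun.entry 1 0).neg
  · exact IsPolyFun.entry 0 0

theorem adjugate_eq_det_smul_inv (a : GL (Fin 2) K) :
    (a : Mat2 K).adjugate = (a : Mat2 K).det • ((a⁻¹ : GL (Fin 2) K) : Mat2 K) := by
  rw [Matrix.coe_units_inv, Matrix.inv_def, smul_smul, Ring.mul_inverse_cancel, one_smul]
  exact (Matrix.isUnit_iff_isUnit_det _).1 a.isUnit

/-- A space of matrices stable under conjugation by a group whose envelope contains `SL_2` is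
stable under conjugation by `SL_2`. -/
theorem conj_SL_mem {A : Subgroup (GL (Fin 2) K)} (hA : SLsub 2 K ≤ algebraicEnvelope A)
    {W : Submodule K (Mat2 K)}
    (hW : ∀ a ∈ A, ∀ x ∈ W, (a : Mat2 K) * x * ((a⁻¹ : GL (Fin 2) K) : Mat2 K) ∈ W)
    {g x : Mat2 K} (hg : g.det = 1) (hx : x ∈ W) : g * x * g.adjugate ∈ W := by
  by_contra hcon
  obtain ⟨φ, hφ, hW0⟩ := Submodule.exists_le_ker_of_notMem hcon
  refine hφ ?_
  -- The adjugate replaces the inverse to keep the condition polynomial: it is the inverse on `SL_2`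
  -- and a scalar multiple of it on `A`.
  have hpoly : IsPolyFun fun y : Mat2 K => φ (y * x * y.adjugate) := by
    have : ∀ m : Mat2 K, φ m = ∑ i, ∑ j, m i j * φ (Matrix.single i j 1) := fun m => by
      have hm := congrArg φ (Matrix.matrix_eq_sum_single m)
      simp only [map_sum] at hm
      rw [hm]
      refine Finset.sum_congr rfl fun i _ => Finset.sum_congr rfl fun j _ => ?_
      rw [← smul_eq_mul, ← map_smul, Matrix.smul_single, smul_eq_mul, mul_one]
    rw [funext fun y : Mat2 K => this (y * x * y.adjugate)]
    have h1 : ∀ i j, IsPolyFun fun y : Mat2 K => (y * x * y.adjugate) i j :=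
      IsPolyFun.mul_entry (φ := fun y => y * x) (ψ := fun y => y.adjugate)
        (IsPolyFun.mul_entry (φ := fun y => y) (ψ := fun _ => x) IsPolyFun.entry
          fun _ _ => IsPolyFun.const _) isPolyFun_adjugate
    exact IsPolyFun.sum _ fun i _ => IsPolyFun.sum _ fun j _ => (h1 i j).mul (IsPolyFun.const _)
  obtain ⟨γ, hγ, rfl, -⟩ := mem_SLsub_of_det hg
  refine hpoly.eq_zero_of_mem_algebraicEnvelope A (fun a ha => ?_) (hA hγ)
  rw [adjugate_eq_det_smul_inv, mul_smul_comm, map_smul]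
  have h2 : φ _ = 0 := hW0 (hW a ha x hx)
  rw [h2, smul_zero]

/-- A space of matrices stable under conjugation by `SL_2` which contains the scalars and some
nonscalar matrix contains all matrices. -/
theorem eq_top_of_conj_SL [CharZero K] {W : Submodule K (Mat2 K)}
    (hW : ∀ g x : Mat2 K, g.det = 1 → x ∈ W → g * x * g.adjugate ∈ W) (h1 : (1 : Mat2 K) ∈ W)
    {x : Mat2 K} (hx : x ∈ W) (hne : IsNonscalar x) : W = ⊤ := by
  have h2 : (2 : K) ≠ 0 := two_ne_zero
  -- Since `E² = 0`, conjugating by `1 ± E` gives `x ± [E, x] - E x E`; the half sum and half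
  -- difference isolate the two terms.
  have hEE : ∀ x ∈ W, matE K * x * matE K ∈ W ∧ matE K * x - x * matE K ∈ W := by
    intro x hx
    have ha := hW !![1, 1; 0, 1] x (by simp [Matrix.det_fin_two]) hx
    have hb := hW !![1, -1; 0, 1] x (by simp [Matrix.det_fin_two]) hx
    constructor
    · convert W.sub_mem hx (W.smul_mem (1 / 2) (W.add_mem ha hb)) using 1
      rw [Matrix.eta_fin_two x]
      ext i j
      fin_cases i <;> fin_cases j <;> simp [matE, Matrix.adjugate_fin_two] <;> ring
    · convert W.smul_mem (1 / 2) (W.sub_mem ha hb) using 1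
      rw [Matrix.eta_fin_two x]
      ext i j
      fin_cases i <;> fin_cases j <;> simp [matE, Matrix.adjugate_fin_two] <;> ring
  have hFF : ∀ x ∈ W, matF K * x * matF K ∈ W ∧ matF K * x - x * matF K ∈ W := by
    intro x hx
    have ha := hW !![1, 0; 1, 1] x (by simp [Matrix.det_fin_two]) hx
    have hb := hW !![1, 0; -1, 1] x (by simp [Matrix.det_fin_two]) hx
    constructor
    · convert W.sub_mem hx (W.smul_mem (1 / 2) (W.add_mem ha hb)) using 1
      rw [Matrix.eta_fin_two x]
      ext i j
      fin_cases i <;> fin_cases j <;> simp [matF, Matrix.adjugate_fin_two] <;> ring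
    · convert W.smul_mem (1 / 2) (W.sub_mem ha hb) using 1
      rw [Matrix.eta_fin_two x]
      ext i j
      fin_cases i <;> fin_cases j <;> simp [matF, Matrix.adjugate_fin_two] <;> ring
  have hFE : matF K ∈ W → matE K ∈ W := fun h => by
    convert (hEE _ h).1 using 1
    simp [matE, matF]
  -- `E x E = x₁₀ E` and `F x F = x₀₁ F`, while for diagonal `x` one has `[E, x] = (x₁₁ - x₀₀) E`.
  -- One of these coefficients is nonzero.
  have hE : matE K ∈ W := by
    by_cases h10 : x 1 0 = 0
    · by_cases h01 : x 0 1 = 0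
      · have hd : x 1 1 - x 0 0 ≠ 0 := by
          rcases hne with h | h | h
          · exact absurd h01 h
          · exact absurd h10 h
          · exact fun h' => h (sub_eq_zero.1 h').symm
        convert W.smul_mem (x 1 1 - x 0 0)⁻¹ (hEE x hx).2 using 1
        rw [Matrix.eta_fin_two x, h10, h01]
        simp [matE, hd]
      · refine hFE ?_
        convert W.smul_mem (x 0 1)⁻¹ (hFF x hx).1 using 1
        rw [Matrix.eta_fin_two x]
        simp [matF, h01]
    · convert W.smul_mem (x 1 0)⁻¹ (hEE x hx).1 using 1
      rw [Matrix.eta_fin_two x]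
      simp [matE, h10]
  have hF : matF K ∈ W := by
    convert (hFF _ hE).1 using 1
    simp [matE, matF]
  have hH := (hEE _ hF).2
  refine eq_top_iff.2 fun y _ => ?_
  have : y = ((y 0 0 + y 1 1) / 2) • (1 : Mat2 K) + y 0 1 • matE K + y 1 0 • matF K +
      ((y 0 0 - y 1 1) / 2) • (matE K * matF K - matF K * matE K) := by
    ext i j
    fin_cases i <;> fin_cases j <;> simp [matE, matF] <;> ring
  rw [this]
  exact W.add_mem (W.add_mem (W.add_mem (W.smul_mem _ h1) (W.smul_mem _ hE)) (W.smul_mem _ hF))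
    (W.smul_mem _ hH)

/-- A matrix which commutes up to scalars with a group whose envelope contains `SL_2` is
scalar. -/
theorem not_isNonscalar_of_commute {A : Subgroup (GL (Fin 2) K)}
    (hA : SLsub 2 K ≤ algebraicEnvelope A) {z : Mat2 K} (hz : z.det ≠ 0)
    (h : ∀ a ∈ A, ∃ c : K, z * (a : Mat2 K) = c • ((a : Mat2 K) * z)) : ¬IsNonscalar z := by
  -- Proportionality of `z x` and `x z` is expressed by polynomial minors, which pass from `A` to
  -- `SL_2`. Two transvections then suffice to force `z` to be scalar.
  have key : ∀ x : Mat2 K, x.det = 1 → ∀ i j k l : Fin 2,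
      (z * x) i j * (x * z) k l - (z * x) k l * (x * z) i j = 0 := by
    intro x hx i j k l
    obtain ⟨g, hg, rfl, -⟩ := mem_SLsub_of_det hx
    have hp : ∀ i j, IsPolyFun fun y : Mat2 K => (z * y) i j :=
      IsPolyFun.mul_entry (fun _ _ => IsPolyFun.const _) IsPolyFun.entry
    have hq : ∀ i j, IsPolyFun fun y : Mat2 K => (y * z) i j :=
      IsPolyFun.mul_entry IsPolyFun.entry (fun _ _ => IsPolyFun.const _)
    refine (((hp i j).mul (hq k l)).sub ((hp k l).mul (hq i j))).eq_zero_of_mem_algebraicEnvelope A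
      (fun a ha => ?_) (hA hg)
    obtain ⟨c, hc⟩ := h a ha
    rw [hc]
    simp only [Matrix.smul_apply, smul_eq_mul]
    ring
  have hE := fun i j k l => key !![1, 1; 0, 1] (by simp [Matrix.det_fin_two]) i j k l
  have hF := fun i j k l => key !![1, 0; 1, 1] (by simp [Matrix.det_fin_two]) i j k l
  have h10 : z 1 0 = 0 := by
    have := hE 1 0 1 1
    simp [Matrix.mul_apply, Fin.sum_univ_two] at this
    have : z 1 0 * z 1 0 = 0 := by linear_combination -this
    exact mul_self_eq_zero.1 this
  have h01 : z 0 1 = 0 := by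
    have := hF 0 1 0 0
    simp [Matrix.mul_apply, Fin.sum_univ_two] at this
    have : z 0 1 * z 0 1 = 0 := by linear_combination -this
    exact mul_self_eq_zero.1 this
  have hdiag : z 0 0 = z 1 1 := by
    have := hE 0 0 0 1
    simp [Matrix.mul_apply, Fin.sum_univ_two, h10, h01] at this
    rw [Matrix.det_fin_two, h10] at hz
    have h0 : z 0 0 ≠ 0 := fun h => hz (by simp [h])
    have : z 0 0 * (z 1 1 - z 0 0) = 0 := by linear_combination this
    exact (sub_eq_zero.1 ((mul_eq_zero.1 this).resolve_left h0)).symm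
  simp [IsNonscalar, h01, h10, hdiag]

/-- Every `sl_2`-triple of `2 × 2` matrices is conjugate to the standard one. -/
theorem exists_conj_of_sl2_triple [CharZero K] {e f h : Mat2 K} (he : e ≠ 0)
    (hhe : h * e - e * h = (2 : K) • e) (hhf : h * f - f * h = (-2 : K) • f)
    (hef : e * f - f * e = h) :
    ∃ a : Mat2 K, a.det ≠ 0 ∧ e * a = a * matE K ∧ f * a = a * matF K := by
  have h2 : (2 : K) ≠ 0 := two_ne_zero
  have ent : ∀ {x y : Mat2 K}, x = y → x 0 0 = y 0 0 ∧ x 0 1 = y 0 1 ∧ x 1 0 = y 1 0 ∧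
    x 1 1 = y 1 1 := fun h => by simp [h]
  obtain ⟨a1, a2, a3, a4⟩ := ent hhe
  obtain ⟨b1, b2, b3, b4⟩ := ent hhf
  obtain ⟨c1, c2, c3, c4⟩ := ent hef
  simp only [Matrix.sub_apply, Matrix.mul_apply, Fin.sum_univ_two, Matrix.smul_apply,
    smul_eq_mul] at a1 a2 a3 a4 b1 b2 b3 b4 c1 c2 c3 c4
  have te : e 1 1 = -e 0 0 := by
    have : 2 * (e 0 0 + e 1 1) = 0 := by linear_combination -a1 - a4
    linear_combination (mul_eq_zero.1 this).resolve_left h2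
  have tf : f 1 1 = -f 0 0 := by
    have : 2 * (f 0 0 + f 1 1) = 0 := by linear_combination b1 + b4
    linear_combination (mul_eq_zero.1 this).resolve_left h2
  have h4 : (4 : K) ≠ 0 := by norm_num
  -- This is the vanishing of `tr (e [h, e]) = 2 tr e²`. With trace zero it gives `e² = 0`, and
  -- likewise for `f`.
  have se : e 0 0 * e 0 0 + e 0 1 * e 1 0 = 0 := by
    have : 4 * (e 0 0 * e 0 0 + e 0 1 * e 1 0) = 0 := by
      linear_combination -(e 0 0 * a1 + e 1 0 * a2 + e 0 1 * a3 + e 1 1 * a4) -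
        2 * (e 1 1 - e 0 0) * te
    exact (mul_eq_zero.1 this).resolve_left h4
  have sf : f 0 0 * f 0 0 + f 0 1 * f 1 0 = 0 := by
    have : 4 * (f 0 0 * f 0 0 + f 0 1 * f 1 0) = 0 := by
      linear_combination (f 0 0 * b1 + f 1 0 * b2 + f 0 1 * b3 + f 1 1 * b4) -
        2 * (f 1 1 - f 0 0) * tf
    exact (mul_eq_zero.1 this).resolve_left h4
  have sq : ∀ x : Mat2 K, x 1 1 = -x 0 0 → x 0 0 * x 0 0 + x 0 1 * x 1 0 = 0 → x * x = 0 := by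
    intro x h1 h2
    ext i j
    fin_cases i <;> fin_cases j <;> simp [Matrix.mul_apply, Fin.sum_univ_two, h1]
    · exact h2
    · ring
    · ring
    · linear_combination h2
  have ee := sq e te se
  have ff := sq f tf sf
  have efe : e * f * e = e := by
    have h3 : (2 : K) • (e * f * e) = (2 : K) • e := by
      rw [← hhe, ← hef]
      have h5 : (e * f - f * e) * e - e * (e * f - f * e) =
        e * f * e + e * f * e - f * (e * e) - (e * e) * f := by noncomm_ring
      rw [h5, ee, two_smul]
      simp
    exact smul_right_injective _ h2 h3
  obtain ⟨k, hk⟩ : ∃ k, e.col k ≠ 0 := by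
    by_contra! hcon
    exact he (by ext i k; exact congrFun (hcon k) i)
  have hVE : Matrix.single k (0 : Fin 2) (1 : K) * matE K = Matrix.single k 1 1 := by
    ext i j
    fin_cases k <;> fin_cases i <;> fin_cases j <;>
      simp [matE, Matrix.mul_apply, Matrix.single_apply]
  have hVE' : Matrix.single k (1 : Fin 2) (1 : K) * matE K = 0 := by
    ext i j
    fin_cases k <;> fin_cases i <;> fin_cases j <;>
      simp [matE, Matrix.mul_apply, Matrix.single_apply]
  have hVF : Matrix.single k (1 : Fin 2) (1 : K) * matF K = Matrix.single k 0 1 := by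
    ext i j
    fin_cases k <;> fin_cases i <;> fin_cases j <;>
      simp [matF, Matrix.mul_apply, Matrix.single_apply]
  have hVF' : Matrix.single k (0 : Fin 2) (1 : K) * matF K = 0 := by
    ext i j
    fin_cases k <;> fin_cases i <;> fin_cases j <;>
      simp [matF, Matrix.mul_apply, Matrix.single_apply]
  -- The columns of `a` are a nonzero column of `e`, which is a highest weight vector, and its image
  -- under `f`.
  set a : Mat2 K := e * Matrix.single k 0 1 + f * (e * Matrix.single k 1 1) with ha
  have hea : e * a = a * matE K := by
    rw [ha, mul_add, add_mul, mul_assoc, mul_assoc, mul_assoc, hVE, hVE', ← mul_assoc, ee,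
      ← mul_assoc e f, ← mul_assoc, efe]
    simp
  have hfa : f * a = a * matF K := by
    rw [ha, mul_add, add_mul, mul_assoc, mul_assoc, mul_assoc, hVF, hVF', ← mul_assoc f f, ff]
    simp
  refine ⟨a, fun hdet => ?_, hea, hfa⟩
  obtain ⟨w, hw0, hw⟩ := Matrix.exists_mulVec_eq_zero_iff.2 hdet
  have hcol : a.col 0 = e.col k := by
    ext i
    simp [ha, Matrix.mul_apply, Matrix.single_apply]
  have h1 : w 1 = 0 := by
    have h3 : (a * matE K).mulVec w = 0 := by
      rw [← hea, ← Matrix.mulVec_mulVec, hw, Matrix.mulVec_zero]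
    have h5 : (a * matE K).mulVec w = w 1 • a.col 0 := by
      rw [← Matrix.mulVec_mulVec]
      ext i
      simp [matE, Matrix.mulVec, dotProduct, Fin.sum_univ_two, mul_comm]
    rw [h5, hcol] at h3
    exact (smul_eq_zero.1 h3).resolve_right hk
  have h0 : w 0 = 0 := by
    have h5 : a.mulVec w = w 0 • a.col 0 := by
      ext i
      simp [Matrix.mulVec, dotProduct, Fin.sum_univ_two, mul_comm, h1]
    rw [h5, hcol] at hw
    exact (smul_eq_zero.1 hw).resolve_right hk
  exact hw0 (by ext i; fin_cases i <;> simp [h0, h1])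

end MatrixTwo

/-! ### A Goursat lemma for subalgebras of a product of `gl_2` -/

section LieGoursat

variable {K C Γ : Type*} [Field K] [Group Γ]

/-- A subspace of a product of copies of `gl_2` which is a Lie subalgebra, contains the scalars of
each factor, and is stable under the adjoint action of `Γ` through `ρ`. -/
structure IsAdStable (ρ : C → Γ →* GL (Fin 2) K) (L : Submodule K (C → Mat2 K)) : Prop where
  lie_mem : ∀ X ∈ L, ∀ Y ∈ L, X * Y - Y * X ∈ L
  scalar_mem : ∀ t : C → K, (fun c => t c • (1 : Mat2 K)) ∈ L
  ad_mem : ∀ γ, ∀ X ∈ L,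
    (fun c => (ρ c γ : Mat2 K) * X c * (((ρ c γ)⁻¹ : GL (Fin 2) K) : Mat2 K)) ∈ L

variable {ρ : C → Γ →* GL (Fin 2) K} {L : Submodule K (C → Mat2 K)}

namespace IsAdStable

theorem single_scalar_mem [DecidableEq C] (hL : IsAdStable ρ L) (c : C) (t : K) :
    Pi.single c (t • (1 : Mat2 K)) ∈ L := by
  convert hL.scalar_mem (Pi.single c t) using 1
  ext d : 1
  by_cases h : d = c
  · subst h; simp
  · simp [h]

/-- If `L` has an element which vanishes on `S` and is nonscalar at `c`, then it has elements which
vanish on `S` and take any given value at `c`. -/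
theorem exists_apply_eq [CharZero K] (hL : IsAdStable ρ L)
    (henv : ∀ c, SLsub 2 K ≤ algebraicEnvelope (ρ c).range) {c : C} {S : Set C}
    (hc : c ∉ S) {X : C → Mat2 K} (hX : X ∈ L) (hXS : ∀ d ∈ S, X d = 0)
    (hXc : IsNonscalar (X c)) (y : Mat2 K) : ∃ Y ∈ L, (∀ d ∈ S, Y d = 0) ∧ Y c = y := by
  classical
  -- The possible values at `c` form a space stable under the adjoint action, hence under `SL_2`; it
  -- contains the scalars and a nonscalar matrix.
  let W : Submodule K (Mat2 K) :=
    { carrier := {y | ∃ Y ∈ L, (∀ d ∈ S, Y d = 0) ∧ Y c = y}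
      add_mem' := by
        rintro _ _ ⟨Y, hY, hYS, rfl⟩ ⟨Z, hZ, hZS, rfl⟩
        exact ⟨Y + Z, L.add_mem hY hZ, fun d hd => by simp [hYS d hd, hZS d hd], rfl⟩
      zero_mem' := ⟨0, L.zero_mem, fun _ _ => rfl, rfl⟩
      smul_mem' := by
        rintro t _ ⟨Y, hY, hYS, rfl⟩
        exact ⟨t • Y, L.smul_mem t hY, fun d hd => by simp [hYS d hd], rfl⟩ }
  have hW : ∀ g x : Mat2 K, g.det = 1 → x ∈ W → g * x * g.adjugate ∈ W := by
    intro g x hg hx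
    refine conj_SL_mem (henv c) ?_ hg hx
    rintro _ ⟨γ, rfl⟩ _ ⟨Y, hY, hYS, rfl⟩
    exact ⟨_, hL.ad_mem γ Y hY, fun d hd => by simp [hYS d hd], rfl⟩
  have h1 : (1 : Mat2 K) ∈ W := ⟨_, hL.single_scalar_mem c 1, fun d hd => by
    have : d ≠ c := fun h => hc (h ▸ hd)
    simp [this], by simp⟩
  have htop := eq_top_of_conj_SL hW h1 ⟨X, hX, hXS, rfl⟩ hXc
  have hy : y ∈ W := htop ▸ Submodule.mem_top
  exact hy

/-- Otherwise the projection of `L` to the factors `c` and `d` is, modulo scalars, the graph of an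
isomorphism. Every such isomorphism is inner, and compatibility with the adjoint action makes `ρ c`
and `ρ d` projectively conjugate. -/
theorem exists_isNonscalar_of_ne [CharZero K] (hL : IsAdStable ρ L)
    (henv : ∀ c, SLsub 2 K ≤ algebraicEnvelope (ρ c).range)
    (hns : ∀ c, ∃ X ∈ L, IsNonscalar (X c)) {c d : C} (hcd : c ≠ d)
    (hne : ¬∃ a : GL (Fin 2) K, ∀ γ, ∃ t : K, (ρ d γ : Mat2 K) * a = t • (a * (ρ c γ : Mat2 K))) :
    ∃ X ∈ L, X d = 0 ∧ IsNonscalar (X c) := by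
  classical
  by_contra! hcon
  have h2 : (2 : K) ≠ 0 := two_ne_zero
  have hall : ∀ b (y : Mat2 K), ∃ Y ∈ L, Y b = y := by
    intro b y
    obtain ⟨X, hX, hXb⟩ := hns b
    obtain ⟨Y, hY, -, h⟩ := hL.exists_apply_eq henv (S := ∅) (by simp) hX (by simp) hXb y
    exact ⟨Y, hY, h⟩
  -- The assumption is symmetric in `c` and `d`: an element vanishing at `c` but nonscalar at `d`
  -- could be used to correct the value at `d` of a lift of `E` to zero.
  have hcon' : ∀ X ∈ L, X c = 0 → ¬IsNonscalar (X d) := by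
    intro X hX hXc hXd
    obtain ⟨Y, hY, hYc⟩ := hall c (matE K)
    obtain ⟨Z, hZ, hZc, hZd⟩ := hL.exists_apply_eq henv (S := {c}) (by simpa using hcd.symm)
      hX (by simpa using hXc) hXd (Y d)
    refine hcon (Y - Z) (L.sub_mem hY hZ) (by simp [hZd]) ?_
    simpa [hYc, hZc c rfl] using isNonscalar_matE
  obtain ⟨Xe, hXe, hXec⟩ := hall c (matE K)
  obtain ⟨Xf, hXf, hXfc⟩ := hall c (matF K)
  set Xh := Xe * Xf - Xf * Xe with hXh
  have hXhL : Xh ∈ L := hL.lie_mem _ hXe _ hXf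
  have hXhc : Xh c = matH K := by
    simp [hXh, hXec, hXfc, matE, matF, matH]
  have h5 := not_isNonscalar_iff.1 (hcon' (Xh * Xe - Xe * Xh - (2 : K) • Xe)
    (L.sub_mem (hL.lie_mem _ hXhL _ hXe) (L.smul_mem _ hXe)) (by
      simp only [Pi.sub_apply, Pi.mul_apply, Pi.smul_apply, hXhc, hXec]
      ext i j
      fin_cases i <;> fin_cases j <;> simp [matE, matH]; norm_num))
  have h6 := not_isNonscalar_iff.1 (hcon' (Xh * Xf - Xf * Xh - (-2 : K) • Xf)
    (L.sub_mem (hL.lie_mem _ hXhL _ hXf) (L.smul_mem _ hXf)) (by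
      simp only [Pi.sub_apply, Pi.mul_apply, Pi.smul_apply, hXhc, hXfc]
      ext i j
      fin_cases i <;> fin_cases j <;> simp [matF, matH]; norm_num))
  set s := (Xh * Xe - Xe * Xh - (2 : K) • Xe) d 0 0
  set u := (Xh * Xf - Xf * Xh - (-2 : K) • Xf) d 0 0
  simp only [Pi.sub_apply, Pi.mul_apply, Pi.smul_apply] at h5 h6
  -- At `d` the relations of the lifted triple hold up to the scalars `s` and `u`. These shifts
  -- absorb the errors and leave commutators unchanged.
  set e := Xe d + (s / 2) • (1 : Mat2 K) with he
  set f := Xf d - (u / 2) • (1 : Mat2 K) with hf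
  have hef : e * f - f * e = Xh d := by
    simp only [he, hf, hXh, Pi.sub_apply, Pi.mul_apply, mul_sub, sub_mul, mul_add, add_mul,
      smul_mul_assoc, mul_smul_comm, one_mul, mul_one]
    module
  have hhe : Xh d * e - e * Xh d = (2 : K) • e := by
    have : Xh d * e - e * Xh d = Xh d * Xe d - Xe d * Xh d := by
      simp only [he, mul_add, add_mul, smul_mul_assoc, mul_smul_comm, one_mul, mul_one]
      abel
    rw [this, he, sub_eq_iff_eq_add.1 h5, smul_add, smul_smul, mul_div_cancel₀ _ h2, add_comm]
  have hhf : Xh d * f - f * Xh d = (-2 : K) • f := by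
    have : Xh d * f - f * Xh d = Xh d * Xf d - Xf d * Xh d := by
      simp only [hf, mul_sub, sub_mul, smul_mul_assoc, mul_smul_comm, one_mul, mul_one]
      abel
    rw [this, hf, sub_eq_iff_eq_add.1 h6, smul_sub, smul_smul, neg_mul, mul_div_cancel₀ _ h2,
      neg_smul u, sub_neg_eq_add, add_comm]
  have he0 : e ≠ 0 := by
    intro h0
    refine hcon (Xe + Pi.single d ((s / 2) • (1 : Mat2 K)))
      (L.add_mem hXe (hL.single_scalar_mem _ _)) ?_ ?_
    · simpa [he] using h0
    · simpa [hcd, hXec] using isNonscalar_matE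
  obtain ⟨a, hdet, hea, hfa⟩ := exists_conj_of_sl2_triple he0 hhe hhf hef
  have hha : Xh d * a = a * matH K := by
    have : matH K = matE K * matF K - matF K * matE K := by simp [matE, matF, matH]
    rw [← hef, this, sub_mul, mul_assoc e f a, mul_assoc f e a, hfa, hea, ← mul_assoc e,
      ← mul_assoc f, hea, hfa, mul_sub, mul_assoc, mul_assoc]
  have key : ∀ X ∈ L, ∃ s : K, X d * a = a * X c + s • a := by
    intro X hX
    set x := X c 0 1
    set y := X c 1 0
    set z := (X c 0 0 - X c 1 1) / 2
    set t := (X c 0 0 + X c 1 1) / 2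
    have hXc : X c = x • matE K + y • matF K + z • matH K + t • (1 : Mat2 K) := by
      ext i j
      fin_cases i <;> fin_cases j <;> simp [matE, matF, matH, x, y, z, t] <;> ring
    obtain ⟨w, h7⟩ : ∃ w : K, (X - (x • Xe + y • Xf + z • Xh +
        Pi.single c (t • (1 : Mat2 K))) : C → Mat2 K) d = w • (1 : Mat2 K) := ⟨_, not_isNonscalar_iff.1 (hcon'
      (X - (x • Xe + y • Xf + z • Xh + Pi.single c (t • (1 : Mat2 K))))
      (L.sub_mem hX (L.add_mem (L.add_mem (L.add_mem (L.smul_mem _ hXe) (L.smul_mem _ hXf))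
        (L.smul_mem _ hXhL)) (hL.single_scalar_mem _ _))) (by
        simp [hXec, hXfc, hXhc, ← hXc]))⟩
    simp only [Pi.sub_apply, Pi.add_apply, Pi.smul_apply, Pi.single_eq_of_ne hcd.symm,
      add_zero] at h7
    have h8 : X d = x • e + y • f + z • Xh d + (w - x * (s / 2) + y * (u / 2)) • (1 : Mat2 K) := by
      rw [sub_eq_iff_eq_add.1 h7, he, hf]
      module
    refine ⟨w - x * (s / 2) + y * (u / 2) - t, ?_⟩
    rw [h8, hXc]
    simp only [add_mul, mul_add, smul_mul_assoc, mul_smul_comm, hea, hfa, hha, one_mul, mul_one]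
    module
  let A : GL (Fin 2) K := Matrix.GeneralLinearGroup.mkOfDetNeZero a hdet
  have hA : (A : Mat2 K) = a := rfl
  refine hne ⟨A, fun γ => ?_⟩
  -- Conjugation by `z` changes each matrix only by adding a scalar, and comparing traces shows that
  -- the scalar is zero. So `z` is central, which is the projective equivalence excluded by `hne`.
  set z : GL (Fin 2) K := (ρ c γ)⁻¹ * A⁻¹ * ρ d γ * A with hz
  have hcomm : ∀ x : Mat2 K, (z : Mat2 K) * x = x * z := by
    intro x
    obtain ⟨X, hX, rfl⟩ := hall c x
    obtain ⟨s, hs⟩ := key X hX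
    obtain ⟨s', hs'⟩ := key _ (hL.ad_mem γ X hX)
    have h1 : X d = A * (X c + s • (1 : Mat2 K)) * ((A⁻¹ : GL (Fin 2) K) : Mat2 K) := by
      rw [Units.eq_mul_inv_iff_mul_eq, hA, hs, mul_add, mul_smul_comm, mul_one]
    have h3 : (z : Mat2 K) * X c * ((z⁻¹ : GL (Fin 2) K) : Mat2 K) + s • (1 : Mat2 K) =
        X c + s' • (1 : Mat2 K) := by
      have h4 : (z : Mat2 K) * (X c + s • (1 : Mat2 K)) * ((z⁻¹ : GL (Fin 2) K) : Mat2 K) =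
          (((ρ c γ)⁻¹ : GL (Fin 2) K) : Mat2 K) * ((A⁻¹ : GL (Fin 2) K) : Mat2 K) *
          ((ρ d γ : Mat2 K) * X d * (((ρ d γ)⁻¹ : GL (Fin 2) K) : Mat2 K) * a) * ρ c γ := by
        rw [h1, hz, ← hA]
        simp only [mul_inv_rev, inv_inv, Units.val_mul, mul_assoc]
      rw [hs'] at h4
      have h5 : (((ρ c γ)⁻¹ : GL (Fin 2) K) : Mat2 K) * ((A⁻¹ : GL (Fin 2) K) : Mat2 K) *
          (a * ((ρ c γ : Mat2 K) * X c * (((ρ c γ)⁻¹ : GL (Fin 2) K) : Mat2 K)) + s' • a) *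
            ρ c γ = X c + s' • (1 : Mat2 K) := by
        rw [← hA]
        simp only [mul_add, add_mul, mul_assoc, mul_smul_comm, smul_mul_assoc,
          Units.inv_mul_cancel_left, Units.inv_mul, mul_one]
      rw [h5] at h4
      rw [← h4, mul_add, add_mul, mul_smul_comm, smul_mul_assoc, mul_one, Units.mul_inv]
    have h4 := congrArg Matrix.trace h3
    rw [Matrix.trace_add, Matrix.trace_add, Matrix.trace_mul_comm, ← mul_assoc, Units.inv_mul,
      one_mul] at h4
    have h6 : s = s' := by
      have h7 := add_left_cancel h4
      simp only [Matrix.trace_smul, Matrix.trace_one, Fintype.card_fin, smul_eq_mul] at h7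
      exact mul_right_cancel₀ (by exact_mod_cast h2) h7
    rw [h6] at h3
    have h8 := add_right_cancel h3
    rwa [Units.mul_inv_eq_iff_eq_mul] at h8
  have hzs : ¬IsNonscalar (z : Mat2 K) := by
    refine not_isNonscalar_of_commute (henv c) ?_ fun b _ => ⟨1, by rw [one_smul, hcomm]⟩
    exact ((Matrix.isUnit_iff_isUnit_det _).1 z.isUnit).ne_zero
  refine ⟨(z : Mat2 K) 0 0, ?_⟩
  have h9 := not_isNonscalar_iff.1 hzs
  have h10 : (ρ d γ : Mat2 K) * A = A * (ρ c γ : Mat2 K) * z := by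
    rw [hz]
    simp only [Units.val_mul, mul_assoc, Units.mul_inv_cancel_left]
  rw [h10, h9]
  simp

/-- Goursat's lemma for `gl_2`: if no two of the `ρ c` are projectively equivalent and no
projection of `L` to a factor is scalar, then `L` is everything. -/
theorem eq_top [CharZero K] [Finite C] (hL : IsAdStable ρ L)
    (henv : ∀ c, SLsub 2 K ≤ algebraicEnvelope (ρ c).range)
    (hns : ∀ c, ∃ X ∈ L, IsNonscalar (X c))
    (hne : ∀ c d, c ≠ d → ¬∃ a : GL (Fin 2) K, ∀ γ, ∃ t : K,
      (ρ d γ : Mat2 K) * a = t • (a * (ρ c γ : Mat2 K))) : L = ⊤ := by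
  classical
  have := Fintype.ofFinite C
  -- A commutator vanishes wherever either factor does. The values `E` and `H` at `c` are prescribed
  -- so that the commutator there is `-2E`.
  have key : ∀ c, ∀ S : Finset C, c ∉ S → ∃ X ∈ L, (∀ d ∈ S, X d = 0) ∧ IsNonscalar (X c) := by
    intro c S
    induction S using Finset.induction_on with
    | empty =>
      intro _
      obtain ⟨X, hX, h⟩ := hns c
      exact ⟨X, hX, by simp, h⟩
    | insert d S _ ih =>
      intro hc
      rw [Finset.mem_insert, not_or] at hc
      obtain ⟨X, hX, hXS, hXc⟩ := ih hc.2
      obtain ⟨Y, hY, hYd, hYc⟩ := hL.exists_isNonscalar_of_ne henv hns hc.1 (hne c d hc.1)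
      obtain ⟨X', hX', hXS', hXc'⟩ := hL.exists_apply_eq henv (S := S) (by simpa using hc.2) hX
        (by simpa using hXS) hXc (matE K)
      obtain ⟨Y', hY', hYd', hYc'⟩ := hL.exists_apply_eq henv (S := {d}) (by simpa using hc.1) hY
        (by simpa using hYd) hYc (matH K)
      refine ⟨X' * Y' - Y' * X', hL.lie_mem _ hX' _ hY', fun b hb => ?_, ?_⟩
      · rcases Finset.mem_insert.1 hb with rfl | hb
        · simp [hYd' _ rfl]
        · simp [hXS' b hb]
      · refine Or.inl ?_
        simp only [Pi.sub_apply, Pi.mul_apply, hXc', hYc']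
        simp [matE, matH]
        norm_num
  refine eq_top_iff.2 fun X _ => ?_
  rw [← Finset.univ_sum_single X]
  refine L.sum_mem fun c _ => ?_
  obtain ⟨Y, hY, hYS, hYc⟩ := key c (Finset.univ.erase c) (by simp)
  obtain ⟨Z, hZ, hZS, hZc⟩ := hL.exists_apply_eq henv (S := {d | d ≠ c}) (by simp) hY
    (fun d hd => hYS d (by simpa using hd)) hYc (X c)
  convert hZ using 1
  ext d : 1
  by_cases h : d = c
  · subst h; simp [hZc]
  · simp [h, hZS d h]

end IsAdStable

end LieGoursat

/-! ### Group action and derived action on tensor powers -/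

section TensorAction

variable {K ι : Type*} [Field K]

variable (K ι) in
/-- The tensor power of the standard two-dimensional space indexed by `ι`. -/
abbrev TensorPow := ⨂[K] _ : ι, (Fin 2 → K)

/-- The action of a family of matrices on a tensor power. -/
def tensorAct (g : ι → Mat2 K) : Module.End K (TensorPow K ι) :=
  PiTensorProduct.map fun i => (g i).mulVecLin

theorem tensorAct_tprod (g : ι → Mat2 K) (x : ι → Fin 2 → K) :
    tensorAct g (PiTensorProduct.tprod K x) =
      PiTensorProduct.tprod K fun i => (g i).mulVec (x i) := by
  rw [tensorAct, PiTensorProduct.map_tprod]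
  rfl

theorem tensorAct_mul (g h : ι → Mat2 K) : tensorAct (g * h) = tensorAct g * tensorAct h := by
  simp only [tensorAct, Pi.mul_apply, Matrix.mulVecLin_mul]
  exact PiTensorProduct.map_comp _ _

theorem tensorAct_one : tensorAct (1 : ι → Mat2 K) = 1 := by
  simp only [tensorAct, Pi.one_apply, Matrix.mulVecLin_one]
  exact PiTensorProduct.map_id

section Basis

variable [Fintype ι]

variable (K ι) in
/-- The standard basis of a tensor power. -/
def tensorBasis : Module.Basis (ι → Fin 2) K (TensorPow K ι) :=
  Basis.piTensorProduct fun _ => Pi.basisFun K (Fin 2)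

theorem tensorBasis_apply (s : ι → Fin 2) :
    tensorBasis K ι s = PiTensorProduct.tprod K fun i => Pi.single (s i) (1 : K) := by
  rw [tensorBasis, Basis.piTensorProduct_apply]
  simp

theorem tensorAct_diagonal (d : ι → Fin 2 → K) (s : ι → Fin 2) :
    tensorAct (fun i => Matrix.diagonal (d i)) (tensorBasis K ι s) =
      (∏ i, d i (s i)) • tensorBasis K ι s := by
  rw [tensorBasis_apply, tensorAct_tprod, ← MultilinearMap.map_smul_univ]
  congr 1
  ext i j
  rw [Matrix.mulVec_diagonal]
  by_cases h : j = s i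
  · subst h; simp
  · simp [h]

end Basis

variable [DecidableEq ι]

theorem tensorAct_update_add (g : ι → Mat2 K) (i : ι) (x y : Mat2 K) :
    tensorAct (Function.update g i (x + y)) =
      tensorAct (Function.update g i x) + tensorAct (Function.update g i y) := by
  have h : ∀ x, tensorAct (Function.update g i x) = PiTensorProduct.map
      (Function.update (fun j => (g j).mulVecLin) i x.mulVecLin) := fun x => by
    rw [tensorAct]
    congr 1
    ext j : 1
    by_cases hj : j = i
    · subst hj; simp
    · simp [hj]
  rw [h, h, h, Matrix.mulVecLin_add, PiTensorProduct.map_update_add]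

theorem tensorAct_update_smul (g : ι → Mat2 K) (i : ι) (t : K) (x : Mat2 K) :
    tensorAct (Function.update g i (t • x)) = t • tensorAct (Function.update g i x) := by
  have h : ∀ x, tensorAct (Function.update g i x) = PiTensorProduct.map
      (Function.update (fun j => (g j).mulVecLin) i x.mulVecLin) := fun x => by
    rw [tensorAct]
    congr 1
    ext j : 1
    by_cases hj : j = i
    · subst hj; simp
    · simp [hj]
  have h2 : (t • x).mulVecLin = t • x.mulVecLin := by
    ext; simp
  rw [h, h, h2, PiTensorProduct.map_update_smul]

variable [Fintype ι]

/-- The derived action of a family of matrices on a tensor power. -/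
def tensorDer : (ι → Mat2 K) →ₗ[K] Module.End K (TensorPow K ι) where
  toFun x := ∑ i, tensorAct (Pi.mulSingle i (x i))
  map_add' x y := by
    simp only [Pi.add_apply, Pi.mulSingle, tensorAct_update_add, Finset.sum_add_distrib]
  map_smul' t x := by
    simp only [Pi.smul_apply, Pi.mulSingle, tensorAct_update_smul, Finset.smul_sum,
      RingHom.id_apply]

theorem tensorDer_apply (x : ι → Mat2 K) :
    tensorDer x = ∑ i, tensorAct (Pi.mulSingle i (x i)) := rfl

/-- Operators in different tensor slots commute, so the mixed terms of the two products cancel. -/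
theorem tensorDer_lie (x y : ι → Mat2 K) :
    tensorDer (x * y - y * x) = tensorDer x * tensorDer y - tensorDer y * tensorDer x := by
  rw [map_sub]
  have h : ∀ x y : ι → Mat2 K, tensorDer x * tensorDer y = tensorDer (x * y) +
      ∑ i, ∑ j ∈ Finset.univ.erase i, tensorAct
        (Pi.mulSingle (M := fun _ => Mat2 K) i (x i) * Pi.mulSingle (M := fun _ => Mat2 K) j (y j)) := by
    intro x y
    simp only [tensorDer_apply, Finset.sum_mul_sum, ← Finset.sum_add_distrib]
    refine Finset.sum_congr rfl fun i _ => ?_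
    rw [← Finset.add_sum_erase _ _ (Finset.mem_univ i)]
    simp only [← tensorAct_mul, Pi.mul_apply, Pi.mulSingle_mul]
  have h2 : ∑ i, ∑ j ∈ Finset.univ.erase i,
      tensorAct
        (Pi.mulSingle (M := fun _ => Mat2 K) i (x i) * Pi.mulSingle (M := fun _ => Mat2 K) j (y j)) =
      ∑ i, ∑ j ∈ Finset.univ.erase i,
      tensorAct (Pi.mulSingle (M := fun _ => Mat2 K) i (y i) *
        Pi.mulSingle (M := fun _ => Mat2 K) j (x j)) := by
    rw [Finset.sum_comm' (t' := Finset.univ) (s' := fun j => Finset.univ.erase j)]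
    · refine Finset.sum_congr rfl fun i _ => Finset.sum_congr rfl fun j hj => ?_
      rw [(Pi.mulSingle_commute (f := fun _ => Mat2 K) (Finset.ne_of_mem_erase hj) (x j)
        (y i)).eq]
    · intro i j
      simp [eq_comm]
  rw [h x y, h y x, h2]
  abel

theorem tensorAct_mul_tensorDer {g h x : ι → Mat2 K} (hg : h * g = 1) :
    tensorAct g * tensorDer x = tensorDer (g * x * h) * tensorAct g := by
  simp only [tensorDer_apply, Finset.mul_sum, Finset.sum_mul, ← tensorAct_mul]
  refine Finset.sum_congr rfl fun i _ => congrArg _ ?_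
  ext j : 1
  have hj : ∀ j, h j * g j = 1 := fun j => congrFun hg j
  by_cases hij : j = i
  · subst hij
    simp [mul_assoc, hj]
  · simp [hij]

theorem tensorDer_scalar (t : ι → K) :
    tensorDer (fun i => t i • (1 : Mat2 K)) = (∑ i, t i) • 1 := by
  rw [tensorDer_apply, Finset.sum_smul]
  refine Finset.sum_congr rfl fun i _ => ?_
  rw [Pi.mulSingle, tensorAct_update_smul, Function.update_eq_self_iff.2 (by simp), tensorAct_one]

theorem tensorDer_diagonal (d : ι → Fin 2 → K) (s : ι → Fin 2) :
    tensorDer (fun i => Matrix.diagonal (d i)) (tensorBasis K ι s) =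
      (∑ i, d i (s i)) • tensorBasis K ι s := by
  rw [tensorDer_apply, LinearMap.sum_apply, Finset.sum_smul]
  refine Finset.sum_congr rfl fun i _ => ?_
  have h : (Pi.mulSingle i (Matrix.diagonal (d i)) : ι → Mat2 K) =
      fun j => Matrix.diagonal ((Pi.mulSingle i (d i) : ι → Fin 2 → K) j) := by
    ext j : 1
    by_cases hj : j = i
    · subst hj; simp
    · simp [hj]
  rw [h, tensorAct_diagonal, Finset.prod_eq_single i]
  · simp
  · intro j _ hj
    simp [hj]
  · simp

end TensorAction

/-! ### Diagonal operators and supports of eigenvectors -/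

section DiagonalOperators

variable {K V J : Type*} [Field K] [AddCommGroup V] [Module K V]

theorem repr_of_diagonal (b : Module.Basis J K V) {D : Module.End K V} {w : J → K}
    (hD : ∀ s, D (b s) = w s • b s) (v : V) (s : J) : b.repr (D v) s = w s * b.repr v s := by
  classical
  have h : b.coord s ∘ₗ D = w s • b.coord s := by
    refine b.ext fun s' => ?_
    simp only [LinearMap.comp_apply, hD, map_smul, LinearMap.smul_apply, b.coord_apply,
      b.repr_self, smul_eq_mul]
    by_cases h : s' = s
    · subst h; rfl
    · simp [h]
  exact LinearMap.congr_fun h v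

theorem weight_eq_of_apply_eq_smul (b : Module.Basis J K V) {D : Module.End K V} {w : J → K}
    (hD : ∀ s, D (b s) = w s • b s) {v : V} {μ : K} (hv : D v = μ • v) {s : J}
    (hs : b.repr v s ≠ 0) : w s = μ := by
  have h := repr_of_diagonal b hD v s
  rw [hv, map_smul, Finsupp.smul_apply, smul_eq_mul] at h
  exact (mul_right_cancel₀ hs h).symm

theorem apply_eq_smul_of_weight_eq (b : Module.Basis J K V) {D : Module.End K V} {w : J → K}
    (hD : ∀ s, D (b s) = w s • b s) {v : V} {μ : K} (hv : ∀ s, b.repr v s ≠ 0 → w s = μ) :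
    D v = μ • v := by
  refine b.repr.injective (Finsupp.ext fun s => ?_)
  rw [repr_of_diagonal b hD, map_smul, Finsupp.smul_apply, smul_eq_mul]
  by_cases hs : b.repr v s = 0
  · simp [hs]
  · rw [hv s hs]

end DiagonalOperators

/-! ### From group eigenvectors to Lie algebra eigenvectors -/

section Eigenvectors

variable {K ι : Type*} [Field K] [Fintype ι] [DecidableEq ι]

/-- If `v` is an eigenvector of a family of diagonalisable matrices, then it is an eigenvector for
the derived action of the matrices obtained by applying a homomorphism `Kˣ → K` to the
eigenvalues. -/
theorem exists_tensorDer_eq_smul (φ : Additive Kˣ →+ K) {P : ι → GL (Fin 2) K} {g : ι → Mat2 K}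
    {d : ι → Fin 2 → Kˣ} (hg : ∀ i, g i * P i = P i * Matrix.diagonal fun j => (d i j : K))
    {v : TensorPow K ι} (hv : ∃ t : K, tensorAct g v = t • v) :
    ∃ t : K, tensorDer (fun i => (P i : Mat2 K) *
      Matrix.diagonal (fun j => φ (Additive.ofMul (d i j))) *
      (((P i)⁻¹ : GL (Fin 2) K) : Mat2 K)) v = t • v := by
  obtain ⟨t, ht⟩ := hv
  set p : ι → Mat2 K := fun i => P i with hp
  set q : ι → Mat2 K := fun i => (((P i)⁻¹ : GL (Fin 2) K) : Mat2 K) with hq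
  have hqp : q * p = 1 := funext fun i => (P i).inv_mul
  have hpq : p * q = 1 := funext fun i => (P i).mul_inv
  set v' := tensorAct q v with hv'
  have hvv' : v = tensorAct p v' := by
    rw [hv', ← Module.End.mul_apply, ← tensorAct_mul, hpq, tensorAct_one]
    rfl
  have h1 : tensorAct (fun i => Matrix.diagonal fun j => (d i j : K)) v' = t • v' := by
    have h2 : (fun i => Matrix.diagonal fun j => (d i j : K)) * q = q * g := by
      ext i : 1
      have := hg i
      simp only [Pi.mul_apply, hq]
      rw [Units.eq_inv_mul_iff_mul_eq, ← mul_assoc, ← this, mul_assoc, Units.mul_inv, mul_one]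
    rw [hv', ← Module.End.mul_apply, ← tensorAct_mul, h2, tensorAct_mul, Module.End.mul_apply, ht,
      map_smul]
  have h3 : ∃ t : K, tensorDer (fun i => Matrix.diagonal fun j => φ (Additive.ofMul (d i j))) v' =
      t • v' := by
    by_cases hv0 : v' = 0
    · exact ⟨0, by simp [hv0]⟩
    obtain ⟨s₀, hs₀⟩ : ∃ s, (tensorBasis K ι).repr v' s ≠ 0 := by
      by_contra! hcon
      exact hv0 ((tensorBasis K ι).repr.injective (Finsupp.ext fun s => by simp [hcon s]))
    refine ⟨∑ i, φ (Additive.ofMul (d i (s₀ i))), apply_eq_smul_of_weight_eq _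
      (tensorDer_diagonal _) fun s hs => ?_⟩
    have e1 := weight_eq_of_apply_eq_smul _ (tensorAct_diagonal fun i j => (d i j : K)) h1 hs
    have e2 := weight_eq_of_apply_eq_smul _ (tensorAct_diagonal fun i j => (d i j : K)) h1 hs₀
    -- All basis vectors in the support of `v'` have the same multiplicative weight. Applying `φ`
    -- turns this into equality of additive weights.
    have e3 : ∏ i, d i (s i) = ∏ i, d i (s₀ i) := by
      ext
      push_cast
      rw [e1, e2]
    have e4 := congrArg (fun u => φ (Additive.ofMul u)) e3
    simpa only [ofMul_prod, map_sum] using e4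
  obtain ⟨u, hu⟩ := h3
  refine ⟨u, ?_⟩
  have h4 := congrArg (fun D => D v') (tensorAct_mul_tensorDer (g := p)
    (x := fun i => Matrix.diagonal fun j => φ (Additive.ofMul (d i j))) hqp)
  simp only [Module.End.mul_apply, hu, map_smul, ← hvv'] at h4
  exact h4.symm

end Eigenvectors

section Diagonalisation

variable {K : Type*} [Field K] [CharZero K]

theorem exists_diagonalisation [IsAlgClosed K] (x : GL (Fin 2) K)
    (hx : (x : Mat2 K).trace ^ 2 - 4 * (x : Mat2 K).det ≠ 0) :
    ∃ (P : GL (Fin 2) K) (d : Fin 2 → Kˣ), d 0 ≠ d 1 ∧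
      (x : Mat2 K) * P = P * Matrix.diagonal fun j => (d j : K) := by
  obtain ⟨δ, hδ⟩ := IsAlgClosed.exists_pow_nat_eq
    ((x : Mat2 K).trace ^ 2 - 4 * (x : Mat2 K).det) two_pos
  have hδ0 : δ ≠ 0 := fun h => hx (by rw [← hδ, h]; simp)
  have h2 : (2 : K) ≠ 0 := two_ne_zero
  set e : Fin 2 → K := ![((x : Mat2 K).trace + δ) / 2, ((x : Mat2 K).trace - δ) / 2] with he
  have he01 : e 0 - e 1 ≠ 0 := by
    have : e 0 - e 1 = δ := by simp [he]; ring
    rwa [this]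
  have hprod : e 0 * e 1 = (x : Mat2 K).det := by
    have : 4 * (e 0 * e 1) = 4 * (x : Mat2 K).det := by
      simp only [he, Matrix.cons_val_zero, Matrix.cons_val_one]
      linear_combination -hδ
    exact mul_left_cancel₀ (by norm_num) this
  have hsum : e 0 + e 1 = (x : Mat2 K).trace := by simp [he]; ring
  have hdet : (x : Mat2 K).det ≠ 0 := ((Matrix.isUnit_iff_isUnit_det _).1 x.isUnit).ne_zero
  have hroot : ∀ j, ((x : Mat2 K) - e j • (1 : Mat2 K)).det = 0 := by
    intro j
    rw [Matrix.det_fin_two] at hprod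
    rw [Matrix.trace_fin_two] at hsum
    fin_cases j <;> simp [Matrix.det_fin_two] <;> linear_combination -hprod + e _ * hsum
  have hev : ∀ j, ∃ v ≠ 0, (x : Mat2 K).mulVec v = e j • v := by
    intro j
    obtain ⟨v, hv0, hv⟩ := Matrix.exists_mulVec_eq_zero_iff.2 (hroot j)
    refine ⟨v, hv0, ?_⟩
    rwa [Matrix.sub_mulVec, Matrix.smul_mulVec, Matrix.one_mulVec, sub_eq_zero] at hv
  choose v hv0 hv using hev
  set M : Mat2 K := Matrix.of fun i j => v j i with hM
  have hMw : ∀ w : Fin 2 → K, M.mulVec w = w 0 • v 0 + w 1 • v 1 := fun w => by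
    ext i
    simp [hM, Matrix.mulVec, dotProduct, Fin.sum_univ_two, mul_comm]
  have hMdet : M.det ≠ 0 := by
    intro h0
    obtain ⟨w, hw0, hw⟩ := Matrix.exists_mulVec_eq_zero_iff.2 h0
    rw [hMw] at hw
    have h3 := congrArg (x : Mat2 K).mulVec hw
    rw [Matrix.mulVec_add, Matrix.mulVec_smul, Matrix.mulVec_smul, hv, hv, Matrix.mulVec_zero] at h3
    have h4 : ((e 0 - e 1) * w 0) • v 0 = 0 := by
      have : ((e 0 - e 1) * w 0) • v 0 = w 0 • e 0 • v 0 + w 1 • e 1 • v 1 -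
          e 1 • (w 0 • v 0 + w 1 • v 1) := by module
      rw [this, h3, hw]; simp
    have h5 : ((e 1 - e 0) * w 1) • v 1 = 0 := by
      have : ((e 1 - e 0) * w 1) • v 1 = w 0 • e 0 • v 0 + w 1 • e 1 • v 1 -
          e 0 • (w 0 • v 0 + w 1 • v 1) := by module
      rw [this, h3, hw]; simp
    have h6 : w 0 = 0 := by simpa [he01, hv0] using h4
    have h7 : w 1 = 0 := by
      have : e 1 - e 0 ≠ 0 := by rwa [← neg_sub, neg_ne_zero]
      simpa [this, hv0] using h5
    exact hw0 (by ext i; fin_cases i <;> simp [h6, h7])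
  have hej : ∀ j, e j ≠ 0 := by
    rw [← hprod] at hdet
    intro j
    fin_cases j
    · exact left_ne_zero_of_mul hdet
    · exact right_ne_zero_of_mul hdet
  refine ⟨Matrix.GeneralLinearGroup.mkOfDetNeZero M hMdet, fun j => Units.mk0 (e j) (hej j),
    fun h => he01 (sub_eq_zero.2 (congrArg Units.val h)), ?_⟩
  change (x : Mat2 K) * M = M * Matrix.diagonal e
  ext i j
  rw [Matrix.mul_diagonal]
  have := congrFun (hv j) i
  simpa [Matrix.mul_apply, Matrix.mulVec, dotProduct, hM, mul_comm] using this

/-- The powers of `u` form a copy of `ℤ` in `Kˣ`. In characteristic zero `K` is divisible, hence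
injective as a `ℤ`-module, so the inclusion `ℤ → K` extends. -/
theorem exists_addMonoidHom_ne_zero {u : Kˣ} (hu : ∀ n : ℕ, 0 < n → u ^ n ≠ 1) :
    ∃ φ : Additive Kˣ →+ K, φ (Additive.ofMul u) ≠ 0 := by
  have hinj : Function.Injective (zmultiplesHom (Additive Kˣ) (Additive.ofMul u)) := by
    rw [injective_iff_map_eq_zero]
    intro n hn
    by_contra hn0
    refine hu n.natAbs (Int.natAbs_pos.2 hn0) ?_
    have h1 : u ^ n = 1 := by
      simpa [← ofMul_zpow] using hn
    rcases Int.natAbs_eq n with h | h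
    · rw [h] at h1; exact_mod_cast h1
    · rw [h, zpow_neg, inv_eq_one] at h1; exact_mod_cast h1
  have hdiv : Module.Baer ℤ K := Module.Baer.of_divisible K
  obtain ⟨φ, hφ⟩ := hdiv.extension_property_addMonoidHom _ hinj (Int.castAddHom K)
  refine ⟨φ, ?_⟩
  have := DFunLike.congr_fun hφ 1
  simp at this
  rw [this]
  exact one_ne_zero

end Diagonalisation

theorem prod_comp_fin_two {H M : Type*} [Fintype H] [CommMonoid M] (d : Fin 2 → M) (s : H → Fin 2) :
    ∏ h, d (s h) = d 0 ^ (Finset.univ.filter fun h => s h = 0).card *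
      d 1 ^ (Finset.univ.filter fun h => s h = 1).card := by
  have h1 : ∀ h, d (s h) = if s h = 0 then d 0 else d 1 := fun h => by
    rcases Fin.exists_fin_two.1 ⟨s h, rfl⟩ with e | e <;> simp [e]
  have h2 : ∀ h, ¬s h = 0 ↔ s h = 1 := fun h => by omega
  simp only [h1, Finset.prod_ite, Finset.prod_const, h2]

theorem card_filter_add_card_filter {H : Type*} [Fintype H] (s : H → Fin 2) :
    (Finset.univ.filter fun h => s h = 0).card + (Finset.univ.filter fun h => s h = 1).card =
      Fintype.card H := by
  have h2 : ∀ h, s h = 1 ↔ ¬s h = 0 := fun h => by omega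
  simp only [h2]
  exact Finset.card_filter_add_card_filter_not _

/-! ### Joint eigenvectors are the invariants of a product of `sl_2` -/

section Invariants

variable {K C H : Type*} [Field K] [Fintype C] [Fintype H] [DecidableEq C] [DecidableEq H]

variable (K C H) in
/-- The vectors of the tensor power indexed by `C × H` which are killed by the Lie algebra
`sl_2 ^ C`, each factor acting diagonally through the coordinates in `{c} × H`. -/
def slInvariants : Submodule K (TensorPow K (C × H)) where
  carrier := {v | ∀ X : C → Mat2 K, (∀ c, (X c).trace = 0) →
    tensorDer (fun i : C × H => X i.1) v = 0}
  add_mem' hv hw X hX := by rw [map_add, hv X hX, hw X hX, add_zero]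
  zero_mem' X _ := map_zero _
  smul_mem' t v hv X hX := by rw [map_smul, hv X hX, smul_zero]

theorem mem_slInvariants {v : TensorPow K (C × H)} : v ∈ slInvariants K C H ↔
    ∀ X : C → Mat2 K, (∀ c, (X c).trace = 0) → tensorDer (fun i : C × H => X i.1) v = 0 :=
  Iff.rfl

theorem tensorDer_tensorAct_apply (g : C → GL (Fin 2) K) (X : C → Mat2 K)
    (v : TensorPow K (C × H)) :
    tensorAct (fun i : C × H => (g i.1 : Mat2 K)) (tensorDer (fun i : C × H => X i.1) v) =
      tensorDer (fun i : C × H => (g i.1 : Mat2 K) * X i.1 *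
        (((g i.1)⁻¹ : GL (Fin 2) K) : Mat2 K))
        (tensorAct (fun i : C × H => (g i.1 : Mat2 K)) v) :=
  congrArg (fun D => D v) (tensorAct_mul_tensorDer (g := fun i : C × H => (g i.1 : Mat2 K))
    (h := fun i : C × H => (((g i.1)⁻¹ : GL (Fin 2) K) : Mat2 K))
    (x := fun i : C × H => X i.1) (funext fun i => (g i.1).inv_mul))

theorem tensorAct_mem_slInvariants (g : C → GL (Fin 2) K) {v : TensorPow K (C × H)}
    (hv : v ∈ slInvariants K C H) :
    tensorAct (fun i : C × H => (g i.1 : Mat2 K)) v ∈ slInvariants K C H := by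
  intro X hX
  have h := tensorDer_tensorAct_apply g
    (fun c => (((g c)⁻¹ : GL (Fin 2) K) : Mat2 K) * X c * (g c : Mat2 K)) v
  have h0 := hv (fun c => (((g c)⁻¹ : GL (Fin 2) K) : Mat2 K) * X c * (g c : Mat2 K)) fun c => by
    rw [Matrix.trace_mul_comm, ← mul_assoc, Units.mul_inv, one_mul, hX]
  rw [h0, map_zero] at h
  simpa only [mul_assoc, Units.mul_inv, mul_one, Units.mul_inv_cancel_left] using h.symm

theorem commutator_tensorDer (X Y : C → Mat2 K) (v : TensorPow K (C × H)) :
    tensorDer (fun i : C × H => (X * Y - Y * X) i.1) v =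
      tensorDer (fun i : C × H => X i.1) (tensorDer (fun i : C × H => Y i.1) v) -
        tensorDer (fun i : C × H => Y i.1) (tensorDer (fun i : C × H => X i.1) v) :=
  congrArg (fun D => D v) (tensorDer_lie (fun i : C × H => X i.1) fun i : C × H => Y i.1)

theorem isNonscalar_conj_diagonal {P : GL (Fin 2) K} {d : Fin 2 → K} (hd : d 0 ≠ d 1) :
    IsNonscalar ((P : Mat2 K) * Matrix.diagonal d * ((P⁻¹ : GL (Fin 2) K) : Mat2 K)) := by
  by_contra hcon
  rw [not_isNonscalar_iff] at hcon
  set t := ((P : Mat2 K) * Matrix.diagonal d * ((P⁻¹ : GL (Fin 2) K) : Mat2 K)) 0 0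
  rw [Units.mul_inv_eq_iff_eq_mul, smul_mul_assoc, one_mul, ← mul_one (P : Mat2 K),
    ← mul_smul_comm, mul_assoc, one_mul] at hcon
  have h := P.isUnit.mul_left_cancel hcon
  have h0 := congrFun (congrFun h 0) 0
  have h1 := congrFun (congrFun h 1) 1
  simp at h0 h1
  exact hd (h0.trans h1.symm)

/-- The joint eigenvectors of a group acting through pairwise inequivalent representations with
large image are killed by `sl_2 ^ C`. -/
theorem mem_slInvariants_of_eigenvector [CharZero K] [IsAlgClosed K] {Γ : Type*} [Group Γ]
    {ρ : C → Γ →* GL (Fin 2) K} (henv : ∀ c, SLsub 2 K ≤ algebraicEnvelope (ρ c).range)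
    (hne : ∀ c d, c ≠ d → ¬∃ a : GL (Fin 2) K, ∀ γ, ∃ t : K,
      (ρ d γ : Mat2 K) * a = t • (a * (ρ c γ : Mat2 K)))
    (hreg : ∃ γ, ∀ c, (ρ c γ : Mat2 K).trace ^ 2 - 4 * (ρ c γ : Mat2 K).det ≠ 0 ∧
      ∀ n : ℕ, 0 < n → IsNonscalar ((ρ c γ : Mat2 K) ^ n))
    {v : TensorPow K (C × H)}
    (hv : ∀ γ, ∃ t : K, tensorAct (fun i : C × H => (ρ i.1 γ : Mat2 K)) v = t • v) :
    v ∈ slInvariants K C H := by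
  -- The condition quantifies over all joint eigenvectors, which makes `L` independent of `v` and
  -- stable under the adjoint action.
  set L : Submodule K (C → Mat2 K) :=
    { carrier := {X | ∀ v : TensorPow K (C × H),
        (∀ γ, ∃ t : K, tensorAct (fun i : C × H => (ρ i.1 γ : Mat2 K)) v = t • v) →
          ∃ t : K, tensorDer (fun i : C × H => X i.1) v = t • v}
      add_mem' := fun {X Y} hX hY v hv => by
        obtain ⟨a, ha⟩ := hX v hv
        obtain ⟨b, hb⟩ := hY v hv
        exact ⟨a + b, by
          rw [add_smul, ← ha, ← hb, ← LinearMap.add_apply, ← map_add]; rfl⟩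
      zero_mem' := fun v _ => ⟨0, by
        rw [zero_smul]
        exact congrArg (fun D : Module.End K _ => D v) (map_zero tensorDer)⟩
      smul_mem' := fun t X hX v hv => by
        obtain ⟨a, ha⟩ := hX v hv
        exact ⟨t * a, by rw [mul_smul, ← ha, ← LinearMap.smul_apply, ← map_smul]; rfl⟩ } with hLdef
  have hL : IsAdStable ρ L := by
    refine ⟨fun X hX Y hY v hv => ?_, fun t v _ => ?_, fun γ X hX v hv => ?_⟩
    · obtain ⟨a, ha⟩ := hX v hv
      obtain ⟨b, hb⟩ := hY v hv
      refine ⟨0, ?_⟩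
      rw [commutator_tensorDer, ha, hb, map_smul, map_smul, ha, hb, smul_comm, sub_self, zero_smul]
    · exact ⟨_, congrArg (fun D => D v) (tensorDer_scalar fun i : C × H => t i.1)⟩
    · set w := tensorAct (fun i : C × H => (ρ i.1 γ⁻¹ : Mat2 K)) v with hw
      have hinv : ∀ γ₁ γ₂ : Γ, ∀ u : TensorPow K (C × H),
          tensorAct (fun i : C × H => (ρ i.1 γ₁ : Mat2 K))
            (tensorAct (fun i : C × H => (ρ i.1 γ₂ : Mat2 K)) u) =
          tensorAct (fun i : C × H => (ρ i.1 (γ₁ * γ₂) : Mat2 K)) u := fun γ₁ γ₂ u => by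
        rw [← Module.End.mul_apply, ← tensorAct_mul]
        congr 2
        ext i : 1
        simp
      have hv1 : v = tensorAct (fun i : C × H => (ρ i.1 γ : Mat2 K)) w := by
        rw [hw, hinv, mul_inv_cancel]
        simp only [map_one, Units.val_one]
        exact (congrArg (fun D : Module.End K _ => D v) tensorAct_one).symm
      obtain ⟨b, hb⟩ := hv γ⁻¹
      have hwe : ∀ γ, ∃ t : K, tensorAct (fun i : C × H => (ρ i.1 γ : Mat2 K)) w = t • w := by
        intro γ'
        obtain ⟨t, ht⟩ := hv γ'
        refine ⟨t, ?_⟩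
        rw [hw, hb, map_smul, ht, smul_comm]
      obtain ⟨t, ht⟩ := hX w hwe
      refine ⟨t, ?_⟩
      have h := tensorDer_tensorAct_apply (fun c => ρ c γ) X w
      rw [← hv1, ht, map_smul, ← hv1] at h
      exact h.symm
  have hns : ∀ c, ∃ X ∈ L, IsNonscalar (X c) := by
    intro c
    obtain ⟨γ, hγ⟩ := hreg
    choose P d hd hP using fun c => exists_diagonalisation (ρ c γ) (hγ c).1
    have hu : ∀ n : ℕ, 0 < n → (d c 0 / d c 1) ^ n ≠ 1 := by
      intro n hn h
      have h1 : ∀ n, (ρ c γ : Mat2 K) ^ n * P c =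
          P c * Matrix.diagonal fun j => (d c j : K) ^ n := by
        intro n
        induction n with
        | zero => simp
        | succ n ih =>
          rw [pow_succ, mul_assoc, hP, ← mul_assoc, ih, mul_assoc, Matrix.diagonal_mul_diagonal]
          simp only [pow_succ]
      rw [div_pow, div_eq_one] at h
      have h2 : (Matrix.diagonal fun j => (d c j : K) ^ n) = (d c 0 : K) ^ n • (1 : Mat2 K) := by
        have h3 : (d c 0 : K) ^ n = (d c 1 : K) ^ n := by exact_mod_cast congrArg Units.val h
        ext i j
        fin_cases i <;> fin_cases j <;> simp [h3]
      have h4 := h1 n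
      rw [h2, mul_smul_comm, mul_one, ← one_mul (P c : Mat2 K), ← smul_mul_assoc,
        ← mul_assoc, mul_one] at h4
      have h5 := (P c).isUnit.mul_right_cancel h4
      have h6 := (hγ c).2 n hn
      rw [h5] at h6
      simp [IsNonscalar] at h6
    -- No power of `ρ c γ` is scalar, so its ratio of eigenvalues has infinite order and `φ` can be
    -- chosen nonzero on it. The choice depends on `c`, while `γ` serves all factors.
    obtain ⟨φ, hφ⟩ := exists_addMonoidHom_ne_zero hu
    refine ⟨fun c => (P c : Mat2 K) * Matrix.diagonal (fun j => φ (Additive.ofMul (d c j))) *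
      (((P c)⁻¹ : GL (Fin 2) K) : Mat2 K), fun v hv =>
        exists_tensorDer_eq_smul φ (P := fun i : C × H => P i.1) (d := fun i => d i.1)
          (fun i => hP i.1) (hv γ), isNonscalar_conj_diagonal fun h => hφ ?_⟩
    rw [ofMul_div, map_sub, h, sub_self]
  have htop := hL.eq_top henv hns hne
  -- Now every tuple acts on `v` by a scalar, and scalars commute. The traceless tuple `X` is then
  -- written as a sum of commutators.
  have hbr : ∀ X Y : C → Mat2 K, tensorDer (fun i : C × H => (X * Y - Y * X) i.1) v = 0 := by
    intro X Y
    obtain ⟨a, ha⟩ := (htop ▸ Submodule.mem_top : X ∈ L) v hv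
    obtain ⟨b, hb⟩ := (htop ▸ Submodule.mem_top : Y ∈ L) v hv
    rw [commutator_tensorDer, ha, hb, map_smul, map_smul, ha, hb, smul_comm, sub_self]
  intro X hX
  have hdecomp : (fun i : C × H => X i.1) =
      (fun i : C × H => ((fun c => (X c 0 1 / 2) • matH K) * (fun _ => matE K) -
        (fun _ => matE K) * fun c => (X c 0 1 / 2) • matH K : C → Mat2 K) i.1) +
      (fun i : C × H => ((fun c => (-X c 1 0 / 2) • matH K) * (fun _ => matF K) -
        (fun _ => matF K) * fun c => (-X c 1 0 / 2) • matH K : C → Mat2 K) i.1) +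
      (fun i : C × H => ((fun c => X c 0 0 • matE K) * (fun _ => matF K) -
        (fun _ => matF K) * fun c => X c 0 0 • matE K : C → Mat2 K) i.1) := by
    ext ⟨c, h⟩ i j
    have h1 := hX c
    rw [Matrix.trace_fin_two] at h1
    fin_cases i <;> fin_cases j <;> simp [matE, matF, matH]
    · ring
    · linear_combination h1
  rw [hdecomp, map_add, map_add, LinearMap.add_apply, LinearMap.add_apply, hbr, hbr, hbr,
    add_zero, add_zero]

/-- Coordinates of invariant vectors are supported on the balanced multi-indices. -/
theorem card_filter_eq_of_mem_slInvariants [CharZero K] {v : TensorPow K (C × H)}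
    (hv : v ∈ slInvariants K C H) {s : C × H → Fin 2} (hs : (tensorBasis K (C × H)).repr v s ≠ 0)
    (c : C) : (Finset.univ.filter fun h => s (c, h) = 0).card =
      (Finset.univ.filter fun h => s (c, h) = 1).card := by
  set D : C × H → Fin 2 → K := fun i => if i.1 = c then ![1, -1] else 0 with hD
  have h1 : tensorDer (fun i : C × H => Matrix.diagonal (D i)) v = 0 • v := by
    have := hv (fun c' => Matrix.diagonal (if c' = c then ![1, -1] else 0)) fun c' => by
      by_cases h : c' = c <;> simp [h]
    rw [zero_smul]
    exact this
  have h2 := weight_eq_of_apply_eq_smul _ (tensorDer_diagonal D) (μ := (0 : K))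
    (by rw [h1]; simp) hs
  rw [Fintype.sum_prod_type, Finset.sum_eq_single c] at h2
  · have h3 := congrArg Multiplicative.toAdd
      (prod_comp_fin_two (fun j => Multiplicative.ofAdd ((![1, -1] : Fin 2 → K) j))
        fun h => s (c, h))
    simp only [hD, if_true] at h2
    simp only [toAdd_prod, toAdd_ofAdd, toAdd_mul, toAdd_pow, h2] at h3
    simp at h3
    have h4 := (add_neg_eq_zero.1 h3.symm)
    exact_mod_cast h4
  · intro c' _ hc'
    simp [hD, hc']
  · simp

theorem tensorAct_diagonal_of_mem_slInvariants [CharZero K] {k : ℕ} (hk : Fintype.card H = 2 * k)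
    {v : TensorPow K (C × H)} (hv : v ∈ slInvariants K C H) (d : C → Fin 2 → K) :
    tensorAct (fun i : C × H => Matrix.diagonal (d i.1)) v =
      (∏ c, (d c 0 * d c 1) ^ k) • v := by
  refine apply_eq_smul_of_weight_eq _ (tensorAct_diagonal fun i : C × H => d i.1) fun s hs => ?_
  rw [Fintype.prod_prod_type]
  refine Finset.prod_congr rfl fun c _ => ?_
  have h1 := card_filter_eq_of_mem_slInvariants hv hs c
  have h2 := card_filter_add_card_filter fun h => s (c, h)
  have h3 : (Finset.univ.filter fun h => s (c, h) = 1).card = k := by omega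
  dsimp only
  rw [prod_comp_fin_two (d c) fun h => s (c, h), h1, h3, mul_pow]

/-- Diagonalise each factor. The change of basis preserves the invariants, and a balanced
multi-index sees each eigenvalue exactly `k` times. -/
theorem tensorAct_of_disc_ne_zero [CharZero K] [IsAlgClosed K] {k : ℕ}
    (hk : Fintype.card H = 2 * k) {v : TensorPow K (C × H)} (hv : v ∈ slInvariants K C H)
    (g : C → GL (Fin 2) K)
    (hg : ∀ c, (g c : Mat2 K).trace ^ 2 - 4 * (g c : Mat2 K).det ≠ 0) :
    tensorAct (fun i : C × H => (g i.1 : Mat2 K)) v = (∏ c, (g c : Mat2 K).det ^ k) • v := by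
  choose P d _ hP using fun c => exists_diagonalisation (g c) (hg c)
  have hdet : ∀ c, (g c : Mat2 K).det = (d c 0 : K) * d c 1 := by
    intro c
    have h := congrArg Matrix.det (hP c)
    rw [Matrix.det_mul, Matrix.det_mul, mul_comm] at h
    have h0 : (P c : Mat2 K).det ≠ 0 := ((Matrix.isUnit_iff_isUnit_det _).1 (P c).isUnit).ne_zero
    rw [mul_left_cancel₀ h0 h, Matrix.det_diagonal, Fin.prod_univ_two]
  have hw := tensorAct_mem_slInvariants (fun c => (P c)⁻¹) hv
  have h1 := tensorAct_diagonal_of_mem_slInvariants hk hw fun c j => (d c j : K)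
  have h2 : (fun i : C × H => (g i.1 : Mat2 K)) = (fun i : C × H => (P i.1 : Mat2 K)) *
      ((fun i : C × H => Matrix.diagonal fun j => (d i.1 j : K)) *
        fun i : C × H => (((P i.1)⁻¹ : GL (Fin 2) K) : Mat2 K)) := by
    ext i : 1
    simp only [Pi.mul_apply]
    rw [← mul_assoc, ← hP, mul_assoc, Units.mul_inv, mul_one]
  have h3 : (fun i : C × H => (P i.1 : Mat2 K)) *
      (fun i : C × H => (((P i.1)⁻¹ : GL (Fin 2) K) : Mat2 K)) = 1 :=
    funext fun i => Units.mul_inv _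
  rw [h2, tensorAct_mul, tensorAct_mul, Module.End.mul_apply, Module.End.mul_apply, h1, map_smul,
    ← Module.End.mul_apply, ← tensorAct_mul, h3, tensorAct_one, Module.End.one_apply]
  simp only [hdet]

/-- This reduces arbitrary matrices to diagonalisable ones. Split off `diag (u⁻¹, 1)`: the
discriminant of the other factor is a polynomial in `u` of degree at most two, and it cannot vanish
at 2, 3 and 4 because the determinant is nonzero. -/
theorem exists_eq_mul_disc_ne_zero [CharZero K] (g : GL (Fin 2) K) : ∃ g₁ g₂ : GL (Fin 2) K,
    g = g₁ * g₂ ∧ (g₁ : Mat2 K).trace ^ 2 - 4 * (g₁ : Mat2 K).det ≠ 0 ∧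
      (g₂ : Mat2 K).trace ^ 2 - 4 * (g₂ : Mat2 K).det ≠ 0 := by
  have hdet : (g : Mat2 K).det ≠ 0 := ((Matrix.isUnit_iff_isUnit_det _).1 g.isUnit).ne_zero
  have key : ∀ u : K, u ≠ 0 → u ≠ 1 →
      ((g : Mat2 K) 0 0 * u + (g : Mat2 K) 1 1) ^ 2 - 4 * ((g : Mat2 K).det * u) ≠ 0 →
      ∃ g₁ g₂ : GL (Fin 2) K,
        g = g₁ * g₂ ∧ (g₁ : Mat2 K).trace ^ 2 - 4 * (g₁ : Mat2 K).det ≠ 0 ∧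
          (g₂ : Mat2 K).trace ^ 2 - 4 * (g₂ : Mat2 K).det ≠ 0 := by
    intro u hu0 hu1 hu
    let a : GL (Fin 2) K := Matrix.GeneralLinearGroup.mkOfDetNeZero !![u, 0; 0, 1]
      (by simpa [Matrix.det_fin_two] using hu0)
    have ha : (a : Mat2 K) = !![u, 0; 0, 1] := rfl
    let b : GL (Fin 2) K := Matrix.GeneralLinearGroup.mkOfDetNeZero !![u⁻¹, 0; 0, 1]
      (by simpa [Matrix.det_fin_two] using hu0)
    have hb : (b : Mat2 K) = !![u⁻¹, 0; 0, 1] := rfl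
    have hba : b * a = 1 := by
      apply Units.ext
      rw [Units.val_mul, ha, hb]
      simp [hu0, Matrix.one_fin_two]
    refine ⟨b, a * g, by rw [← mul_assoc, hba, one_mul], ?_, ?_⟩
    · rw [hb]
      have : u⁻¹ - 1 ≠ 0 := by
        rw [sub_ne_zero]; simpa using hu1
      have h2 := pow_ne_zero 2 this
      convert h2 using 1
      simp [Matrix.det_fin_two, Matrix.trace_fin_two]
      ring
    · convert hu using 1
      rw [Units.val_mul, Matrix.det_mul, ha, Matrix.trace_fin_two]
      simp [Matrix.mul_apply, Fin.sum_univ_two, Matrix.det_fin_two]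
      ring
  by_contra hcon
  have h2 := not_not.1 fun h => hcon (key 2 (by norm_num) (by norm_num) h)
  have h3 := not_not.1 fun h => hcon (key 3 (by norm_num) (by norm_num) h)
  have h4 := not_not.1 fun h => hcon (key 4 (by norm_num) (by norm_num) h)
  have ha : (g : Mat2 K) 0 0 = 0 := by
    have : (g : Mat2 K) 0 0 ^ 2 = 0 := by linear_combination (h2 + h4 - 2 * h3) / 2
    exact pow_eq_zero_iff two_ne_zero |>.1 this
  rw [ha] at h2 h3
  exact hdet (by linear_combination (h2 - h3) / 4)

/-- A family of invertible matrices acts on invariant vectors through the determinants. -/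
theorem tensorAct_of_mem_slInvariants [CharZero K] [IsAlgClosed K] {k : ℕ}
    (hk : Fintype.card H = 2 * k) {v : TensorPow K (C × H)} (hv : v ∈ slInvariants K C H)
    (g : C → GL (Fin 2) K) :
    tensorAct (fun i : C × H => (g i.1 : Mat2 K)) v = (∏ c, (g c : Mat2 K).det ^ k) • v := by
  choose g₁ g₂ hg h1 h2 using fun c => exists_eq_mul_disc_ne_zero (g c)
  have h3 : (fun i : C × H => (g i.1 : Mat2 K)) = (fun i : C × H => (g₁ i.1 : Mat2 K)) *
      fun i : C × H => (g₂ i.1 : Mat2 K) := by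
    ext i : 1
    rw [Pi.mul_apply, hg, Units.val_mul]
  rw [h3, tensorAct_mul, Module.End.mul_apply, tensorAct_of_disc_ne_zero hk hv g₂ h2, map_smul,
    tensorAct_of_disc_ne_zero hk hv g₁ h1, smul_smul, mul_comm, ← Finset.prod_mul_distrib]
  congr 1
  refine Finset.prod_congr rfl fun c _ => ?_
  rw [hg, Units.val_mul, Matrix.det_mul, mul_pow]

/-- An odd number of slots admits no balanced multi-index. -/
theorem slInvariants_eq_bot_of_odd [CharZero K] [Nonempty C] (hH : Odd (Fintype.card H)) :
    slInvariants K C H = ⊥ := by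
  refine (Submodule.eq_bot_iff _).2 fun v hv => ?_
  refine (tensorBasis K (C × H)).repr.injective (Finsupp.ext fun s => ?_)
  rw [map_zero, Finsupp.zero_apply]
  by_contra hs
  obtain ⟨c⟩ := ‹Nonempty C›
  have h1 := card_filter_eq_of_mem_slInvariants hv hs c
  have h2 := card_filter_add_card_filter fun h => s (c, h)
  obtain ⟨k, hk⟩ := hH
  omega

end Invariants

/-! ### Dimension of the invariants of `sl_2` from weight spaces -/

section Ladder

variable {K V : Type*} [Field K] [AddCommGroup V] [Module K V]

/-- In a representation of `sl_2` whose weights are bounded, a vector of positive weight `k` on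
which the Casimir operator vanishes is zero. -/
theorem eq_zero_of_casimir [CharZero K] {E F H : Module.End K V} (hHE : H * E - E * H = (2 : K) • E)
    (hEF : E * F - F * E = H) {B : ℕ} (hB : ∀ k : ℕ, B < k → ∀ v, H v = (k : K) • v → v = 0)
    {k : ℕ} (hk : 0 < k) {v : V} (hv : H v = (k : K) • v)
    (hFE : (2 : K) • F (E v) = -((k : K) + (k : K) ^ 2 / 2) • v) : v = 0 := by
  have key : ∀ N k : ℕ, B < k + N → 0 < k → ∀ v : V, H v = (k : K) • v →
      (2 : K) • F (E v) = -((k : K) + (k : K) ^ 2 / 2) • v → v = 0 := by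
    intro N
    induction N with
    | zero => exact fun k hk _ v hv _ => hB k hk v hv
    | succ N ih =>
      -- The hypothesis on `F E v` says that the Casimir `H² + 2H + 4FE` kills `v`, hence also `E
      -- v`, of weight `k + 2`. Climbing past the bound gives `E v = 0`, and then the nonzero
      -- coefficient `k + k²/2` forces `v = 0`.
      intro k hkN hk v hv hFE
      have hHEv : H (E v) = ((k + 2 : ℕ) : K) • E v := by
        have := congrArg (fun D => D v) hHE
        simp only [LinearMap.sub_apply, Module.End.mul_apply, LinearMap.smul_apply, hv,
          map_smul] at this
        rw [sub_eq_iff_eq_add.1 this]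
        push_cast
        module
      have hEv : E v = 0 := by
        refine ih (k + 2) (by omega) (by omega) _ hHEv ?_
        have h1 := congrArg (fun D => D (E v)) hEF
        simp only [LinearMap.sub_apply, Module.End.mul_apply] at h1
        have h2 : F (E (E v)) = E (F (E v)) - H (E v) := by rw [← h1]; abel
        have h3 := congrArg E hFE
        rw [map_smul, map_smul] at h3
        rw [h2, smul_sub, h3, hHEv, smul_smul, ← sub_smul]
        congr 1
        push_cast
        ring
      rw [hEv, map_zero, smul_zero] at hFE
      refine (smul_eq_zero.1 hFE.symm).resolve_left (neg_ne_zero.2 ?_)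
      have h4 : (k : K) + (k : K) ^ 2 / 2 = ((2 * k + k ^ 2 : ℕ) : K) / 2 := by
        push_cast; ring
      rw [h4]
      exact div_ne_zero (Nat.cast_ne_zero.2 (by positivity)) two_ne_zero
  exact key (B + 1) k (by omega) hk v hv hFE

theorem finrank_eigenspace_of_diagonal {J : Type*} [Fintype J]
    (b : Module.Basis J K V) {D : Module.End K V} {w : J → K}
    (hD : ∀ s, D (b s) = w s • b s) (μ : K) [DecidablePred fun s => w s = μ] :
    Module.finrank K (D.eigenspace μ) = (Finset.univ.filter fun s => w s = μ).card := by
  have h : D.eigenspace μ = Submodule.span K (Set.range fun s : {s // w s = μ} => b s) := by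
    have h1 : (Set.range fun s : {s // w s = μ} => b s) = b '' {s | w s = μ} := by
      ext x; simp
    ext v
    rw [h1, b.mem_span_image, Module.End.mem_eigenspace_iff]
    constructor
    · intro hv s hs
      exact weight_eq_of_apply_eq_smul b hD hv (Finsupp.mem_support_iff.1 hs)
    · intro hv
      exact apply_eq_smul_of_weight_eq b hD fun s hs => hv (Finsupp.mem_support_iff.2 hs)
  have h2 := finrank_span_eq_card (b := fun s : {s // w s = μ} => b s)
    (b.linearIndependent.comp _ Subtype.val_injective)
  rw [h, h2, Fintype.card_subtype]

/-- The dimension of the space of invariants of a finite-dimensional representation of `sl_2`. -/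
theorem finrank_invariants [CharZero K] [FiniteDimensional K V] {E F H : Module.End K V}
    (hHE : H * E - E * H = (2 : K) • E) (hHF : H * F - F * H = (-2 : K) • F)
    (hEF : E * F - F * E = H) {B : ℕ} (hB : ∀ k : ℕ, B < k → ∀ v, H v = (k : K) • v → v = 0)
    (hB' : ∀ k : ℕ, B < k → ∀ v, H v = -(k : K) • v → v = 0) :
    Module.finrank K (LinearMap.ker E ⊓ LinearMap.ker F ⊓ LinearMap.ker H : Submodule K V) =
      Module.finrank K (H.eigenspace 0) - Module.finrank K (H.eigenspace 2) := by
  have hE0 : ∀ v ∈ H.eigenspace 0, E v ∈ H.eigenspace 2 := by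
    intro v hv
    rw [Module.End.mem_eigenspace_iff] at hv ⊢
    have := congrArg (fun D => D v) hHE
    simpa [hv] using this
  have hF2 : ∀ v ∈ H.eigenspace 2, F v ∈ H.eigenspace 0 := by
    intro v hv
    rw [Module.End.mem_eigenspace_iff] at hv ⊢
    have := congrArg (fun D => D v) hHF
    simpa [hv, sub_eq_iff_eq_add] using this
  have hinj : ∀ v ∈ H.eigenspace 2, E (F v) = 0 → v = 0 := by
    intro v hv h0
    rw [Module.End.mem_eigenspace_iff] at hv
    refine eq_zero_of_casimir hHE hEF hB two_pos (by exact_mod_cast hv) ?_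
    have := congrArg (fun D => D v) hEF
    simp only [LinearMap.sub_apply, Module.End.mul_apply, h0, zero_sub, hv] at this
    rw [neg_eq_iff_eq_neg.1 this, smul_neg, smul_smul, ← neg_smul]
    congr 1
    norm_num
  let e : H.eigenspace 0 →ₗ[K] H.eigenspace 2 := E.restrict hE0
  let f : H.eigenspace 2 →ₗ[K] H.eigenspace 0 := F.restrict hF2
  -- On the weight space 2 the composite `E F` is injective, hence bijective by finite dimension. So
  -- the kernel of `E` on weight 0 has the dimension claimed.
  have hsurj : Function.Surjective e := by
    have h1 : Function.Injective (e ∘ₗ f) := by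
      rw [injective_iff_map_eq_zero]
      intro v hv
      exact Subtype.ext (hinj v v.2 (congrArg Subtype.val hv))
    have h2 := LinearMap.injective_iff_surjective.1 h1
    exact Function.Surjective.of_comp h2
  have hker : (LinearMap.ker E ⊓ LinearMap.ker F ⊓ LinearMap.ker H : Submodule K V) =
      (LinearMap.ker e).map (H.eigenspace 0).subtype := by
    ext v
    simp only [Submodule.mem_inf, LinearMap.mem_ker, Submodule.mem_map, Submodule.subtype_apply]
    constructor
    · rintro ⟨⟨h1, -⟩, h2⟩
      exact ⟨⟨v, by rw [Module.End.mem_eigenspace_iff, h2, zero_smul]⟩, Subtype.ext h1, rfl⟩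
    · rintro ⟨⟨v, hv⟩, h1, rfl⟩
      have hEv : E v = 0 := congrArg Subtype.val h1
      have hHv : H v = 0 := by simpa using Module.End.mem_eigenspace_iff.1 hv
      refine ⟨⟨hEv, ?_⟩, hHv⟩
      have hEFv : E (F v) = 0 := by
        have := congrArg (fun D => D v) hEF
        simpa [hEv, hHv] using this
      have hHFv : H (F v) = (-2 : K) • F v := by
        have := congrArg (fun D => D v) hHF
        simpa [hHv] using this
      -- `F v` has weight -2 and is killed by `E`. In the opposite triple its weight is 2, so the
      -- ladder argument gives `F v = 0`.
      refine eq_zero_of_casimir (E := F) (F := E) (H := -H) (B := B) (k := 2) ?_ ?_ ?_ two_pos ?_ ?_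
      · rw [neg_mul, mul_neg, ← neg_sub', hHF, neg_smul, neg_neg]
      · rw [← hEF]; abel
      · intro k hk v hv
        refine hB' k hk v ?_
        rw [LinearMap.neg_apply] at hv
        rw [neg_smul, ← hv, neg_neg]
      · rw [LinearMap.neg_apply, hHFv]
        push_cast
        module
      · have := congrArg (fun D => D (F v)) hEF
        simp only [LinearMap.sub_apply, Module.End.mul_apply, hEFv, map_zero, sub_zero,
          hHFv] at this
        rw [this, smul_smul]
        congr 1
        norm_num
  rw [hker, ← (Submodule.equivMapOfInjective _ (H.eigenspace 0).injective_subtype _).finrank_eq]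
  have h1 := LinearMap.finrank_range_add_finrank_ker e
  rw [LinearMap.range_eq_top.2 hsurj, finrank_top] at h1
  omega

end Ladder

/-! ### Counting weights in one tensor power -/

section SingleFactor

variable {K H : Type*} [Field K] [Fintype H] [DecidableEq H]

variable (K H) in
/-- The action of `sl_2` on a tensor power through the diagonal. -/
def diagDer (x : Mat2 K) : Module.End K (TensorPow K H) := tensorDer fun _ => x

variable (K H) in
/-- The invariants of `sl_2` acting diagonally on a tensor power. -/
def diagInvariants : Submodule K (TensorPow K H) :=
  LinearMap.ker (diagDer K H (matE K)) ⊓ LinearMap.ker (diagDer K H (matF K)) ⊓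
    LinearMap.ker (diagDer K H (matH K))

theorem card_filter_card_filter_eq (j : ℕ) :
    (Finset.univ.filter fun s : H → Fin 2 => (Finset.univ.filter fun h => s h = 1).card = j).card =
      (Fintype.card H).choose j := by
  rw [← Finset.card_univ, ← Finset.card_powersetCard]
  refine Finset.card_bij' (fun s _ => Finset.univ.filter fun h => s h = 1)
    (fun t _ h => if h ∈ t then 1 else 0) ?_ ?_ ?_ ?_
  · intro s hs
    simpa using hs
  · intro t ht
    simpa using ht
  · intro s _
    ext h : 1
    rcases Fin.exists_fin_two.1 ⟨s h, rfl⟩ with e | e <;> simp [e]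
  · intro t _
    ext h
    simp

theorem diagDer_lie (x y : Mat2 K) :
    diagDer K H x * diagDer K H y - diagDer K H y * diagDer K H x = diagDer K H (x * y - y * x) :=
  (tensorDer_lie (fun _ : H => x) fun _ => y).symm

theorem diagDer_smul (t : K) (x : Mat2 K) : diagDer K H (t • x) = t • diagDer K H x :=
  map_smul tensorDer t fun _ : H => x

theorem diagDer_matH (s : H → Fin 2) : diagDer K H (matH K) (tensorBasis K H s) =
    (((Finset.univ.filter fun h => s h = 0).card : K) -
      (Finset.univ.filter fun h => s h = 1).card) • tensorBasis K H s := by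
  have h1 : matH K = Matrix.diagonal ![1, -1] := by
    ext i j
    fin_cases i <;> fin_cases j <;> simp [matH]
  rw [diagDer, h1, tensorDer_diagonal fun _ : H => ![1, -1]]
  congr 1
  have h3 := congrArg Multiplicative.toAdd
    (prod_comp_fin_two (fun j => Multiplicative.ofAdd ((![1, -1] : Fin 2 → K) j)) s)
  simp only [toAdd_prod, toAdd_ofAdd, toAdd_mul, toAdd_pow] at h3
  rw [h3]
  simp [sub_eq_add_neg]

/-- The dimension of the space of invariants of `sl_2` on an even tensor power. -/
theorem finrank_diagInvariants [CharZero K] {k : ℕ} (hk : 0 < k) (hH : Fintype.card H = 2 * k) :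
    Module.finrank K (diagInvariants K H) =
      (2 * k).choose k - (2 * k).choose (k - 1) := by
  classical
  have hfin : FiniteDimensional K (TensorPow K H) :=
    Module.Finite.of_basis (tensorBasis K H)
  have hle : ∀ s : H → Fin 2, (Finset.univ.filter fun h => s h = 0).card +
      (Finset.univ.filter fun h => s h = 1).card = 2 * k := fun s => by
    rw [card_filter_add_card_filter, hH]
  have hbound : ∀ j : ℕ, 2 * k < j → ∀ ε : K, ε = 1 ∨ ε = -1 → ∀ v,
      diagDer K H (matH K) v = (ε * j) • v → v = 0 := by
    intro j hj ε hε v hv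
    refine (tensorBasis K H).repr.injective (Finsupp.ext fun s => ?_)
    rw [map_zero, Finsupp.zero_apply]
    by_contra hs
    have h1 := weight_eq_of_apply_eq_smul _ diagDer_matH hv hs
    have h2 := hle s
    rcases hε with rfl | rfl
    · rw [one_mul, sub_eq_iff_eq_add] at h1
      have h3 : (Finset.univ.filter fun h => s h = 0).card =
        j + (Finset.univ.filter fun h => s h = 1).card := by exact_mod_cast h1
      omega
    · rw [neg_one_mul, sub_eq_iff_eq_add, neg_add_eq_sub, eq_sub_iff_add_eq] at h1
      have h3 : (Finset.univ.filter fun h => s h = 0).card + j =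
        (Finset.univ.filter fun h => s h = 1).card := by exact_mod_cast h1
      omega
  rw [diagInvariants, finrank_invariants (B := 2 * k)]
  · rw [finrank_eigenspace_of_diagonal _ diagDer_matH, finrank_eigenspace_of_diagonal _ diagDer_matH,
      ← hH, ← card_filter_card_filter_eq k, ← card_filter_card_filter_eq (k - 1)]
    congr 2
    · ext s
      simp only [Finset.mem_filter, Finset.mem_univ, true_and]
      have h2 := hle s
      rw [sub_eq_zero, Nat.cast_inj]
      omega
    -- Weight 2 means `k - 1` entries equal to 1; positivity of `k` keeps the truncated subtraction
    -- honest.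
    · ext s
      simp only [Finset.mem_filter, Finset.mem_univ, true_and]
      have h2 := hle s
      rw [sub_eq_iff_eq_add, show (2 : K) = (2 : ℕ) by norm_num, ← Nat.cast_add, Nat.cast_inj]
      omega
  · rw [diagDer_lie, ← diagDer_smul]
    congr 1
    ext i j
    fin_cases i <;> fin_cases j <;> simp [matE, matH]; norm_num
  · rw [diagDer_lie, ← diagDer_smul]
    congr 1
    ext i j
    fin_cases i <;> fin_cases j <;> simp [matF, matH]; norm_num
  · rw [diagDer_lie]
    congr 1
    simp [matE, matF, matH]
  · exact fun j hj v hv => hbound j hj 1 (Or.inl rfl) v (by rwa [one_mul])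
  · exact fun j hj v hv => hbound j hj (-1) (Or.inr rfl) v (by rwa [neg_one_mul])

end SingleFactor

/-! ### Common kernels in a tensor power -/

section Product

variable {K C M : Type*} [Field K] [DecidableEq C] [AddCommGroup M] [Module K M]

theorem exists_comp_eq_of_ker_le {N L : Type*} [AddCommGroup N] [Module K N] [AddCommGroup L]
    [Module K L] (f : M →ₗ[K] N) (g : M →ₗ[K] L) (h : LinearMap.ker f ≤ LinearMap.ker g) :
    ∃ u : N →ₗ[K] L, u ∘ₗ f = g := by
  obtain ⟨u, hu⟩ := LinearMap.exists_extend
    ((LinearMap.ker f).liftQ g h ∘ₗ f.quotKerEquivRange.symm.toLinearMap)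
  refine ⟨u, LinearMap.ext fun x => ?_⟩
  have h1 := LinearMap.congr_fun hu ⟨f x, x, rfl⟩
  simp only [LinearMap.comp_apply, Submodule.subtype_apply, LinearEquiv.coe_coe] at h1
  rw [LinearMap.comp_apply, h1]
  have h2 : f.quotKerEquivRange.symm ⟨f x, x, rfl⟩ = Submodule.Quotient.mk x := by
    rw [LinearEquiv.symm_apply_eq]
    rfl
  rw [h2]
  rfl

variable (K M) in
/-- An endomorphism of `M` acting on the factor `c` of a tensor power of `M`. -/
def slotMap (c : C) : Module.End K M →ₗ[K] Module.End K (⨂[K] _ : C, M) where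
  toFun A := PiTensorProduct.map (Function.update (fun _ => LinearMap.id) c A)
  map_add' _ _ := PiTensorProduct.map_update_add _ _ _ _
  map_smul' _ _ := PiTensorProduct.map_update_smul _ _ _ _

theorem slotMap_apply (c : C) (A : Module.End K M) : slotMap K M c A =
    PiTensorProduct.map (Function.update (fun _ => LinearMap.id) c A) := rfl

theorem slotMap_one (c : C) : slotMap K M c 1 = 1 := by
  have h : Function.update (fun _ => LinearMap.id) c (1 : Module.End K M) =
      fun _ : C => LinearMap.id := Function.update_eq_self c _
  rw [slotMap_apply, h]
  exact PiTensorProduct.map_id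

theorem slotMap_comp_map {N : Type*} [AddCommGroup N] [Module K N] (c : C) (A : Module.End K M)
    (f : C → N →ₗ[K] M) : slotMap K M c A ∘ₗ PiTensorProduct.map f =
      PiTensorProduct.map (Function.update f c (A ∘ₗ f c)) := by
  rw [slotMap_apply, ← PiTensorProduct.map_comp]
  congr 1
  ext c' : 1
  by_cases h : c' = c
  · subst h; simp
  · simp [h]

theorem slotMap_mul (c : C) (A B : Module.End K M) :
    slotMap K M c (A * B) = slotMap K M c A * slotMap K M c B := by
  change slotMap K M c (A ∘ₗ B) = slotMap K M c A ∘ₗ slotMap K M c B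
  rw [slotMap_apply c B, slotMap_comp_map, slotMap_apply]
  simp

/-- The tensors killed in each factor by a finite family of operators form the tensor power of the
common kernel. -/
theorem finrank_iInf_ker_slotMap [Fintype C] [FiniteDimensional K M] {J : Type*} [Finite J]
    (A : J → Module.End K M) :
    Module.finrank K (⨅ c : C, ⨅ j, LinearMap.ker (slotMap K M c (A j)) :
      Submodule K (⨂[K] _ : C, M)) =
      Module.finrank K (⨅ j, LinearMap.ker (A j) : Submodule K M) ^ Fintype.card C := by
  classical
  have := Fintype.ofFinite J
  set U : Submodule K M := ⨅ j, LinearMap.ker (A j) with hU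
  have hUA : ∀ j, A j ∘ₗ U.subtype = 0 := fun j => LinearMap.ext fun x =>
    (Submodule.mem_iInf _).1 x.2 j
  obtain ⟨π, hπ⟩ := U.subtype.exists_leftInverse_of_injective U.ker_subtype
  -- With `π` a projection onto the common kernel `U`, the map `1 - π` kills `U` and so factors
  -- through the operators `A j`. Hence a tensor killed by all `A j` in slot `c` is fixed by `π` in
  -- that slot.
  obtain ⟨B, hB⟩ := exists_comp_eq_of_ker_le (LinearMap.pi A) (1 - U.subtype ∘ₗ π) (by
    intro x hx
    have hxU : x ∈ U := (Submodule.mem_iInf _).2 fun j => congrFun hx j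
    have := LinearMap.congr_fun hπ ⟨x, hxU⟩
    rw [LinearMap.mem_ker, LinearMap.sub_apply, LinearMap.comp_apply]
    have h2 : π x = ⟨x, hxU⟩ := this
    simp [h2])
  have hB' : (1 : Module.End K M) = U.subtype ∘ₗ π +
      ∑ j, (B ∘ₗ LinearMap.single K (fun _ : J => M) j) * A j := by
    rw [← sub_eq_iff_eq_add', ← hB]
    ext x
    simp only [LinearMap.comp_apply, LinearMap.sum_apply, Module.End.mul_apply]
    rw [← map_sum]
    congr 1
    ext j
    simp
  set i : (⨂[K] _ : C, U) →ₗ[K] ⨂[K] _ : C, M := PiTensorProduct.map fun _ => U.subtype with hi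
  have hinj : Function.Injective i := by
    refine Function.LeftInverse.injective (g := PiTensorProduct.map fun _ => π) fun t => ?_
    rw [hi, ← LinearMap.comp_apply, ← PiTensorProduct.map_comp]
    simp only [hπ, PiTensorProduct.map_id, LinearMap.id_apply]
  have hrange : (⨅ c : C, ⨅ j, LinearMap.ker (slotMap K M c (A j)) :
      Submodule K (⨂[K] _ : C, M)) = LinearMap.range i := by
    apply le_antisymm
    · intro t ht
      simp only [Submodule.mem_iInf, LinearMap.mem_ker] at ht
      have h1 : ∀ c, slotMap K M c (U.subtype ∘ₗ π) t = t := by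
        intro c
        have h2 := congrArg (fun D => slotMap K M c D t) hB'
        simp only [slotMap_one, Module.End.one_apply, map_add, map_sum, slotMap_mul,
          LinearMap.add_apply, LinearMap.sum_apply, Module.End.mul_apply, ht, map_zero,
          Finset.sum_const_zero, add_zero] at h2
        exact h2.symm
      -- Projecting the slots one after another shows that `t` comes from the tensor power of `U`.
      have h3 : ∀ S : Finset C, PiTensorProduct.map
          (fun c => if c ∈ S then U.subtype ∘ₗ π else LinearMap.id) t = t := by
        intro S
        induction S using Finset.induction_on with
        | empty => simp [PiTensorProduct.map_id]
        | insert c S hc ih =>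
          have h4 := congrArg (fun D => D t) (slotMap_comp_map (K := K) c (U.subtype ∘ₗ π)
            fun c => if c ∈ S then U.subtype ∘ₗ π else LinearMap.id)
          simp only [LinearMap.comp_apply, ih, h1] at h4
          nth_rw 2 [h4]
          congr 2
          ext c' : 1
          by_cases h : c' = c
          · subst h; simp [hc]
          · simp [h]
      have h5 := h3 Finset.univ
      simp only [Finset.mem_univ, if_true] at h5
      rw [PiTensorProduct.map_comp] at h5
      exact ⟨_, h5⟩
    · rintro _ ⟨t, rfl⟩
      simp only [Submodule.mem_iInf, LinearMap.mem_ker]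
      intro c j
      rw [← LinearMap.comp_apply, hi, slotMap_comp_map, hUA]
      have := PiTensorProduct.map_update_smul (R := K) (fun _ : C => U.subtype) c (0 : K) 0
      rw [zero_smul, zero_smul] at this
      rw [this, LinearMap.zero_apply]
  rw [hrange, LinearMap.finrank_range_of_inj hinj,
    Module.finrank_eq_card_basis (Basis.piTensorProduct fun _ : C => Module.finBasis K U)]
  simp

end Product

/-! ### Tensor powers over a product as iterated tensor powers -/

section Nested

variable {K C H : Type*} [Field K] [DecidableEq C] [DecidableEq H]

variable (K C H) in
/-- Pure tensors indexed by a product, as iterated pure tensors. -/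
def nestTprod : MultilinearMap K (fun _ : C × H => Fin 2 → K) (⨂[K] _ : C, TensorPow K H) :=
  have key : ∀ [DecidableEq (C × H)] (x : C × H → Fin 2 → K) (i : C × H) (y : Fin 2 → K),
      (fun c => PiTensorProduct.tprod K fun h => Function.update x i y (c, h)) =
        Function.update (fun c => PiTensorProduct.tprod K fun h => x (c, h)) i.1
          (PiTensorProduct.tprod K (Function.update (fun h => x (i.1, h)) i.2 y)) := by
    intro _ x i y
    ext c : 1
    by_cases hc : c = i.1
    · subst hc
      rw [Function.update_self]
      congr 1
      ext h : 1
      by_cases hh : h = i.2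
      · subst hh; simp
      · rw [Function.update_of_ne hh, Function.update_of_ne fun e => hh (congrArg Prod.snd e)]
    · rw [Function.update_of_ne hc]
      congr 1
      ext h : 1
      rw [Function.update_of_ne fun e => hc (congrArg Prod.fst e)]
  { toFun := fun x => PiTensorProduct.tprod K fun c => PiTensorProduct.tprod K fun h => x (c, h)
    map_update_add' := by
      intro inst x i y z
      simp only [key, MultilinearMap.map_update_add]
    map_update_smul' := by
      intro inst x i t y
      simp only [key, MultilinearMap.map_update_smul] }

variable (K C H) in
/-- Iterating tensor powers. -/
def nest : TensorPow K (C × H) →ₗ[K] ⨂[K] _ : C, TensorPow K H :=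
  PiTensorProduct.lift (nestTprod K C H)

theorem nest_tprod (x : C × H → Fin 2 → K) : nest K C H (PiTensorProduct.tprod K x) =
    PiTensorProduct.tprod K fun c => PiTensorProduct.tprod K fun h => x (c, h) := by
  rw [nest, PiTensorProduct.lift.tprod]
  rfl

theorem nest_tensorAct (g : C × H → Mat2 K) : nest K C H ∘ₗ tensorAct g =
    PiTensorProduct.map (fun c => tensorAct fun h => g (c, h)) ∘ₗ nest K C H := by
  refine PiTensorProduct.ext (MultilinearMap.ext fun x => ?_)
  simp only [LinearMap.compMultilinearMap_apply, LinearMap.comp_apply, tensorAct_tprod, nest_tprod,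
    PiTensorProduct.map_tprod]

variable [Fintype C] [Fintype H]

theorem nest_bijective : Function.Bijective (nest K C H) := by
  have h : nest K C H = ((tensorBasis K (C × H)).equiv
      (Basis.piTensorProduct fun _ : C => tensorBasis K H) (Equiv.curry C H (Fin 2))).toLinearMap := by
    refine (tensorBasis K (C × H)).ext fun s => ?_
    rw [LinearEquiv.coe_coe, Module.Basis.equiv_apply, Basis.piTensorProduct_apply,
      tensorBasis_apply, nest_tprod]
    congr 1
    ext c : 1
    rw [tensorBasis_apply]
    rfl
  rw [h]
  exact LinearEquiv.bijective _

theorem nest_tensorDer (X : C → Mat2 K) (v : TensorPow K (C × H)) :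
    nest K C H (tensorDer (fun i => X i.1) v) =
      ∑ c, slotMap K (TensorPow K H) c (diagDer K H (X c)) (nest K C H v) := by
  have h1 : ∀ (c : C) (h : H) (y : Mat2 K),
      nest K C H (tensorAct (Function.update 1 (c, h) y) v) =
        slotMap K (TensorPow K H) c (tensorAct (Function.update 1 h y)) (nest K C H v) := by
    intro c h y
    rw [← LinearMap.comp_apply, nest_tensorAct, slotMap_apply, LinearMap.comp_apply]
    congr 2
    ext c' : 1
    by_cases hc : c' = c
    · subst hc
      rw [Function.update_self]
      congr 1
      ext h' : 1
      by_cases hh : h' = h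
      · subst hh; simp
      · rw [Function.update_of_ne hh, Function.update_of_ne fun e => hh (congrArg Prod.snd e)]
        rfl
    · rw [Function.update_of_ne hc]
      refine Eq.trans ?_ tensorAct_one
      congr 1
      ext h' : 1
      rw [Function.update_of_ne fun e => hc (congrArg Prod.fst e)]
      rfl
  rw [tensorDer_apply, LinearMap.sum_apply, map_sum, Fintype.sum_prod_type]
  refine Finset.sum_congr rfl fun c _ => ?_
  rw [diagDer, tensorDer_apply, map_sum, LinearMap.sum_apply]
  exact Finset.sum_congr rfl fun h _ => h1 c h _

variable (K) in
/-- The standard basis of `sl_2`. -/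
def slBasis : Fin 3 → Mat2 K := ![matE K, matF K, matH K]

/-- Tuples supported at a single `c` separate the factors, and linearity reduces the condition at
`c` to the standard basis of `sl_2`. -/
theorem map_nest_slInvariants : (slInvariants K C H).map (nest K C H) =
    ⨅ c : C, ⨅ j, LinearMap.ker (slotMap K (TensorPow K H) c (diagDer K H (slBasis K j))) := by
  ext w
  obtain ⟨v, rfl⟩ := nest_bijective.2 w
  have h0 : nest K C H v ∈ (slInvariants K C H).map (nest K C H) ↔ v ∈ slInvariants K C H :=
    nest_bijective.1.mem_set_image
  rw [h0, mem_slInvariants]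
  simp only [Submodule.mem_iInf, LinearMap.mem_ker]
  constructor
  · intro h c j
    have h1 := congrArg (nest K C H) (h (Pi.single c (slBasis K j)) fun c' => by
      by_cases hc : c' = c
      · subst hc
        rw [Pi.single_eq_same]
        fin_cases j <;> simp [slBasis, matE, matF, matH, Matrix.trace_fin_two]
      · rw [Pi.single_eq_of_ne hc, Matrix.trace_zero])
    rw [nest_tensorDer, map_zero, Finset.sum_eq_single c, Pi.single_eq_same] at h1
    · exact h1
    · intro c' _ hc
      rw [Pi.single_eq_of_ne hc, show diagDer K H 0 = 0 from map_zero tensorDer, map_zero,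
        LinearMap.zero_apply]
    · simp
  · intro h X hX
    refine nest_bijective.1 ?_
    rw [nest_tensorDer, map_zero]
    refine Finset.sum_eq_zero fun c _ => ?_
    have h1 : X c = X c 0 1 • matE K + X c 1 0 • matF K + X c 0 0 • matH K := by
      have h2 := hX c
      rw [Matrix.trace_fin_two] at h2
      ext i j
      fin_cases i <;> fin_cases j <;> simp [matE, matF, matH]
      exact (neg_eq_of_add_eq_zero_right h2).symm
    have h3 : diagDer K H (X c) = X c 0 1 • diagDer K H (matE K) + X c 1 0 • diagDer K H (matF K) +
        X c 0 0 • diagDer K H (matH K) := by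
      rw [← diagDer_smul, ← diagDer_smul, ← diagDer_smul]
      refine (congrArg (diagDer K H) h1).trans ?_
      exact ((map_add tensorDer _ _).trans (congrArg (· + _) (map_add tensorDer _ _)))
    have hE := h c 0
    have hF := h c 1
    have hH := h c 2
    simp only [slBasis, Matrix.cons_val_zero, Matrix.cons_val_one, Matrix.cons_val] at hE hF hH
    simp only [h3, map_add, map_smul, LinearMap.add_apply, LinearMap.smul_apply, hE, hF, hH,
      smul_zero, add_zero]

/-- The dimension of the space of tensors invariant under a product of copies of `sl_2`. -/
theorem finrank_slInvariants [CharZero K] {k : ℕ} (hk : 0 < k) (hH : Fintype.card H = 2 * k) :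
    Module.finrank K (slInvariants K C H) =
      ((2 * k).choose k - (2 * k).choose (k - 1)) ^ Fintype.card C := by
  have : FiniteDimensional K (TensorPow K H) := Module.Finite.of_basis (tensorBasis K H)
  have h : ⨅ j, LinearMap.ker (diagDer K H (slBasis K j)) = diagInvariants K H := by
    ext v
    simp [diagInvariants, Submodule.mem_iInf, Fin.forall_fin_succ, slBasis, and_assoc]
  rw [(Submodule.equivMapOfInjective _ nest_bijective.1 (slInvariants K C H)).finrank_eq,
    map_nest_slInvariants, finrank_iInf_ker_slotMap fun j => diagDer K H (slBasis K j),
    ← finrank_diagInvariants (K := K) hk hH, h]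

end Nested

/-- If the envelope of the image of a group contains `SL_2`, so does the envelope of the image of
any subgroup of finite index. -/
theorem SLsub_le_algebraicEnvelope_map {K Γ : Type*} [Field K] [CharZero K] [Group Γ]
    {f : Γ →* GL (Fin 2) K} (h : SLsub 2 K ≤ algebraicEnvelope f.range) (U : Subgroup Γ)
    [U.FiniteIndex] : SLsub 2 K ≤ algebraicEnvelope (U.map f) := by
  refine SLsub_le_algebraicEnvelope_of_relIndex h ?_
  rw [MonoidHom.range_eq_map, Subgroup.relIndex_map_map]
  intro h
  have h1 := Subgroup.index_eq_zero_of_relIndex_eq_zero h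
  have h2 := Subgroup.index_dvd_of_le (le_sup_left : U ≤ U ⊔ f.ker)
  exact Subgroup.FiniteIndex.index_ne_zero (Nat.eq_zero_of_zero_dvd (h1 ▸ h2))

/-! ### A Galois element regular in all factors -/

section Regular

variable {K : Type*} [Field K]

/-- A function on two-by-two matrices that vanishes unless the discriminant is nonzero and the
`n`-th power is nonscalar. -/
def regFun (n : ℕ) (y : Mat2 K) : K :=
  (y.trace ^ 2 - 4 * y.det) * ((y ^ n) 0 0 - (y ^ n) 1 1)

theorem regFun_eq (n : ℕ) (y : Mat2 K) : regFun n y = ((y 0 0 + y 1 1) * (y 0 0 + y 1 1) -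
    4 * (y 0 0 * y 1 1 - y 0 1 * y 1 0)) * ((y ^ n) 0 0 - (y ^ n) 1 1) := by
  rw [regFun, Matrix.trace_fin_two, Matrix.det_fin_two, sq]

theorem isPolyFun_regFun (n : ℕ) : IsPolyFun fun y : Mat2 K => regFun n y := by
  simp only [regFun_eq]
  have e := fun i j => IsPolyFun.entry (K := K) (n := 2) i j
  have p := fun i j => IsPolyFun.pow_entry (K := K) (n := 2) (φ := fun x => x) IsPolyFun.entry n i j
  exact (((((e 0 0).add (e 1 1)).mul ((e 0 0).add (e 1 1))).sub ((IsPolyFun.const 4).mul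
    (((e 0 0).mul (e 1 1)).sub ((e 0 1).mul (e 1 0)))))).mul ((p 0 0).sub (p 1 1))

theorem continuous_regFun [TopologicalSpace K] [IsTopologicalRing K] (n : ℕ) :
    Continuous fun y : GL (Fin 2) K => regFun n (y : Mat2 K) := by
  have h : Continuous fun y : Mat2 K => regFun n y := by
    unfold regFun
    have h1 : Continuous fun y : Mat2 K => y ^ n := continuous_pow n
    exact ((continuous_id.matrix_trace.pow 2).sub
      (continuous_const.mul continuous_id.matrix_det)).mul
      ((h1.matrix_elem 0 0).sub (h1.matrix_elem 1 1))
  exact h.comp Units.continuous_val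

/-- The coset `g SL_2` consists of all matrices with the determinant of `g`. It contains `diag (2d,
d/2)` with `d² = det g`, whose eigenvalue ratio 4 is not a root of unity. -/
theorem exists_regFun_ne_zero [CharZero K] [IsAlgClosed K] (g : GL (Fin 2) K) {n : ℕ} (hn : 0 < n) :
    ∃ x ∈ SLsub 2 K, regFun n ((g : Mat2 K) * (x : Mat2 K)) ≠ 0 := by
  obtain ⟨d, hd⟩ := IsAlgClosed.exists_pow_nat_eq (g : Mat2 K).det two_pos
  have hg : (g : Mat2 K).det ≠ 0 := ((Matrix.isUnit_iff_isUnit_det _).1 g.isUnit).ne_zero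
  have hd0 : d ≠ 0 := by
    rintro rfl
    exact hg (by rw [← hd]; simp)
  let y : Mat2 K := Matrix.diagonal ![d * 2, d * 2⁻¹]
  have hy : y.det = (g : Mat2 K).det := by
    rw [← hd, Matrix.det_diagonal]
    simp
    field_simp
  obtain ⟨x, hx, hxy, -⟩ := mem_SLsub_of_det (x := ((g⁻¹ : GL (Fin 2) K) : Mat2 K) * y) (by
    rw [Matrix.det_mul, hy, ← Matrix.det_mul, ← Units.val_mul, inv_mul_cancel]
    simp)
  refine ⟨x, hx, ?_⟩
  rw [hxy, ← mul_assoc, ← Units.val_mul, mul_inv_cancel, Units.val_one, one_mul]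
  have hdisc : y.trace ^ 2 - 4 * y.det = d ^ 2 * (9 / 4) := by
    rw [hy, ← hd, Matrix.trace_diagonal, Fin.sum_univ_two]
    simp
    ring
  rw [regFun, hdisc, Matrix.diagonal_pow]
  refine mul_ne_zero (mul_ne_zero (pow_ne_zero _ hd0) (by norm_num)) ?_
  simp only [Matrix.diagonal_apply_eq, Pi.pow_apply, Matrix.cons_val_zero, Matrix.cons_val_one,
    mul_pow, ← mul_sub]
  refine mul_ne_zero (pow_ne_zero _ hd0) fun h => ?_
  rw [sub_eq_zero, inv_pow] at h
  have h1 : (2 : K) ^ n * 2 ^ n = 1 := by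
    nth_rw 1 [h]
    exact inv_mul_cancel₀ (pow_ne_zero _ two_ne_zero)
  rw [← mul_pow] at h1
  have h2 : (2 * 2) ^ n = 1 := by exact_mod_cast h1
  simp at h2
  omega

variable {Γ C : Type*} [Group Γ] [TopologicalSpace Γ] [IsTopologicalGroup Γ] [CompactSpace Γ]
  [TotallyDisconnectedSpace Γ] [Finite C] [CharZero K] [IsAlgClosed K]
  [TopologicalSpace K] [IsTopologicalRing K] [T1Space K]

/-- Given finitely many continuous representations of a profinite group whose envelopes contain
`SL_2`, some element of the group has regular image of infinite projective order in all of them. -/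
theorem exists_regular (ρ : C → Γ →ₜ* GL (Fin 2) K)
    (henv : ∀ c, SLsub 2 K ≤ algebraicEnvelope (ρ c).toMonoidHom.range) :
    ∃ γ, ∀ c, (ρ c γ : Mat2 K).trace ^ 2 - 4 * (ρ c γ : Mat2 K).det ≠ 0 ∧
      ∀ n, 0 < n → IsNonscalar ((ρ c γ : Mat2 K) ^ n) := by
  suffices h : ∃ γ, ∀ c (n : ℕ), regFun (n + 1) (ρ c γ : Mat2 K) ≠ 0 by
    obtain ⟨γ, hγ⟩ := h
    refine ⟨γ, fun c => ⟨left_ne_zero_of_mul (hγ c 0), fun n hn => Or.inr (Or.inr ?_)⟩⟩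
    obtain ⟨n, rfl⟩ := Nat.exists_eq_succ_of_ne_zero hn.ne'
    exact sub_ne_zero.1 (right_ne_zero_of_mul (hγ c n))
  by_contra! hcon
  -- Baire's theorem is applied on the compact group, not on `K`. If every element failed, one of
  -- countably many closed failure sets would contain a coset `g U` with `U` open. The polynomial
  -- condition would then spread to `ρ c g` times the envelope of the image of `U`, hence to `ρ c g`
  -- times `SL_2`.
  obtain ⟨⟨c, n⟩, g, hg⟩ := nonempty_interior_of_iUnion_of_closed
    (f := fun i : C × ℕ => {γ : Γ | regFun (i.2 + 1) (ρ i.1 γ : Mat2 K) = 0})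
    (fun i => isClosed_singleton.preimage
      ((continuous_regFun (i.2 + 1)).comp (ρ i.1).continuous_toFun))
    (Set.eq_univ_of_forall fun γ => by
      obtain ⟨c, n, h⟩ := hcon γ
      exact Set.mem_iUnion.2 ⟨(c, n), h⟩)
  obtain ⟨S, hS, hSo, hgS⟩ := mem_interior.1 hg
  obtain ⟨U, hU⟩ := ProfiniteGrp.exist_openNormalSubgroup_sub_open_nhds_of_one
    (hSo.preimage (continuous_const_mul g)) (by simpa using hgS)
  have hUfin : U.toSubgroup.FiniteIndex := by
    have := Subgroup.quotient_finite_of_isOpen U.toSubgroup U.isOpen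
    exact Subgroup.finiteIndex_of_finite_quotient
  have henvU := SLsub_le_algebraicEnvelope_map (henv c) U.toSubgroup
  obtain ⟨x, hx, hne⟩ := exists_regFun_ne_zero (ρ c g) n.succ_pos
  refine hne (((isPolyFun_regFun (n + 1)).mul_left _).eq_zero_of_mem_algebraicEnvelope _ ?_ (henvU hx))
  rintro _ ⟨u, hu, rfl⟩
  have := hS (hU hu)
  rw [← Units.val_mul]
  have h2 : ρ c g * (ρ c).toMonoidHom u = ρ c (g * u) := (map_mul (ρ c) g u).symm
  rw [h2]
  exact this

end Regular

/-! ### One-dimensional subrepresentations and joint eigenvectors -/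

section OneDim

variable {K Γ V : Type*} [Field K] [Group Γ] [AddCommGroup V] [Module K V]
  {σ : Representation K Γ V}

theorem IsOneDim.exists_eq_smul {W : Subrepresentation σ} (hW : IsOneDim W) {v : V}
    (hv : v ∈ W.toSubmodule) (γ : Γ) : ∃ t : K, σ γ v = t • v := by
  by_cases h0 : v = 0
  · exact ⟨0, by simp [h0]⟩
  · obtain ⟨t, ht⟩ := (finrank_eq_one_iff_of_nonzero' (⟨v, hv⟩ : W.toSubmodule)
      (by simpa [Subtype.ext_iff] using h0)).1 hW ⟨σ γ v, W.apply_mem_toSubmodule γ hv⟩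
    exact ⟨t, (congrArg Subtype.val ht).symm⟩

/-- Nonzero joint eigenvectors span exactly the one-dimensional subrepresentations. The hypothesis
asks that, together with zero, they form a subspace, so their sum adds nothing new. -/
theorem numOneDim_eq_finrank {S : Submodule K V}
    (hS : ∀ v, v ∈ S ↔ ∀ γ, ∃ t : K, σ γ v = t • v) : numOneDim σ = Module.finrank K S := by
  have h : (⨆ W : {W : Subrepresentation σ // IsOneDim W}, W.1.toSubmodule) = S := by
    apply le_antisymm
    · exact iSup_le fun W v hv => (hS v).2 (W.2.exists_eq_smul hv)
    · intro v hv
      by_cases h0 : v = 0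
      · rw [h0]
        exact zero_mem _
      · let W : Subrepresentation σ := ⟨K ∙ v, fun γ w hw => by
          obtain ⟨u, rfl⟩ := Submodule.mem_span_singleton.1 hw
          obtain ⟨t, ht⟩ := (hS v).1 hv γ
          rw [map_smul, ht]
          exact Submodule.smul_mem _ _ (Submodule.smul_mem _ _ (Submodule.mem_span_singleton_self v))⟩
        exact Submodule.mem_iSup_of_mem (p := fun W : {W : Subrepresentation σ // IsOneDim W} =>
          W.1.toSubmodule) ⟨W, finrank_span_singleton h0⟩ (Submodule.mem_span_singleton_self v)
  rw [numOneDim, h]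

theorem IsOneDim.nonempty_equiv_charRep {W : Subrepresentation σ} (hW : IsOneDim W) {ψ : Γ →* Kˣ}
    (h : ∀ v ∈ W.toSubmodule, ∀ γ, σ γ v = (ψ γ : K) • v) :
    Nonempty (W.toRepresentation.Equiv (charRep ψ)) := by
  have : Module.Finite K W.toSubmodule := Module.finite_of_finrank_eq_succ hW
  let e : W.toSubmodule ≃ₗ[K] K :=
    LinearEquiv.ofFinrankEq _ _ (Eq.trans hW (Module.finrank_self K).symm)
  refine ⟨Representation.Equiv.mk e fun γ => LinearMap.ext fun v => ?_⟩
  have h1 : W.toRepresentation γ v = (ψ γ : K) • v := Subtype.ext (h v v.2 γ)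
  change e (W.toRepresentation γ v) = (ψ γ : K) * e v
  rw [h1, map_smul, smul_eq_mul]

end OneDim

/-! ### Changing indices and coordinates in a tensor power -/

section Untwist

variable {K Z I : Type*} [Field K]

/-- Reindexing a tensor power and changing coordinates in its factors. -/
def untwist (e : I ≃ Z) (a : I → GL (Fin 2) K) : TensorPow K Z →ₗ[K] TensorPow K I :=
  tensorAct (fun i => (a i : Mat2 K)) ∘ₗ
    (PiTensorProduct.reindex K (fun _ : Z => Fin 2 → K) e.symm).toLinearMap

theorem untwist_bijective (e : I ≃ Z) (a : I → GL (Fin 2) K) :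
    Function.Bijective (untwist e a) := by
  have h : ∀ a b : I → GL (Fin 2) K, b * a = 1 → Function.LeftInverse
      (tensorAct fun i => (b i : Mat2 K)) (tensorAct fun i => (a i : Mat2 K)) := by
    intro a b hab v
    rw [← Module.End.mul_apply, ← tensorAct_mul]
    have h1 : ((fun i => (b i : Mat2 K)) * fun i => (a i : Mat2 K)) = 1 := by
      ext1 i
      exact congrArg Units.val (congrFun hab i)
    rw [h1, tensorAct_one, Module.End.one_apply]
  have h2 : Function.Bijective (tensorAct fun i => (a i : Mat2 K)) :=
    ⟨(h a a⁻¹ (inv_mul_cancel a)).injective, (h a⁻¹ a (mul_inv_cancel a)).surjective⟩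
  exact h2.comp (LinearEquiv.bijective _)

theorem untwist_tensorAct [Fintype I] (e : I ≃ Z) (a : I → GL (Fin 2) K) {x : Z → Mat2 K} {y : I → Mat2 K}
    {t : I → K} (h : ∀ i, t i • y i * (a i : Mat2 K) = (a i : Mat2 K) * x (e i)) (v : TensorPow K Z) :
    untwist e a (tensorAct x v) = (∏ i, t i) • tensorAct y (untwist e a v) := by
  suffices H : untwist e a ∘ₗ tensorAct x = (∏ i, t i) • tensorAct y ∘ₗ untwist e a from
    LinearMap.congr_fun H v
  refine PiTensorProduct.ext (MultilinearMap.ext fun u => ?_)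
  simp only [LinearMap.compMultilinearMap_apply, LinearMap.comp_apply, LinearMap.smul_apply, untwist,
    tensorAct_tprod, LinearEquiv.coe_coe, PiTensorProduct.reindex_tprod]
  rw [← MultilinearMap.map_smul_univ]
  congr 1
  ext1 i
  rw [Equiv.symm_symm, Matrix.mulVec_mulVec, Matrix.mulVec_mulVec, ← Matrix.smul_mulVec, ← h,
    Matrix.smul_mul]

end Untwist

/-! ### Projective equivalence, normal subgroups and twists -/

section Projective

variable {K Γ : Type*} [Field K]

theorem mk_eq_mk_iff_smul {x y : GL (Fin 2) K} :
    Matrix.ProjGenLinGroup.mk x = Matrix.ProjGenLinGroup.mk y ↔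
      ∃ t : K, (x : Mat2 K) = t • (y : Mat2 K) := by
  rw [eq_comm, Matrix.ProjGenLinGroup.mk_eq_mk_iff]
  constructor
  · rintro ⟨u, rfl⟩
    refine ⟨u, ?_⟩
    ext i j
    simp [Matrix.GeneralLinearGroup.scalar, mul_comm]
  · rintro ⟨t, ht⟩
    have ht0 : t ≠ 0 := by
      rintro rfl
      have := x.isUnit
      rw [ht, zero_smul] at this
      exact not_isUnit_zero this
    refine ⟨Units.mk0 t ht0, Units.ext ?_⟩
    rw [ht]
    ext i j
    simp [Matrix.GeneralLinearGroup.scalar, mul_comm]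

variable [Group Γ]

/-- Two homomorphisms to `GL_2` that agree projectively on a normal subgroup on which the envelope
contains `SL_2` agree projectively. -/
theorem mk_eq_mk_of_normal [CharZero K] {f g : Γ →* GL (Fin 2) K} {N : Subgroup Γ} [hN : N.Normal]
    (henv : SLsub 2 K ≤ algebraicEnvelope (N.map f))
    (h : ∀ n ∈ N, Matrix.ProjGenLinGroup.mk (g n) = Matrix.ProjGenLinGroup.mk (f n)) (γ : Γ) :
    Matrix.ProjGenLinGroup.mk (g γ) = Matrix.ProjGenLinGroup.mk (f γ) := by
  -- `f γ` and `g γ` induce the same projective conjugation on the image of `N`, so their quotient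
  -- commutes up to scalars with a group whose envelope contains `SL_2`.
  have h1 : ¬IsNonscalar (((f γ)⁻¹ * g γ : GL (Fin 2) K) : Mat2 K) := by
    refine not_isNonscalar_of_commute henv
      ((Matrix.isUnit_iff_isUnit_det _).1 ((f γ)⁻¹ * g γ).isUnit).ne_zero ?_
    rintro _ ⟨n, hn, rfl⟩
    simp only [← Units.val_mul]
    rw [← mk_eq_mk_iff_smul]
    have h2 := h _ (hN.conj_mem n hn γ)
    simp only [map_mul, map_inv, h n hn] at h2 ⊢
    rw [mul_inv_eq_iff_eq_mul] at h2
    rw [mul_assoc, h2]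
    group
  rw [not_isNonscalar_iff] at h1
  have h3 : Matrix.ProjGenLinGroup.mk ((f γ)⁻¹ * g γ) = Matrix.ProjGenLinGroup.mk 1 :=
    mk_eq_mk_iff_smul.2 ⟨_, by rw [Units.val_one]; exact h1⟩
  rw [map_mul, map_inv, map_one, inv_mul_eq_one] at h3
  exact h3.symm

end Projective

section Twist

variable {Γ K : Type*} [Group Γ] [TopologicalSpace Γ] [Field K] [TopologicalSpace K]

theorem IsIso.trans {ρ₁ ρ₂ ρ₃ : Γ →ₜ* GL (Fin 2) K} (h : IsIso ρ₁ ρ₂) (h' : IsIso ρ₂ ρ₃) :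
    IsIso ρ₁ ρ₃ := by
  obtain ⟨a, ha⟩ := h
  obtain ⟨b, hb⟩ := h'
  exact ⟨b * a, fun g => by rw [hb, ha]; group⟩

/-- The character is the scalar by which a conjugate of `ρ₁` differs from `ρ₂`. It is multiplicative
because scalars are central, and continuous because it and its inverse are matrix entries of
continuous functions. -/
theorem exists_isIso_twist [IsTopologicalRing K] {ρ₁ ρ₂ : Γ →ₜ* GL (Fin 2) K}
    (h : ProjEquiv ρ₁ ρ₂) : ∃ χ : Γ →ₜ* Kˣ, IsIso ρ₁ (twist ρ₂ χ) := by
  obtain ⟨a, ha⟩ := h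
  obtain ⟨a, rfl⟩ := Matrix.ProjGenLinGroup.mk_surjective a
  have h1 : ∀ g, ∃ u : Kˣ, Matrix.GeneralLinearGroup.scalar (Fin 2) u = a * ρ₁ g * a⁻¹ * (ρ₂ g)⁻¹ := by
    intro g
    have h2 := ha g
    rw [← map_inv, ← map_mul, ← map_mul] at h2
    obtain ⟨u, hu⟩ := Matrix.ProjGenLinGroup.mk_eq_mk_iff.1 h2
    refine ⟨u, ?_⟩
    rw [eq_mul_inv_iff_mul_eq, ← hu]
    ext i j
    simp [Matrix.GeneralLinearGroup.scalar, mul_comm]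
  choose χ hχ using h1
  have hinj : Function.Injective (Matrix.GeneralLinearGroup.scalar (Fin 2) : Kˣ → GL (Fin 2) K) := by
    intro u v huv
    have := congrArg (fun x : GL (Fin 2) K => (x : Mat2 K) 0 0) huv
    exact Units.ext (by simpa [Matrix.GeneralLinearGroup.scalar] using this)
  have hcomm : ∀ (u : Kˣ) (x : GL (Fin 2) K), x * Matrix.GeneralLinearGroup.scalar (Fin 2) u =
      Matrix.GeneralLinearGroup.scalar (Fin 2) u * x := by
    intro u x
    ext i j
    simp [Matrix.GeneralLinearGroup.scalar, mul_comm]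
  have hχ' : ∀ g, Matrix.GeneralLinearGroup.scalar (Fin 2) (χ g) * ρ₂ g = a * ρ₁ g * a⁻¹ := by
    intro g
    rw [hχ, inv_mul_cancel_right]
  have hcont : Continuous fun g => Matrix.GeneralLinearGroup.scalar (Fin 2) (χ g) := by
    simp only [hχ]
    exact ((continuous_const.mul ρ₁.continuous_toFun).mul continuous_const).mul
      ρ₂.continuous_toFun.inv
  let χ₀ : Γ →* Kˣ := MonoidHom.mk' χ fun g g' => hinj (by
    have e := hχ' (g * g')
    rw [map_mul, map_mul] at e
    have e' : a * (ρ₁ g * ρ₁ g') * a⁻¹ = (a * ρ₁ g * a⁻¹) * (a * ρ₁ g' * a⁻¹) := by group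
    rw [e', ← hχ', ← hχ', mul_assoc (Matrix.GeneralLinearGroup.scalar (Fin 2) (χ g)),
      ← mul_assoc (ρ₂ g), hcomm, mul_assoc _ (ρ₂ g), ← mul_assoc, ← mul_assoc] at e
    rw [map_mul]
    exact mul_right_cancel (mul_right_cancel (by simpa only [mul_assoc] using e)))
  refine ⟨⟨χ₀, ?_⟩, a, hχ'⟩
  refine Units.continuous_iff.2 ⟨?_, ?_⟩
  · have := (Units.continuous_val.comp hcont).matrix_elem 0 0
    simpa [Matrix.GeneralLinearGroup.scalar, Function.comp_def, χ₀] using this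
  · have := (Units.continuous_val.comp hcont.inv).matrix_elem 0 0
    simpa [Matrix.GeneralLinearGroup.scalar, Function.comp_def, χ₀] using this

end Twist

/-! ### Conjugates by Galois elements -/

section Galois

variable {F Ω : Type*} [Field F] [Field Ω] [Algebra F Ω] {E : IntermediateField F Ω} [Normal F E]
  {K : Type*} [Field K] [TopologicalSpace K]

theorem range_conj {A : Type*} [Group A] [TopologicalSpace A] (σ : Gal(Ω/F))
    (ψ : E.fixingSubgroup →ₜ* A) : (conj σ ψ).toMonoidHom.range = ψ.toMonoidHom.range := by
  apply le_antisymm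
  · rintro _ ⟨g, rfl⟩
    exact ⟨conjAut E σ g, rfl⟩
  · rintro _ ⟨g, rfl⟩
    refine ⟨conjAut E σ⁻¹ g, ?_⟩
    change conj σ⁻¹ (conj σ ψ) g = ψ g
    rw [← conj_mul, inv_mul_cancel, conj_one]

theorem isIso_conj_of_restrict_eq {σ τ : Gal(Ω/F)}
    (h : AlgEquiv.restrictNormalHom E σ = AlgEquiv.restrictNormalHom E τ)
    (ρ : E.fixingSubgroup →ₜ* GL (Fin 2) K) : IsIso (conj σ ρ) (conj τ ρ) := by
  have hmem : τ⁻¹ * σ ∈ E.fixingSubgroup := by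
    rw [← IntermediateField.restrictNormalHom_ker E, MonoidHom.mem_ker, map_mul, map_inv, h,
      inv_mul_cancel]
  refine ⟨ρ ⟨_, hmem⟩, fun g => ?_⟩
  rw [conj_apply, conj_apply, ← map_inv, ← map_mul, ← map_mul]
  congr 1
  apply Subtype.ext
  change τ⁻¹ * (g : Gal(Ω/F)) * τ = (τ⁻¹ * σ) * (σ⁻¹ * g * σ) * (τ⁻¹ * σ)⁻¹
  group

theorem IsIso.conj {ρ₁ ρ₂ : E.fixingSubgroup →ₜ* GL (Fin 2) K} (h : IsIso ρ₁ ρ₂) (σ : Gal(Ω/F)) :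
    IsIso (conj σ ρ₁) (conj σ ρ₂) := by
  obtain ⟨a, ha⟩ := h
  exact ⟨a, fun g => ha _⟩

/-- The inclusion of absolute Galois groups, as a continuous homomorphism. -/
def fixingIncl {k : IntermediateField F Ω} (hk : E ≤ k) : k.fixingSubgroup →ₜ* E.fixingSubgroup where
  toMonoidHom := Subgroup.inclusion (IntermediateField.fixingSubgroup_antitone hk)
  continuous_toFun := continuous_inclusion (IntermediateField.fixingSubgroup_antitone hk)

/-- Representatives of the cosets of a subgroup decompose the group as a product. -/
def cosetEquiv {G : Type*} [Group G] {S : Subgroup G} {r : G ⧸ S → G} (hr : ∀ c, (r c : G ⧸ S) = c) :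
    (G ⧸ S) × S ≃ G where
  toFun i := r i.1 * i.2
  invFun g := (g, ⟨(r g)⁻¹ * g, QuotientGroup.eq.1 (hr g)⟩)
  left_inv i := by
    have h : ((r i.1 * i.2 : G) : G ⧸ S) = i.1 := by
      rw [QuotientGroup.mk_mul_of_mem _ i.2.2, hr]
    refine Prod.ext h (Subtype.ext ?_)
    change (r ((r i.1 * i.2 : G) : G ⧸ S))⁻¹ * (r i.1 * i.2) = i.2
    rw [h, inv_mul_cancel_left]
  right_inv g := mul_inv_cancel_left _ _

variable [IsTopologicalRing K]

/-- This is `ρ^{ηξ} ≅ (ρ^ξ)^η ≅ ρ^η ⊗ χ(ξ)^η`. The chosen lifts need not be multiplicative, but two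
lifts of the same element give isomorphic conjugates. -/
theorem exists_conj_mul_eq {ρ : E.fixingSubgroup →ₜ* GL (Fin 2) K} {s : Gal(E/F) → Gal(Ω/F)}
    (hs : ∀ ζ, AlgEquiv.restrictNormalHom E (s ζ) = ζ) (η ξ : Gal(E/F))
    {χ : E.fixingSubgroup →ₜ* Kˣ} (hχ : IsIso (conj (s ξ) ρ) (twist ρ χ)) :
    ∃ a : GL (Fin 2) K, ∀ g, (conj (s η) χ g : K) • (conj (s η) ρ g : Mat2 K) * (a : Mat2 K) =
      (a : Mat2 K) * (conj (s (η * ξ)) ρ g : Mat2 K) := by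
  have h1 : IsIso (conj (s (η * ξ)) ρ) (conj (s η) (conj (s ξ) ρ)) := by
    rw [← conj_mul]
    exact isIso_conj_of_restrict_eq (by rw [map_mul, hs, hs, hs]) ρ
  obtain ⟨a, ha⟩ := h1.trans (hχ.conj (s η))
  refine ⟨a, fun g => ?_⟩
  have h2 := congrArg Units.val (eq_mul_inv_iff_mul_eq.1 (ha g))
  rw [Units.val_mul, Units.val_mul] at h2
  rw [← h2]
  congr 1
  change _ = (Matrix.GeneralLinearGroup.scalar (Fin 2) (χ (conjAut E (s η) g)) *
    ρ (conjAut E (s η) g) : GL (Fin 2) K).val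
  ext i j
  simp [Matrix.GeneralLinearGroup.scalar, conj_apply]

end Galois

/-! ### Compactness and finite index of absolute Galois groups -/

section Absolute

variable {F Ω : Type*} [Field F] [CharZero F] [Field Ω] [Algebra F Ω] [IsAlgClosure F Ω]
  {E : IntermediateField F Ω} {k : IntermediateField F Ω}

theorem compactSpace_fixingSubgroup (k : IntermediateField F Ω) : CompactSpace k.fixingSubgroup := by
  have : IsGalois F Ω := ⟨⟩
  exact isCompact_iff_compactSpace.1 (InfiniteGalois.fixingSubgroup_isClosed k).isCompact

theorem finiteIndex_range_fixingIncl [Normal F E] (hk : E ≤ k) [FiniteDimensional F k] :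
    (fixingIncl hk).toMonoidHom.range.FiniteIndex := by
  have : CompactSpace E.fixingSubgroup := compactSpace_fixingSubgroup E
  have h : IsOpen ((fixingIncl hk).toMonoidHom.range : Set E.fixingSubgroup) := by
    have h1 : ((fixingIncl hk).toMonoidHom.range : Set E.fixingSubgroup) =
        Subtype.val ⁻¹' (k.fixingSubgroup : Set Gal(Ω/F)) := by
      ext g
      constructor
      · rintro ⟨γ, rfl⟩
        exact γ.2
      · exact fun hg => ⟨⟨g, hg⟩, rfl⟩
    rw [h1]
    exact k.fixingSubgroup_isOpen.preimage continuous_subtype_val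
  have := Subgroup.quotient_finite_of_isOpen _ h
  exact Subgroup.finiteIndex_of_finite_quotient

end Absolute

/-! ### Assembly of the proof -/

section Main

variable {F Ω K : Type*} [Field F] [Field Ω] [Algebra F Ω] {E k : IntermediateField F Ω} [Normal F E]
  [Field K] [TopologicalSpace K] {ρ : E.fixingSubgroup →ₜ* GL (Fin 2) K}
  {s : Gal(E/F) → Gal(Ω/F)} {r : Gal(E/F) ⧸ stab ρ → Gal(E/F)}
  {χ : stab ρ → (E.fixingSubgroup →ₜ* Kˣ)}

theorem untwist_resRep [Fintype (Gal(E/F) ⧸ stab ρ)] [Fintype (stab ρ)]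
    (hr : ∀ c, (r c : Gal(E/F) ⧸ stab ρ) = c) (hk : E ≤ k)
    {a : (Gal(E/F) ⧸ stab ρ) × stab ρ → GL (Fin 2) K}
    (ha : ∀ i g, (conj (s (r i.1)) (χ i.2) g : K) • (conj (s (r i.1)) ρ g : Mat2 K) * (a i : Mat2 K) =
      (a i : Mat2 K) * (conj (s (r i.1 * i.2)) ρ g : Mat2 K))
    (γ : k.fixingSubgroup) (v : TensorPow K Gal(E/F)) :
    untwist (cosetEquiv hr) a (resRep hk (tensorRep fun ζ : Gal(E/F) => conj (s ζ) ρ) γ v) =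
      (∏ i : (Gal(E/F) ⧸ stab ρ) × stab ρ, (conj (s (r i.1)) (χ i.2) (fixingIncl hk γ) : K)) •
        tensorAct (fun i => (conj (s (r i.1)) ρ (fixingIncl hk γ) : Mat2 K))
          (untwist (cosetEquiv hr) a v) :=
  untwist_tensorAct (cosetEquiv hr) a (fun i => ha i (fixingIncl hk γ)) v

variable [IsTopologicalRing K]

theorem exists_isIso_twist_of_stab (ρ : E.fixingSubgroup →ₜ* GL (Fin 2) K)
    (hs : ∀ ζ, AlgEquiv.restrictNormalHom E (s ζ) = ζ) :
    ∃ χ : stab ρ → (E.fixingSubgroup →ₜ* Kˣ), ∀ ξ : stab ρ, IsIso (conj (s ξ) ρ) (twist ρ (χ ξ)) :=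
  Classical.skolem.1 fun ξ => exists_isIso_twist ((mem_stab_iff ρ _).1 (by rw [hs]; exact ξ.2))

theorem exists_intertwiner (hs : ∀ ζ, AlgEquiv.restrictNormalHom E (s ζ) = ζ)
    (hχ : ∀ ξ : stab ρ, IsIso (conj (s ξ) ρ) (twist ρ (χ ξ)))
    (r : Gal(E/F) ⧸ stab ρ → Gal(E/F)) :
    ∃ a : (Gal(E/F) ⧸ stab ρ) × stab ρ → GL (Fin 2) K, ∀ i g,
      (conj (s (r i.1)) (χ i.2) g : K) • (conj (s (r i.1)) ρ g : Mat2 K) * (a i : Mat2 K) =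
        (a i : Mat2 K) * (conj (s (r i.1 * i.2)) ρ g : Mat2 K) := by
  choose a ha using fun (c : Gal(E/F) ⧸ stab ρ) (ξ : stab ρ) => exists_conj_mul_eq hs (r c) ξ (hχ ξ)
  exact ⟨fun i => a i.1 i.2, fun i => ha i.1 i.2⟩

theorem resChar_finprod_apply [Fintype (Gal(E/F) ⧸ stab ρ)] [Fintype (stab ρ)] (hk : E ≤ k) (n : ℕ)
    (γ : k.fixingSubgroup) :
    (resChar hk (∏ᶠ c : Gal(E/F) ⧸ stab ρ,
      conj (s (r c)) (detChar ρ ^ n * ∏ᶠ ξ : stab ρ, χ ξ)) γ : K) =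
    (∏ i : (Gal(E/F) ⧸ stab ρ) × stab ρ, (conj (s (r i.1)) (χ i.2) (fixingIncl hk γ) : K)) *
      ∏ c, (conj (s (r c)) ρ (fixingIncl hk γ) : Mat2 K).det ^ n := by
  let ev (g : E.fixingSubgroup) : (E.fixingSubgroup →ₜ* Kˣ) →* Kˣ :=
    { toFun := fun ψ => ψ g, map_one' := rfl, map_mul' := fun _ _ => rfl }
  have hev : ∀ g ψ, ev g ψ = ψ g := fun _ _ => rfl
  change ((∏ᶠ c : Gal(E/F) ⧸ stab ρ,
    conj (s (r c)) (detChar ρ ^ n * ∏ᶠ ξ : stab ρ, χ ξ)) (fixingIncl hk γ) : K) = _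
  rw [finprod_eq_prod_of_fintype, finprod_eq_prod_of_fintype, ← hev, map_prod, Units.coe_prod,
    Fintype.prod_prod_type, ← Finset.prod_mul_distrib]
  refine Finset.prod_congr rfl fun c _ => ?_
  rw [hev, conj_apply, ← hev, map_mul, map_pow, map_prod, Units.val_mul, Units.val_pow_eq_pow_val,
    Units.coe_prod, mul_comm]
  rfl

variable [CharZero K] [IsAlgClosed K]

/-- The twists contribute the characters `χ(ξ)`, and the action on invariants contributes `det ^ n`
for each coset. This gives both half of the count and the formula for the character. -/
theorem resRep_of_untwist_mem_slInvariants [Fintype (Gal(E/F) ⧸ stab ρ)] [Fintype (stab ρ)]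
    [DecidableEq (Gal(E/F) ⧸ stab ρ)] [DecidableEq (stab ρ)]
    (hr : ∀ c, (r c : Gal(E/F) ⧸ stab ρ) = c) (hk : E ≤ k)
    {a : (Gal(E/F) ⧸ stab ρ) × stab ρ → GL (Fin 2) K}
    (ha : ∀ i g, (conj (s (r i.1)) (χ i.2) g : K) • (conj (s (r i.1)) ρ g : Mat2 K) * (a i : Mat2 K) =
      (a i : Mat2 K) * (conj (s (r i.1 * i.2)) ρ g : Mat2 K)) {n : ℕ}
    (hn : Fintype.card (stab ρ) = 2 * n) {v : TensorPow K Gal(E/F)}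
    (hv : untwist (cosetEquiv hr) a v ∈ slInvariants K (Gal(E/F) ⧸ stab ρ) (stab ρ))
    (γ : k.fixingSubgroup) :
    resRep hk (tensorRep fun ζ : Gal(E/F) => conj (s ζ) ρ) γ v =
      (resChar hk (∏ᶠ c : Gal(E/F) ⧸ stab ρ,
        conj (s (r c)) (detChar ρ ^ n * ∏ᶠ ξ : stab ρ, χ ξ)) γ : K) • v := by
  refine (untwist_bijective (cosetEquiv hr) a).1 ?_
  rw [untwist_resRep hr hk ha, map_smul, resChar_finprod_apply,
    tensorAct_of_mem_slInvariants hn hv fun c => conj (s (r c)) ρ (fixingIncl hk γ), smul_smul]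

variable [CharZero F] [IsAlgClosure F Ω] [T1Space K]

theorem untwist_mem_slInvariants [Fintype (Gal(E/F) ⧸ stab ρ)] [Fintype (stab ρ)]
    [DecidableEq (Gal(E/F) ⧸ stab ρ)] [DecidableEq (stab ρ)]
    (hρ : SLsub 2 K ≤ algebraicEnvelope ρ.toMonoidHom.range)
    (hs : ∀ ζ, AlgEquiv.restrictNormalHom E (s ζ) = ζ)
    (hr : ∀ c, (r c : Gal(E/F) ⧸ stab ρ) = c) (hk : E ≤ k) [FiniteDimensional F k]
    {a : (Gal(E/F) ⧸ stab ρ) × stab ρ → GL (Fin 2) K}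
    (ha : ∀ i g, (conj (s (r i.1)) (χ i.2) g : K) • (conj (s (r i.1)) ρ g : Mat2 K) * (a i : Mat2 K) =
      (a i : Mat2 K) * (conj (s (r i.1 * i.2)) ρ g : Mat2 K))
    {v : TensorPow K Gal(E/F)} (hv : ∀ γ, ∃ t : K,
      resRep hk (tensorRep fun ζ : Gal(E/F) => conj (s ζ) ρ) γ v = t • v) :
    untwist (cosetEquiv hr) a v ∈ slInvariants K (Gal(E/F) ⧸ stab ρ) (stab ρ) := by
  have hfin := finiteIndex_range_fixingIncl (E := E) hk
  have henv : ∀ (c : Gal(E/F) ⧸ stab ρ) (U : Subgroup E.fixingSubgroup) [U.FiniteIndex],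
      SLsub 2 K ≤ algebraicEnvelope (U.map (conj (s (r c)) ρ).toMonoidHom) := fun c U _ =>
    SLsub_le_algebraicEnvelope_map (by rwa [range_conj]) U
  let ρ' (c : Gal(E/F) ⧸ stab ρ) : k.fixingSubgroup →ₜ* GL (Fin 2) K :=
    (conj (s (r c)) ρ).comp (fixingIncl hk)
  have henv' : ∀ c, SLsub 2 K ≤ algebraicEnvelope (ρ' c).toMonoidHom.range := by
    intro c
    have h := henv c (fixingIncl hk).toMonoidHom.range
    rwa [MonoidHom.map_range] at h
  refine mem_slInvariants_of_eigenvector (ρ := fun c => (ρ' c).toMonoidHom) henv' ?_ ?_ ?_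
  · rintro c d hcd ⟨b, hb⟩
    refine hcd ?_
    -- An equivalence over `Gal_k` must be extended to `Gal_E`. It holds on the normal core of
    -- `Gal_k`, which has finite index, so `mk_eq_mk_of_normal` applies.
    have h1 : ∀ g, Matrix.ProjGenLinGroup.mk (b⁻¹ * conj (s (r d)) ρ g * b) =
        Matrix.ProjGenLinGroup.mk (conj (s (r c)) ρ g) := by
      refine mk_eq_mk_of_normal (f := (conj (s (r c)) ρ).toMonoidHom)
        (g := (MulAut.conj b⁻¹).toMonoidHom.comp (conj (s (r d)) ρ).toMonoidHom)
        (henv c (fixingIncl hk).toMonoidHom.range.normalCore) ?_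
      intro n hn
      obtain ⟨γ, rfl⟩ := Subgroup.normalCore_le _ hn
      obtain ⟨t, ht⟩ := hb γ
      refine mk_eq_mk_iff_smul.2 ⟨t, ?_⟩
      change ((b⁻¹ * (ρ' d γ) * (b⁻¹)⁻¹ : GL (Fin 2) K) : Mat2 K) = t • (ρ' c γ : Mat2 K)
      rw [inv_inv, mul_assoc, Units.val_mul, Units.val_mul]
      refine (congrArg (fun x : Mat2 K => ((b⁻¹ : GL (Fin 2) K) : Mat2 K) * x) ht).trans ?_
      rw [Matrix.mul_smul, ← Units.val_mul, ← Units.val_mul, inv_mul_cancel_left]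
      rfl
    have h2 : ProjEquiv (conj (s (r c)) ρ) (conj (s (r d)) ρ) := by
      refine ⟨Matrix.ProjGenLinGroup.mk b, fun g => ?_⟩
      rw [← h1, ← map_inv, ← map_mul, ← map_mul]
      congr 1
      group
    -- Transporting the equivalence back by `r d` puts `(r d)⁻¹ * r c` in the stabiliser, so the two
    -- cosets coincide.
    have h3 := h2.conj (s (r d))⁻¹
    rw [← conj_mul, ← conj_mul, inv_mul_cancel, conj_one, ← mem_stab_iff, map_mul, map_inv, hs,
      hs] at h3
    rw [← hr c, ← hr d]
    exact (QuotientGroup.eq.2 h3).symm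
  · have : IsGalois F Ω := ⟨⟩
    have := compactSpace_fixingSubgroup k
    have : TotallyDisconnectedSpace Gal(Ω/F) := inferInstance
    exact exists_regular ρ' henv'
  · intro γ
    obtain ⟨t, ht⟩ := hv γ
    have h1 := untwist_resRep hr hk ha γ v
    rw [ht, map_smul] at h1
    have h2 : (∏ i : (Gal(E/F) ⧸ stab ρ) × stab ρ,
        (conj (s (r i.1)) (χ i.2) (fixingIncl hk γ) : K)) ≠ 0 :=
      Finset.prod_ne_zero_iff.2 fun i _ => Units.ne_zero _
    exact ⟨_, ((eq_inv_smul_iff₀ h2).2 h1.symm).trans (smul_smul _ _ _)⟩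

variable [FiniteDimensional F E]

theorem numOneDim_eq_zero_of_odd (hρ : SLsub 2 K ≤ algebraicEnvelope ρ.toMonoidHom.range)
    (hs : ∀ ζ, AlgEquiv.restrictNormalHom E (s ζ) = ζ) (hk : E ≤ k) [FiniteDimensional F k]
    (hodd : Odd (Nat.card (stab ρ))) :
    numOneDim (resRep hk (tensorRep fun ζ : Gal(E/F) => conj (s ζ) ρ)) = 0 := by
  classical
  have := Fintype.ofFinite (Gal(E/F) ⧸ stab ρ)
  have := Fintype.ofFinite (stab ρ)
  rw [Nat.card_eq_fintype_card] at hodd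
  obtain ⟨χ, hχ⟩ := exists_isIso_twist_of_stab ρ hs
  have hr : ∀ c : Gal(E/F) ⧸ stab ρ, ((Quotient.out c : Gal(E/F)) : Gal(E/F) ⧸ stab ρ) = c :=
    fun c => Quotient.out_eq c
  obtain ⟨a, ha⟩ := exists_intertwiner hs hχ Quotient.out
  rw [numOneDim_eq_finrank (S := ⊥), finrank_bot]
  intro v
  rw [Submodule.mem_bot]
  refine ⟨fun h γ => ⟨0, by simp [h]⟩, fun h => ?_⟩
  have hmem := untwist_mem_slInvariants hρ hs hr hk ha h
  rw [slInvariants_eq_bot_of_odd hodd, Submodule.mem_bot] at hmem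
  exact (untwist_bijective (cosetEquiv hr) a).1 (hmem.trans (map_zero _).symm)

theorem numOneDim_of_card_eq_two_mul (hρ : SLsub 2 K ≤ algebraicEnvelope ρ.toMonoidHom.range)
    (hs : ∀ ζ, AlgEquiv.restrictNormalHom E (s ζ) = ζ) (hk : E ≤ k) [FiniteDimensional F k] {n : ℕ}
    (hn : Nat.card (stab ρ) = 2 * n) :
    numOneDim (resRep hk (tensorRep fun ζ : Gal(E/F) => conj (s ζ) ρ)) =
      ((2 * n).choose n - (2 * n).choose (n - 1)) ^ Nat.card (Gal(E/F) ⧸ stab ρ) := by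
  classical
  have := Fintype.ofFinite (Gal(E/F) ⧸ stab ρ)
  have := Fintype.ofFinite (stab ρ)
  have hn0 : 0 < 2 * n := hn ▸ Nat.card_pos
  rw [Nat.card_eq_fintype_card] at hn
  obtain ⟨χ, hχ⟩ := exists_isIso_twist_of_stab ρ hs
  have hr : ∀ c : Gal(E/F) ⧸ stab ρ, ((Quotient.out c : Gal(E/F)) : Gal(E/F) ⧸ stab ρ) = c :=
    fun c => Quotient.out_eq c
  obtain ⟨a, ha⟩ := exists_intertwiner hs hχ Quotient.out
  have hbij := untwist_bijective (cosetEquiv hr) a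
  set S := slInvariants K (Gal(E/F) ⧸ stab ρ) (stab ρ)
  have h1 : Module.finrank K (S.comap (untwist (cosetEquiv hr) a)) = Module.finrank K S := by
    rw [(Submodule.equivMapOfInjective _ hbij.1 _).finrank_eq,
      Submodule.map_comap_eq_of_surjective hbij.2]
  rw [numOneDim_eq_finrank (S := S.comap (untwist (cosetEquiv hr) a)), h1,
    finrank_slInvariants (by omega) hn, Nat.card_eq_fintype_card]
  exact fun v => ⟨fun h γ => ⟨_, resRep_of_untwist_mem_slInvariants hr hk ha hn h γ⟩,
    untwist_mem_slInvariants hρ hs hr hk ha⟩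

theorem nonempty_equiv_charRep_of_isOneDim
    (hρ : SLsub 2 K ≤ algebraicEnvelope ρ.toMonoidHom.range)
    (hs : ∀ ζ, AlgEquiv.restrictNormalHom E (s ζ) = ζ) (hk : E ≤ k) [FiniteDimensional F k] {n : ℕ}
    (hn : Nat.card (stab ρ) = 2 * n) (hχ : ∀ ξ : stab ρ, IsIso (conj (s ξ) ρ) (twist ρ (χ ξ)))
    (hr : ∀ c, (r c : Gal(E/F) ⧸ stab ρ) = c)
    {W : Subrepresentation (resRep hk (tensorRep fun ζ : Gal(E/F) => conj (s ζ) ρ))}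
    (hW : IsOneDim W) :
    Nonempty (W.toRepresentation.Equiv (charRep (resChar hk
      (∏ᶠ c : Gal(E/F) ⧸ stab ρ, conj (s (r c)) (detChar ρ ^ n * ∏ᶠ ξ : stab ρ, χ ξ))))) := by
  classical
  have := Fintype.ofFinite (Gal(E/F) ⧸ stab ρ)
  have := Fintype.ofFinite (stab ρ)
  rw [Nat.card_eq_fintype_card] at hn
  obtain ⟨a, ha⟩ := exists_intertwiner hs hχ r
  exact hW.nonempty_equiv_charRep fun v hv => resRep_of_untwist_mem_slInvariants hr hk ha hn
    (untwist_mem_slInvariants hρ hs hr hk ha (hW.exists_eq_smul hv))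

end Main

end TensorGalois

end

open TensorGalois in
theorem proposition4p1
    {F Ω : Type*} [Field F] [NumberField F] [Field Ω] [Algebra F Ω] [IsAlgClosure F Ω]
    (E : IntermediateField F Ω) [FiniteDimensional F E] [IsGalois F E]
    (l : ℕ) [Fact l.Prime]
    (ρ : E.fixingSubgroup →ₜ* GL (Fin 2) (PadicAlgCl l))
    (hρ : SLsub 2 (PadicAlgCl l) ≤ algebraicEnvelope ρ.toMonoidHom.range)
    (m : ℕ) (hm : m = Nat.card (stab ρ))
    -- a lift to `Gal(Ω/F)` of every element of `Gal(E/F)`, used to form the conjugates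
    (s : Gal(E/F) → Gal(Ω/F)) (hs : ∀ ζ, AlgEquiv.restrictNormalHom E (s ζ) = ζ) :
    (∃ χ : stab ρ → (E.fixingSubgroup →ₜ* (PadicAlgCl l)ˣ),
      ∀ ξ : stab ρ, IsIso (conj (s ξ) ρ) (twist ρ (χ ξ))) ∧
    ∀ (k : IntermediateField F Ω) (hk : E ≤ k), FiniteDimensional F k →
      (Odd m →
        numOneDim (resRep hk (tensorRep fun ζ : Gal(E/F) => conj (s ζ) ρ)) = 0) ∧
      (Even m →
        numOneDim (resRep hk (tensorRep fun ζ : Gal(E/F) => conj (s ζ) ρ)) =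
          (m.choose (m / 2) - m.choose (m / 2 - 1)) ^ (Module.finrank F E / m) ∧
        ∀ (χ : stab ρ → (E.fixingSubgroup →ₜ* (PadicAlgCl l)ˣ)),
          (∀ ξ : stab ρ, IsIso (conj (s ξ) ρ) (twist ρ (χ ξ))) →
          -- a system of representatives of the cosets
          ∀ r : Gal(E/F) ⧸ stab ρ → Gal(E/F), (∀ c, (r c : Gal(E/F) ⧸ stab ρ) = c) →
          ∀ W : Subrepresentation (resRep hk (tensorRep fun ζ : Gal(E/F) => conj (s ζ) ρ)),
            IsOneDim W →
            Nonempty (W.toRepresentation.Equiv (charRep (resChar hk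
              (∏ᶠ c : Gal(E/F) ⧸ stab ρ,
                conj (s (r c)) (detChar ρ ^ (m / 2) * ∏ᶠ ξ : stab ρ, χ ξ)))))) := by
  refine ⟨exists_isIso_twist_of_stab ρ hs, fun k hk _ => ⟨fun hodd =>
    numOneDim_eq_zero_of_odd hρ hs hk (hm ▸ hodd), fun heven => ?_⟩⟩
  have hm2 : Nat.card (stab ρ) = 2 * (m / 2) := by
    rw [← hm, Nat.two_mul_div_two_of_even heven]
  have hm0 : 0 < m := hm ▸ Nat.card_pos
  refine ⟨?_, fun χ hχ r hr W hW => nonempty_equiv_charRep_of_isOneDim hρ hs hk hm2 hχ hr hW⟩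
  rw [numOneDim_of_card_eq_two_mul hρ hs hk hm2, Nat.two_mul_div_two_of_even heven]
  congr 1
  -- The exponent is the number of cosets, which is `[E : F] / m` by Lagrange; the division is exact
  -- since `m` is positive.
  have h := Subgroup.card_eq_card_quotient_mul_card_subgroup (stab ρ)
  rw [IsGalois.card_aut_eq_finrank, ← hm] at h
  rw [h, Nat.mul_div_cancel _ hm0]
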